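/- Let $D$ be either a smooth, compact, connected Riemannian manifold without boundary, with Riemannian distance $d_D$ and Riemannian volume measure $\mu_D$, normalized so that $\mu_D(D)=1$, or the cube $D=[0,1]^d$ with the Euclidean distance and Lebesgue measure $\mu_D$. Let $\Omega(D)=C([0,1];D)$, with evaluation maps $e_t(\omega)=\omega(t)$, let $\tilde\Omega(D)=\Omega(D)\times D$ with typical element $(\omega,a)$, set $e_t(\omega,a)=\omega(t)$ and $\pi_D(\omega,a)=a$, and let $\Gamma(D)$ be the set of Borel probability measures on $D\times D$ both of whose marginals are $\mu_D$. For $\omega\in\Omega(D)$ put $\mathcal A_1(\omega)=\int_0^1\frac12|\dot\omega(t)|^2\,dt$ if $\omega$ is absolutely continuous and $\mathcal A_1(\omega)=+\infty$ otherwise; for a Borel probability measure $\nu$ on $\tilde\Omega(D)$ put $\mathcal A_1(\nu)=\int\mathcal A_1(\omega)\,d\nu(\omega,a)$. We say that $\nu$ connects $\eta\in\Gamma(D)$ to $\gamma\in\Gamma(D)$ if $$(e_0,\pi_D)_\#\nu=\eta,\qquad (e_1,\pi_D)_\#\nu=\gamma,$$ and that $\nu$ is incompressible if $(e_t)_\#\nu=\mu_D$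 for all $t\in[0,1]$. Let $\overline\delta^2(\eta,\gamma)\in[0,+\infty]$ be the infimum of $\mathcal A_1(\nu)$ over all incompressible $\nu$ connecting $\eta$ to $\gamma$. Equip $C^1([0,1]\times D)$ with the norm $\|f\|_{C^1}=\max\{\sup|f|,\ \sup|\partial_tf|,\ \sup|\nabla_xf|\}$. We say that $\nu$ is almost incompressible if $(e_t)_\#\nu=\rho^\nu(t,\cdot)\,\mu_D$ for all $t\in[0,1]$, for some $\rho^\nu\in C^1([0,1]\times D)$ with $\rho^\nu\ge 0$ and $\|\rho^\nu-1\|_{C^1}\le\frac12$. **Theorem.** For all $\eta,\gamma\in\Gamma(D)$ there exists $p\in\left[C^1([0,1]\times D)\right]^*$ (a bounded linear functional) such that $$\langle p,\rho^\nu-1\rangle+\overline\delta^2(\eta,\gamma)\le\mathcal A_1(\nu)$$ in $(-\infty,+\infty]$ for all almost incompressible $\nu$ connecting $\eta$ to $\gamma$. -/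

import Mathlib

open MeasureTheory Set Bundle
open scoped Manifold ContDiff ENNReal NNReal Topology

noncomputable section

namespace GeneralizedFlow

/-! ### Path space and generalized flows on a domain `D`, over the time interval `[0,1]` -/

section PathSpace

variable {D : Type*} [TopologicalSpace D]

/-- The path space `Ω(D) = C([0,1]; D)` carries the Borel sets of uniform convergence. -/
instance pathMeasurableSpace : MeasurableSpace C(unitInterval, D) := borel _

instance pathBorelSpace : BorelSpace C(unitInterval, D) := ⟨rfl⟩

variable [MeasurableSpace D]

/-- Measure-preserving plans `Γ(D)`: measures on `D × D` both of whose marginals are `μ`. -/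
structure IsPlan (μ : Measure D) (γ : Measure (D × D)) : Prop where
  fst : γ.map Prod.fst = μ
  snd : γ.map Prod.snd = μ

/-- A measure `ν` on `Ω(D) × D`, with typical element `(ω, a)`, connects `η` to `γ` when
`(e₀, π_D)_# ν = η` and `(e₁, π_D)_# ν = γ`. -/
structure Connects (ν : Measure (C(unitInterval, D) × D)) (η γ : Measure (D × D)) : Prop where
  initial : ν.map (fun z => (z.1 0, z.2)) = η
  final : ν.map (fun z => (z.1 1, z.2)) = γ

/-- Incompressibility: `(e_t)_# ν = μ` for every time `t`. -/
def IsIncompressible (μ : Measure D) (ν : Measure (C(unitInterval, D) × D)) : Prop :=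
  ∀ t : unitInterval, ν.map (fun z => z.1 t) = μ

/-- `r` is the density of the flow `ν`: `(e_t)_# ν = r(t, ·) μ` for every time `t`. -/
structure HasDensity (μ : Measure D) (ν : Measure (C(unitInterval, D) × D))
    (r : unitInterval × D → ℝ) : Prop where
  nonneg : ∀ z, 0 ≤ r z
  map_eval : ∀ t : unitInterval,
    ν.map (fun z => z.1 t) = μ.withDensity (fun x => ENNReal.ofReal (r (t, x)))

/-- The action of a flow, given the action `A` of single paths. -/
def flowAction (A : C(unitInterval, D) → ℝ≥0∞) (ν : Measure (C(unitInterval, D) × D)) : ℝ≥0∞ :=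
  ∫⁻ z, A z.1 ∂ν

/-- The squared relaxed distance: the infimum of the action over all incompressible generalized
flows connecting `η` to `γ`. -/
def relaxedDistSq (μ : Measure D) (A : C(unitInterval, D) → ℝ≥0∞) (η γ : Measure (D × D)) :
    ℝ≥0∞ :=
  ⨅ (ν : Measure (C(unitInterval, D) × D)) (_ : IsProbabilityMeasure ν)
    (_ : IsIncompressible μ ν) (_ : Connects ν η γ), flowAction A ν

end PathSpace

/-- The extension of a path `[0,1] → D` to `ℝ`, constant on both sides of `[0,1]`. -/
def extendPath {D : Type*} [TopologicalSpace D] (c : C(unitInterval, D)) : ℝ → D :=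
  Set.IccExtend zero_le_one c

/-! ### Compact Riemannian manifolds without boundary -/

section Manifold

variable {d : ℕ} {M : Type*} [MetricSpace M] [ChartedSpace (EuclideanSpace ℝ (Fin d)) M]
  [RiemannianBundle (fun x : M => TangentSpace (𝓡 d) x)]

variable (d) in
open Classical in
/-- The action `∫₀¹ ½ |ω'(t)|² dt` of a path in a Riemannian manifold, `+∞` if the path is not
absolutely continuous. The norm of `ω'(t)` is the Riemannian norm. -/
def pathAction (c : C(unitInterval, M)) : ℝ≥0∞ :=
  if AbsolutelyContinuousOnInterval (extendPath c) 0 1 then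
    ∫⁻ t in Icc (0 : ℝ) 1,
      2⁻¹ * ‖mfderiv 𝓘(ℝ, ℝ) (𝓡 d) (extendPath c) t (1 : ℝ)‖ₑ ^ 2
  else ⊤

/-- The coordinate vector field `∂ᵢ` of the chart `φ`, at the point with coordinates `y`. -/
def coordVector (φ : OpenPartialHomeomorph M (EuclideanSpace ℝ (Fin d)))
    (y : EuclideanSpace ℝ (Fin d)) (i : Fin d) : TangentSpace (𝓡 d) (φ.symm y) :=
  mfderiv (𝓡 d) (𝓡 d) φ.symm y (EuclideanSpace.single i (1 : ℝ))

/-- The volume density `√(det gᵢⱼ)` in the chart `φ`, where `gᵢⱼ = ⟨∂ᵢ, ∂ⱼ⟩`. -/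
def volumeDensity (φ : OpenPartialHomeomorph M (EuclideanSpace ℝ (Fin d)))
    (y : EuclideanSpace ℝ (Fin d)) : ℝ :=
  √ (Matrix.of fun i j : Fin d => inner ℝ (coordVector φ y i) (coordVector φ y j)).det

/-- The Riemannian volume on the domain of the chart `φ`, as a measure on `M`: the image of
`√(det g) dy` on the target of `φ`. -/
def chartVolume [MeasurableSpace M] (φ : OpenPartialHomeomorph M (EuclideanSpace ℝ (Fin d))) :
    Measure M :=
  ((volume.restrict φ.target).withDensity
    (fun y => ENNReal.ofReal (volumeDensity φ y))).map φ.symm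

variable (d M) in
/-- The Riemannian volume measure. The measures `chartVolume φ` agree on the overlaps of chart
domains, so their least upper bound is the measure on `M` that they define together. -/
def riemannianVolume [MeasurableSpace M] : Measure M :=
  ⨆ x : M, chartVolume (chartAt (EuclideanSpace ℝ (Fin d)) x)

variable (d M) in
/-- The space `C¹([0,1] × M)`, where `[0,1]` is a manifold with boundary. -/
abbrev C1 : Type _ := C^1⟮(𝓡∂ 1).prod (𝓡 d), unitInterval × M; 𝓘(ℝ, ℝ), ℝ⟯

/-- The time derivative (one-sided at `t = 0, 1`). -/
def timeDeriv (f : C1 d M) (z : unitInterval × M) : ℝ :=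
  derivWithin (fun s : ℝ => f (projIcc 0 1 zero_le_one s, z.2)) (Icc 0 1) (z.1 : ℝ)

/-- The space differential, a linear form on the tangent space with its Riemannian norm. -/
def spaceDeriv (f : C1 d M) (z : unitInterval × M) : TangentSpace (𝓡 d) z.2 →L[ℝ] ℝ :=
  mvfderiv (𝓡 d) (fun x : M => f (z.1, x)) z.2

/-- The `C¹` norm `max (sup |f|, sup |∂ₜ f|, sup |∇ₓ f|)`, the smallest of the customary
equivalent `C¹` norms. -/
def c1Norm (f : C1 d M) : ℝ≥0∞ :=
  ⨆ z : unitInterval × M, max ‖f z‖ₑ (max ‖timeDeriv f z‖ₑ ‖spaceDeriv f z‖ₑ)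

end Manifold

/-! ### The unit cube -/

section Cube

variable {d : ℕ}

variable (d) in
/-- The cube `[0,1]^d` in Euclidean space. As a subtype it carries the Euclidean distance. -/
def unitCube : Set (EuclideanSpace ℝ (Fin d)) := {x | ∀ i, x i ∈ Icc (0 : ℝ) 1}

variable (d) in
/-- Lebesgue measure on the cube. -/
def cubeVolume : Measure (unitCube d) := (volume : Measure (EuclideanSpace ℝ (Fin d))).comap (↑)

open Classical in
/-- The action `∫₀¹ ½ |ω'(t)|² dt` of a path in the cube, `+∞` if the path is not absolutely
continuous. -/
def cubePathAction (c : C(unitInterval, unitCube d)) : ℝ≥0∞ :=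
  if AbsolutelyContinuousOnInterval (extendPath c) 0 1 then
    ∫⁻ t in Icc (0 : ℝ) 1,
      2⁻¹ * ‖deriv (fun s => ((extendPath c s).1 : EuclideanSpace ℝ (Fin d))) t‖ₑ ^ 2
  else ⊤

open Classical in
/-- The extension by zero of a function on `[0,1] × [0,1]^d` to `ℝ × ℝ^d`. -/
def cubeExtend (f : unitInterval × unitCube d → ℝ) (z : ℝ × EuclideanSpace ℝ (Fin d)) : ℝ :=
  if h : z.1 ∈ Icc (0 : ℝ) 1 ∧ z.2 ∈ unitCube d then f (⟨z.1, h.1⟩, ⟨z.2, h.2⟩) else 0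

variable (d) in
/-- The space `C¹([0,1] × [0,1]^d)` of functions that are continuously differentiable up to the
boundary. -/
def cubeC1 : Subalgebra ℝ (unitInterval × unitCube d → ℝ) where
  carrier := {f | ContDiffOn ℝ 1 (cubeExtend f) (Icc (0 : ℝ) 1 ×ˢ unitCube d)}
  mul_mem' {f g} hf hg := by
    refine (ContDiffOn.mul hf hg).congr fun z hz => ?_
    have h : z.1 ∈ Icc (0 : ℝ) 1 ∧ z.2 ∈ unitCube d := hz
    simp only [cubeExtend, dif_pos h, Pi.mul_apply]
  add_mem' {f g} hf hg := by
    refine (ContDiffOn.add hf hg).congr fun z hz => ?_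
    have h : z.1 ∈ Icc (0 : ℝ) 1 ∧ z.2 ∈ unitCube d := hz
    simp only [cubeExtend, dif_pos h, Pi.add_apply]
  algebraMap_mem' c := by
    refine (contDiffOn_const (c := c)).congr fun z hz => ?_
    have h : z.1 ∈ Icc (0 : ℝ) 1 ∧ z.2 ∈ unitCube d := hz
    simp only [cubeExtend, dif_pos h]
    rfl

/-- The time derivative (one-sided at `t = 0, 1`). -/
def cubeTimeDeriv (f : cubeC1 d) (z : unitInterval × unitCube d) : ℝ :=
  derivWithin (fun s : ℝ => cubeExtend f.1 (s, z.2)) (Icc 0 1) (z.1 : ℝ)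

/-- The space differential (taken within the cube). -/
def cubeSpaceDeriv (f : cubeC1 d) (z : unitInterval × unitCube d) :
    EuclideanSpace ℝ (Fin d) →L[ℝ] ℝ :=
  fderivWithin ℝ (fun x => cubeExtend f.1 ((z.1 : ℝ), x)) (unitCube d) z.2

/-- The `C¹` norm `max (sup |f|, sup |∂ₜ f|, sup |∇ₓ f|)`. -/
def cubeC1Norm (f : cubeC1 d) : ℝ≥0∞ :=
  ⨆ z : unitInterval × unitCube d, max ‖f.1 z‖ₑ (max ‖cubeTimeDeriv f z‖ₑ ‖cubeSpaceDeriv f z‖ₑ)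

end Cube

end GeneralizedFlow

end

/-! The pairs `(ρ - 1, A(ν) - δ)`, where `δ` is the squared relaxed distance and `ν` runs over the
almost incompressible flows of finite action connecting `η` to `γ`, form a convex set: a mixture of
flows still connects `η` to `γ`, and its density and action are the mixed ones. The pressure is the
slope of a hyperplane through the origin that passes below this set. By a Hahn-Banach argument
(`exists_linearMap_le_of_convex`) it exists, and is bounded, as soon as `A(ν) - δ ≥ -K ‖ρ - 1‖`. If
no such flow exists, `p = 0` will do.

The linear lower bound (`exists_relaxedDistSq_le`) is again obtained by mixing. Let `ν` have density
`1 + f` with `‖f‖ ≤ s`, and suppose that some flow `ν'` with density `1 - (r/s) f` connects `η` to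
`γ` with action at most `C`. The mixture with weights `r/(s+r)` and `s/(s+r)` is incompressible, so
`δ ≤ A(ν) + (s/r) C`. It remains to realize every perturbation of norm at most a fixed `r` with
bounded action (`exists_flow_of_perturbation`). The norm used is weaker than the `C¹` norm: it
involves only the supremum and the Lipschitz constant in time. Without a condition on space
derivatives, perturbations can be cut by indicator functions.

Since `η` and `γ` have marginal `μ`, the perturbations vanish at times `0` and `1` (almost
everywhere), and they can be produced by loops. A set is called flexible when small perturbations
supported in it come from loops of bounded action. Cutoffs in time and concatenation combine such
loops with one incompressible flow of finite action. The latter is obtained from any admissible flow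
of finite action by averaging its density away (`exists_incompressible_flow`).

The construction of loops is `IsPatch.isFlexible`. In a convex coordinate patch, choose `x` and `y`
independently and `m` uniformly in `[0,3]`, and put the particle on the segment from `x` to `y` at
the parameter `m - 1 - u(t,x)` clamped to `[0,1]`. The mass waiting at `x` is `1 + u`, the mass
waiting at `y` is `1 - u`, and the mass in transit does not depend on `u` (`lintegral_clamp`). As
`y` is independent of `x` and `u` has mean zero, the law of the particles at `y` does not depend on
`u` either: only the density at `x` feels the perturbation. Flexible sets that overlap in positive
measure have a flexible union (`IsFlexible.union`), so compactness and connectedness make the whole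
manifold flexible. The cube is a single patch. -/

noncomputable section

namespace GeneralizedFlow

/-! ### Measurability on the path space and couplings of flows -/

section Coupling

variable {D : Type*} [MetricSpace D] [MeasurableSpace D] [BorelSpace D]

theorem measurable_eval (t : unitInterval) : Measurable fun c : C(unitInterval, D) => c t :=
  (continuous_eval_const t).measurable

variable [CompactSpace D]

/-- The Borel sets of the path space are generated by the evaluations. -/
theorem measurable_of_eval {X : Type*} [MeasurableSpace X] {f : X → C(unitInterval, D)}
    (h : ∀ t, Measurable fun x => f x t) : Measurable f := by
  let ev : C(unitInterval, D) → ℕ → D := fun c n => c (TopologicalSpace.denseSeq unitInterval n)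
  have hcont : Continuous ev :=
    continuous_pi fun n => continuous_eval_const _
  have hinj : Function.Injective ev := by
    intro c c' hcc
    refine DFunLike.coe_injective ?_
    refine Continuous.ext_on (TopologicalSpace.denseRange_denseSeq unitInterval) c.continuous
      c'.continuous ?_
    rintro _ ⟨n, rfl⟩
    exact congrFun hcc n
  -- The Lusin-Souslin theorem: a continuous injection between Polish spaces is a Borel embedding.
  have hemb : MeasurableEmbedding ev := hcont.measurableEmbedding hinj
  exact hemb.measurable_comp_iff.1 (measurable_pi_lambda _ fun n => h _)

/-- Two laws on the path space that give the same distribution to the position at time `0` of the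
first path and at time `e` of the second are the marginals of a coupling in which these positions
coincide. The bound on the integral is stated for functions that need not be measurable. -/
theorem exists_coupling {Λ : Measure C(unitInterval, D)} [IsProbabilityMeasure Λ]
    {ν : Measure (C(unitInterval, D) × D)} [IsProbabilityMeasure ν] (e : unitInterval)
    (h : Λ.map (fun c => c 0) = ν.map (fun z => z.1 e)) :
    ∃ Q : Measure ((C(unitInterval, D) × D) × C(unitInterval, D)), IsProbabilityMeasure Q ∧
      Q.map Prod.fst = ν ∧ Q.map Prod.snd = Λ ∧ (∀ᵐ q ∂Q, q.1.1 e = q.2 0) ∧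
      ∀ A : C(unitInterval, D) → ℝ≥0∞, ∫⁻ q, A q.1.1 ∂Q ≤ ∫⁻ z, A z.1 ∂ν := by
  have : Nonempty C(unitInterval, D) := nonempty_of_isProbabilityMeasure Λ
  have hE : Measurable fun z : C(unitInterval, D) × D => z.1 e :=
    (measurable_eval e).comp measurable_fst
  let κ : ProbabilityTheory.Kernel D C(unitInterval, D) :=
    ProbabilityTheory.condDistrib id (fun c : C(unitInterval, D) => c 0) Λ
  -- Given `z`, the second path is drawn from `Λ` conditioned to start at the position of `z` at
  -- time `e`.
  let κ' := κ.comap (fun z : C(unitInterval, D) × D => z.1 e) hE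
  have : ProbabilityTheory.IsMarkovKernel κ := by unfold κ; infer_instance
  have : ProbabilityTheory.IsMarkovKernel κ' := by unfold κ'; infer_instance
  have hjoint : (ν.compProd κ').map (fun q => (q.1.1 e, q.2)) =
      Λ.map (fun c => (c 0, c)) := by
    have h1 := ProbabilityTheory.compProd_map_condDistrib (μ := Λ) (Y := id)
      (mβ := inferInstance)
      (X := fun c : C(unitInterval, D) => c 0) aemeasurable_id
    simp only [id] at h1
    rw [← h1]
    refine Measure.ext_of_lintegral _ fun f hf => ?_
    have hm : Measurable fun q : (C(unitInterval, D) × D) × C(unitInterval, D) =>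
        (q.1.1 e, q.2) := (hE.comp measurable_fst).prodMk measurable_snd
    have hfm : Measurable fun q : (C(unitInterval, D) × D) × C(unitInterval, D) =>
        f (q.1.1 e, q.2) := hf.comp hm
    rw [lintegral_map hf hm, Measure.lintegral_compProd hfm,
      Measure.lintegral_compProd hf, h, lintegral_map (hf.lintegral_kernel_prod_right') hE]
    simp only [κ', ProbabilityTheory.Kernel.comap_apply]
    rfl
  have hm : Measurable fun q : (C(unitInterval, D) × D) × C(unitInterval, D) =>
        (q.1.1 e, q.2) := (hE.comp measurable_fst).prodMk measurable_snd
  have hm' : Measurable fun c : C(unitInterval, D) => (c 0, c) :=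
    (measurable_eval 0).prodMk measurable_id
  refine ⟨ν.compProd κ', inferInstance, Measure.fst_compProd ν κ', ?_, ?_, ?_⟩
  · have := congrArg (Measure.map Prod.snd) hjoint
    rw [Measure.map_map measurable_snd hm, Measure.map_map measurable_snd hm'] at this
    simpa [Function.comp_def] using this
  · have h3 : ∀ᵐ p ∂(Λ.map fun c : C(unitInterval, D) => (c 0, c)), p.1 = p.2 0 := by
      rw [ae_map_iff hm'.aemeasurable]
      · simp
      · exact measurableSet_eq_fun measurable_fst ((measurable_eval 0).comp measurable_snd)
    rw [← hjoint] at h3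
    exact ae_of_ae_map hm.aemeasurable h3
  · intro A
    -- The lower integral of a function that may fail to be measurable is attained by a measurable
    -- minorant, to which disintegration applies. This gives only an inequality, which is the
    -- direction needed.
    obtain ⟨g, hg, hle, heq⟩ := exists_measurable_le_lintegral_eq
      (μ := ν.compProd κ') (fun q => A q.1.1)
    rw [heq, Measure.lintegral_compProd hg]
    refine lintegral_mono fun z => ?_
    calc ∫⁻ c, g (z, c) ∂κ' z ≤ ∫⁻ _, A z.1 ∂κ' z := lintegral_mono fun c => hle (z, c)
      _ = A z.1 := by simp

end Coupling

/-! ### Concatenation of paths -/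

section Concat

variable {D : Type*} [MetricSpace D]

/-- The time `t / τ` of the first path, in a concatenation at time `τ`. -/
def firstTime (τ : ℝ) (t : unitInterval) : unitInterval := projIcc 0 1 zero_le_one (t / τ)

/-- The time `(t - τ) / (1 - τ)` of the second path, in a concatenation at time `τ`. -/
def secondTime (τ : ℝ) (t : unitInterval) : unitInterval :=
  projIcc 0 1 zero_le_one ((t - τ) / (1 - τ))

/-- `c` follows `c₁` up to time `τ`, and then `c₂`. -/
structure IsConcat (τ : ℝ) (c₁ c₂ c : C(unitInterval, D)) : Prop where
  first : ∀ t : unitInterval, (t : ℝ) ≤ τ → c t = c₁ (firstTime τ t)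
  second : ∀ t : unitInterval, τ ≤ (t : ℝ) → c t = c₂ (secondTime τ t)

open Classical in
/-- The concatenation of two paths at time `τ`, and the first path if the paths do not match. -/
def concat (τ : ℝ) (p : C(unitInterval, D) × C(unitInterval, D)) : C(unitInterval, D) :=
  if h : 0 < τ ∧ τ < 1 ∧ p.1 1 = p.2 0 then
    ⟨fun t => if (t : ℝ) ≤ τ then p.1 (firstTime τ t) else p.2 (secondTime τ t), by
      refine Continuous.if_le ?_ ?_ continuous_subtype_val continuous_const ?_
      · exact p.1.continuous.comp (continuous_projIcc.comp (by fun_prop))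
      · exact p.2.continuous.comp (continuous_projIcc.comp (by fun_prop))
      · intro t ht
        have h1 : firstTime τ t = 1 := by
          simp [firstTime, ht, div_self h.1.ne']
        have h2 : secondTime τ t = 0 := by
          simp [secondTime, ht]
        rw [h1, h2, h.2.2]⟩
  else p.1

theorem isConcat_concat {τ : ℝ} (h0 : 0 < τ) (h1 : τ < 1) {p : C(unitInterval, D) × C(unitInterval, D)}
    (h : p.1 1 = p.2 0) : IsConcat τ p.1 p.2 (concat τ p) := by
  have h' : 0 < τ ∧ τ < 1 ∧ p.1 1 = p.2 0 := ⟨h0, h1, h⟩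
  constructor
  · intro t ht
    simp [concat, h', ht]
  · intro t ht
    rcases ht.lt_or_eq with ht | ht
    · simp [concat, h', ht.not_ge]
    · have e1 : firstTime τ t = 1 := by
        simp [firstTime, ← ht, div_self h0.ne']
      have e2 : secondTime τ t = 0 := by
        simp [secondTime, ← ht]
      simp [concat, h', ht.symm.le, e1, e2]

theorem measurable_concat [CompactSpace D] [MeasurableSpace D] [BorelSpace D] (τ : ℝ) :
    Measurable (concat τ : C(unitInterval, D) × C(unitInterval, D) → C(unitInterval, D)) := by
  classical
  refine measurable_of_eval fun t => ?_
  have key : (fun p : C(unitInterval, D) × C(unitInterval, D) => concat τ p t) = fun p =>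
      if 0 < τ ∧ τ < 1 ∧ p.1 1 = p.2 0 then
        (if (t : ℝ) ≤ τ then p.1 (firstTime τ t) else p.2 (secondTime τ t)) else p.1 t := by
    funext p
    by_cases h : 0 < τ ∧ τ < 1 ∧ p.1 1 = p.2 0
    · simp [concat, h]
    · simp only [concat, dif_neg h, if_neg h]
  rw [key]
  refine Measurable.ite ?_ ?_ ((measurable_eval t).comp measurable_fst)
  · by_cases h : 0 < τ ∧ τ < 1
    · have : {p : C(unitInterval, D) × C(unitInterval, D) | 0 < τ ∧ τ < 1 ∧ p.1 1 = p.2 0} =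
          {p | p.1 1 = p.2 0} := by ext p; simp [h]
      rw [this]
      exact measurableSet_eq_fun ((measurable_eval 1).comp measurable_fst)
        ((measurable_eval 0).comp measurable_snd)
    · have : {p : C(unitInterval, D) × C(unitInterval, D) | 0 < τ ∧ τ < 1 ∧ p.1 1 = p.2 0} =
          ∅ := by
        ext p
        simp only [mem_ofPred_eq, mem_empty_iff_false, iff_false]
        tauto
      rw [this]
      exact MeasurableSet.empty
  · by_cases h : (t : ℝ) ≤ τ
    · simpa [h] using! (measurable_eval _).comp measurable_fst
    · simpa [h] using! (measurable_eval _).comp measurable_snd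

@[simp] theorem firstTime_zero (τ : ℝ) : firstTime τ 0 = 0 := by
  simp [firstTime]

@[simp] theorem secondTime_one {τ : ℝ} (h : τ < 1) : secondTime τ 1 = 1 := by
  simp [secondTime, div_self (sub_pos.2 h).ne']

theorem IsConcat.zero {τ : ℝ} {c₁ c₂ c : C(unitInterval, D)} (h : IsConcat τ c₁ c₂ c)
    (h0 : 0 < τ) : c 0 = c₁ 0 := by
  simpa using h.first 0 h0.le

theorem IsConcat.one {τ : ℝ} {c₁ c₂ c : C(unitInterval, D)} (h : IsConcat τ c₁ c₂ c)
    (h1 : τ < 1) : c 1 = c₂ 1 := by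
  simpa [h1] using h.second 1 h1.le

/-- The properties of the action of paths that are used for the construction of flows: constant
paths have no action and the action of a concatenation is controlled by that of its pieces. -/
structure IsPathAction (A : C(unitInterval, D) → ℝ≥0∞) : Prop where
  const : ∀ x : D, A (ContinuousMap.const _ x) = 0
  concat : ∀ τ : ℝ, 0 < τ → τ < 1 → ∃ C : ℝ≥0, ∀ c₁ c₂ c : C(unitInterval, D),
    IsConcat τ c₁ c₂ c → A c ≤ C * (A c₁ + A c₂)

end Concat

end GeneralizedFlow

end

noncomputable section

namespace GeneralizedFlow

/-! ### Flows with prescribed density, and flows of loops -/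

section Flows

variable {D : Type*} [MeasurableSpace D]

/-- The measure `(1 + g) μ`. -/
def perturb (μ : Measure D) (g : D → ℝ) : Measure D :=
  μ.withDensity fun x => ENNReal.ofReal (1 + g x)

theorem perturb_congr_ae {μ : Measure D} {f g : D → ℝ} (h : f =ᵐ[μ] g) :
    perturb μ f = perturb μ g := by
  refine withDensity_congr_ae ?_
  filter_upwards [h] with x hx
  rw [hx]

@[simp] theorem perturb_zero (μ : Measure D) : perturb μ 0 = μ := by
  simp [perturb]

/-- The bounds by `-1` are essential: `ENNReal.ofReal` truncates negative values and is additive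
only on nonnegative ones. -/
theorem perturb_convex {μ : Measure D} {f g : D → ℝ} (hf : Measurable f) (hg : Measurable g)
    (hf1 : ∀ x, -1 ≤ f x) (hg1 : ∀ x, -1 ≤ g x) {a b : ℝ} (ha : 0 ≤ a) (hb : 0 ≤ b)
    (hab : a + b = 1) :
    perturb μ (fun x => a * f x + b * g x) =
      ENNReal.ofReal a • perturb μ f + ENNReal.ofReal b • perturb μ g := by
  have h1 : Measurable fun x => ENNReal.ofReal (1 + f x) := by fun_prop
  have h2 : Measurable fun x => ENNReal.ofReal (1 + g x) := by fun_prop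
  rw [perturb, perturb, perturb, ← withDensity_smul _ h1, ← withDensity_smul _ h2,
    ← withDensity_add_left (h1.const_smul _)]
  congr 1
  funext x
  simp only [Pi.add_apply, Pi.smul_apply, smul_eq_mul]
  rw [← ENNReal.ofReal_mul ha, ← ENNReal.ofReal_mul hb, ← ENNReal.ofReal_add
    (mul_nonneg ha (by linarith [hf1 x])) (mul_nonneg hb (by linarith [hg1 x]))]
  congr 1
  linear_combination -hab

variable [MetricSpace D]

/-- A flow with density `1 + f` that connects `η` to `γ`. -/
structure IsFlow (μ : Measure D) (η γ : Measure (D × D)) (f : unitInterval → D → ℝ)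
    (ν : Measure (C(unitInterval, D) × D)) : Prop where
  prob : IsProbabilityMeasure ν
  map_eval : ∀ t, ν.map (fun z => z.1 t) = perturb μ (f t)
  connects : Connects ν η γ

/-- A law on the space of loops of action at most `C`, with density `1 + g`. -/
structure IsLoopFlow (μ : Measure D) (A : C(unitInterval, D) → ℝ≥0∞) (C : ℝ≥0)
    (g : unitInterval → D → ℝ) (Λ : Measure C(unitInterval, D)) : Prop where
  prob : IsProbabilityMeasure Λ
  map_eval : ∀ t, Λ.map (fun c => c t) = perturb μ (g t)
  ae_loop : ∀ᵐ c ∂Λ, c 0 = c 1 ∧ A c ≤ C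

theorem isProbabilityMeasure_convex {X : Type*} [MeasurableSpace X] {ν₁ ν₂ : Measure X}
    [IsProbabilityMeasure ν₁] [IsProbabilityMeasure ν₂] {a b : ℝ} (ha : 0 ≤ a) (hb : 0 ≤ b)
    (hab : a + b = 1) :
    IsProbabilityMeasure (ENNReal.ofReal a • ν₁ + ENNReal.ofReal b • ν₂) := by
  constructor
  simp [← ENNReal.ofReal_add ha hb, hab]

theorem map_convex {X Y : Type*} [MeasurableSpace X] [MeasurableSpace Y] (ν₁ ν₂ : Measure X)
    {e : X → Y} (he : Measurable e) (a b : ℝ≥0∞) :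
    (a • ν₁ + b • ν₂).map e = a • ν₁.map e + b • ν₂.map e := by
  rw [Measure.map_add _ _ he, Measure.map_smul, Measure.map_smul]

theorem convex_self {X : Type*} [MeasurableSpace X] (ν : Measure X) {a b : ℝ} (ha : 0 ≤ a)
    (hb : 0 ≤ b) (hab : a + b = 1) : ENNReal.ofReal a • ν + ENNReal.ofReal b • ν = ν := by
  rw [← add_smul, ← ENNReal.ofReal_add ha hb, hab]
  simp

theorem flowAction_convex (A : C(unitInterval, D) → ℝ≥0∞) (ν₁ ν₂ : Measure (C(unitInterval, D) × D)) (a b : ℝ≥0∞) :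
    flowAction A (a • ν₁ + b • ν₂) = a * flowAction A ν₁ + b * flowAction A ν₂ := by
  simp [flowAction, lintegral_add_measure, lintegral_smul_measure]

variable [BorelSpace D]
variable {μ : Measure D} {A : C(unitInterval, D) → ℝ≥0∞} {η γ : Measure (D × D)}

theorem IsLoopFlow.convex {C₁ C₂ : ℝ≥0} {g₁ g₂ : unitInterval → D → ℝ}
    {Λ₁ Λ₂ : Measure C(unitInterval, D)} (h₁ : IsLoopFlow μ A C₁ g₁ Λ₁)
    (h₂ : IsLoopFlow μ A C₂ g₂ Λ₂) (hm₁ : ∀ t, Measurable (g₁ t)) (hm₂ : ∀ t, Measurable (g₂ t))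
    (hg₁ : ∀ t x, -1 ≤ g₁ t x) (hg₂ : ∀ t x, -1 ≤ g₂ t x) {a b : ℝ} (ha : 0 ≤ a) (hb : 0 ≤ b)
    (hab : a + b = 1) :
    IsLoopFlow μ A (max C₁ C₂) (fun t x => a * g₁ t x + b * g₂ t x)
      (ENNReal.ofReal a • Λ₁ + ENNReal.ofReal b • Λ₂) := by
  have := h₁.prob
  have := h₂.prob
  refine ⟨isProbabilityMeasure_convex ha hb hab, fun t => ?_, ?_⟩
  · rw [map_convex _ _ (measurable_eval t), h₁.map_eval, h₂.map_eval,
      perturb_convex (hm₁ t) (hm₂ t) (hg₁ t) (hg₂ t) ha hb hab]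
  · rw [ae_add_measure_iff]
    refine ⟨Measure.ae_smul_measure ?_ _, Measure.ae_smul_measure ?_ _⟩
    · filter_upwards [h₁.ae_loop] with c hc
      exact ⟨hc.1, hc.2.trans (by exact_mod_cast le_max_left _ _)⟩
    · filter_upwards [h₂.ae_loop] with c hc
      exact ⟨hc.1, hc.2.trans (by exact_mod_cast le_max_right _ _)⟩

theorem IsFlow.convex {f₁ f₂ : unitInterval → D → ℝ}
    {ν₁ ν₂ : Measure (C(unitInterval, D) × D)} (h₁ : IsFlow μ η γ f₁ ν₁)
    (h₂ : IsFlow μ η γ f₂ ν₂) (hm₁ : ∀ t, Measurable (f₁ t)) (hm₂ : ∀ t, Measurable (f₂ t))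
    (hf₁ : ∀ t x, -1 ≤ f₁ t x) (hf₂ : ∀ t x, -1 ≤ f₂ t x) {a b : ℝ} (ha : 0 ≤ a) (hb : 0 ≤ b)
    (hab : a + b = 1) :
    IsFlow μ η γ (fun t x => a * f₁ t x + b * f₂ t x)
      (ENNReal.ofReal a • ν₁ + ENNReal.ofReal b • ν₂) := by
  have := h₁.prob
  have := h₂.prob
  have he : ∀ t : unitInterval, Measurable fun z : C(unitInterval, D) × D => (z.1 t, z.2) :=
    fun t => ((measurable_eval t).comp measurable_fst).prodMk measurable_snd
  refine ⟨isProbabilityMeasure_convex ha hb hab, fun t => ?_, ?_, ?_⟩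
  · have ht : Measurable fun z : C(unitInterval, D) × D => z.1 t :=
      (measurable_eval t).comp measurable_fst
    rw [map_convex _ _ ht, h₁.map_eval, h₂.map_eval,
      perturb_convex (hm₁ t) (hm₂ t) (hf₁ t) (hf₂ t) ha hb hab]
  · rw [map_convex _ _ (he 0), h₁.connects.initial, h₂.connects.initial,
      convex_self _ ha hb hab]
  · rw [map_convex _ _ (he 1), h₁.connects.final, h₂.connects.final,
      convex_self _ ha hb hab]

variable [CompactSpace D]

/-- Each particle of `ν` first runs a loop that starts at its own initial position, and keeps its
label. Closing the loop brings it back there, so the endpoints, and hence the plans `η` and `γ`, are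
unchanged. The constant `K` comes from `τ` alone. -/
theorem IsFlow.exists_loop_then_flow (hA : IsPathAction A) {τ : ℝ} (h0 : 0 < τ) (h1 : τ < 1) :
    ∃ K : ℝ≥0, ∀ (C : ℝ≥0) (g f : unitInterval → D → ℝ) (Λ : Measure C(unitInterval, D))
      (ν : Measure (C(unitInterval, D) × D)), IsLoopFlow μ A C g Λ → IsFlow μ η γ f ν →
      perturb μ (g 0) = perturb μ (f 0) →
      ∃ ν', IsFlow μ η γ (fun t => if (t : ℝ) ≤ τ then g (firstTime τ t)
        else f (secondTime τ t)) ν' ∧ flowAction A ν' ≤ K * (C + flowAction A ν) := by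
  obtain ⟨K, hK⟩ := hA.concat τ h0 h1
  refine ⟨K, fun C g f Λ ν hΛ hν hgf => ?_⟩
  have := hΛ.prob
  have := hν.prob
  obtain ⟨Q, hQ, hQ1, hQ2, hQe, hQA⟩ := exists_coupling (Λ := Λ) (ν := ν) 0
    (by rw [hΛ.map_eval, hν.map_eval, hgf])
  let F : (C(unitInterval, D) × D) × C(unitInterval, D) → C(unitInterval, D) × D :=
    fun q => (concat τ (q.2, q.1.1), q.1.2)
  have hF : Measurable F := ((measurable_concat τ).comp
    (measurable_snd.prodMk (measurable_fst.comp measurable_fst))).prodMk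
    (measurable_snd.comp measurable_fst)
  have hloop : ∀ᵐ q ∂Q, q.2 0 = q.2 1 ∧ A q.2 ≤ C := by
    rw [← hQ2] at hΛ
    exact ae_of_ae_map measurable_snd.aemeasurable hΛ.ae_loop
  have hcat : ∀ᵐ q ∂Q, IsConcat τ q.2 q.1.1 (F q).1 := by
    filter_upwards [hloop, hQe] with q h2 h3
    exact isConcat_concat h0 h1 (p := (q.2, q.1.1)) (by rw [← h2.1, h3])
  have he : ∀ t : unitInterval, Measurable fun z : C(unitInterval, D) × D => (z.1 t, z.2) :=
    fun t => ((measurable_eval t).comp measurable_fst).prodMk measurable_snd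
  have he' : ∀ t : unitInterval, Measurable fun z : C(unitInterval, D) × D => z.1 t :=
    fun t => (measurable_eval t).comp measurable_fst
  refine ⟨Q.map F, ⟨Measure.isProbabilityMeasure_map hF.aemeasurable, fun t => ?_, ?_, ?_⟩, ?_⟩
  · rw [Measure.map_map (he' t) hF]
    split_ifs with ht
    · rw [← hΛ.map_eval, ← hQ2, Measure.map_map (measurable_eval _) measurable_snd]
      refine Measure.map_congr ?_
      filter_upwards [hcat] with q hq
      exact hq.first t ht
    · rw [← hν.map_eval, ← hQ1, Measure.map_map (he' _) measurable_fst]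
      refine Measure.map_congr ?_
      filter_upwards [hcat] with q hq
      exact hq.second t (not_le.1 ht).le
  · rw [Measure.map_map (he _) hF, ← hν.connects.initial, ← hQ1,
      Measure.map_map (he _) measurable_fst]
    refine Measure.map_congr ?_
    filter_upwards [hcat, hQe] with q hq hqe
    simp only [Function.comp_apply, hq.zero h0, hqe, F]
  · rw [Measure.map_map (he _) hF, ← hν.connects.final, ← hQ1,
      Measure.map_map (he _) measurable_fst]
    refine Measure.map_congr ?_
    filter_upwards [hcat, hQe] with q hq hqe
    simp only [Function.comp_apply, hq.one h1, F]
  · calc flowAction A (Q.map F) ≤ ∫⁻ q, A (F q).1 ∂Q := lintegral_map_le _ _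
      _ ≤ ∫⁻ q, K * (C + A q.1.1) ∂Q := by
        refine lintegral_mono_ae ?_
        filter_upwards [hcat, hloop] with q hq hl
        exact (hK _ _ _ hq).trans (by gcongr; exact hl.2)
      _ = K * (C + ∫⁻ q, A q.1.1 ∂Q) := by
        rw [lintegral_const_mul' _ _ ENNReal.coe_ne_top, lintegral_add_left measurable_const]
        simp
      _ ≤ K * (C + flowAction A ν) := by gcongr; exact hQA A

/-- The mirror image: the loop is attached at the final position, so the coupling is taken at time
`1`. -/
theorem IsFlow.exists_flow_then_loop (hA : IsPathAction A) {τ : ℝ} (h0 : 0 < τ) (h1 : τ < 1) :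
    ∃ K : ℝ≥0, ∀ (C : ℝ≥0) (g f : unitInterval → D → ℝ) (Λ : Measure C(unitInterval, D))
      (ν : Measure (C(unitInterval, D) × D)), IsLoopFlow μ A C g Λ → IsFlow μ η γ f ν →
      perturb μ (g 0) = perturb μ (f 1) →
      ∃ ν', IsFlow μ η γ (fun t => if (t : ℝ) ≤ τ then f (firstTime τ t)
        else g (secondTime τ t)) ν' ∧ flowAction A ν' ≤ K * (C + flowAction A ν) := by
  obtain ⟨K, hK⟩ := hA.concat τ h0 h1
  refine ⟨K, fun C g f Λ ν hΛ hν hgf => ?_⟩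
  have := hΛ.prob
  have := hν.prob
  obtain ⟨Q, hQ, hQ1, hQ2, hQe, hQA⟩ := exists_coupling (Λ := Λ) (ν := ν) 1
    (by rw [hΛ.map_eval, hν.map_eval, hgf])
  let F : (C(unitInterval, D) × D) × C(unitInterval, D) → C(unitInterval, D) × D :=
    fun q => (concat τ (q.1.1, q.2), q.1.2)
  have hF : Measurable F := ((measurable_concat τ).comp
    ((measurable_fst.comp measurable_fst).prodMk measurable_snd)).prodMk
    (measurable_snd.comp measurable_fst)
  have hloop : ∀ᵐ q ∂Q, q.2 0 = q.2 1 ∧ A q.2 ≤ C := by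
    rw [← hQ2] at hΛ
    exact ae_of_ae_map measurable_snd.aemeasurable hΛ.ae_loop
  have hcat : ∀ᵐ q ∂Q, IsConcat τ q.1.1 q.2 (F q).1 := by
    filter_upwards [hQe] with q h3
    exact isConcat_concat h0 h1 (p := (q.1.1, q.2)) h3
  have he : ∀ t : unitInterval, Measurable fun z : C(unitInterval, D) × D => (z.1 t, z.2) :=
    fun t => ((measurable_eval t).comp measurable_fst).prodMk measurable_snd
  have he' : ∀ t : unitInterval, Measurable fun z : C(unitInterval, D) × D => z.1 t :=
    fun t => (measurable_eval t).comp measurable_fst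
  refine ⟨Q.map F, ⟨Measure.isProbabilityMeasure_map hF.aemeasurable, fun t => ?_, ?_, ?_⟩, ?_⟩
  · rw [Measure.map_map (he' t) hF]
    split_ifs with ht
    · rw [← hν.map_eval, ← hQ1, Measure.map_map (he' _) measurable_fst]
      refine Measure.map_congr ?_
      filter_upwards [hcat] with q hq
      exact hq.first t ht
    · rw [← hΛ.map_eval, ← hQ2, Measure.map_map (measurable_eval _) measurable_snd]
      refine Measure.map_congr ?_
      filter_upwards [hcat] with q hq
      exact hq.second t (not_le.1 ht).le
  · rw [Measure.map_map (he _) hF, ← hν.connects.initial, ← hQ1,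
      Measure.map_map (he _) measurable_fst]
    refine Measure.map_congr ?_
    filter_upwards [hcat, hQe] with q hq hqe
    simp only [Function.comp_apply, hq.zero h0, F]
  · rw [Measure.map_map (he _) hF, ← hν.connects.final, ← hQ1,
      Measure.map_map (he _) measurable_fst]
    refine Measure.map_congr ?_
    filter_upwards [hcat, hQe, hloop] with q hq hqe hl
    simp only [Function.comp_apply, hq.one h1, hqe, hl.1, F]
  · calc flowAction A (Q.map F) ≤ ∫⁻ q, A (F q).1 ∂Q := lintegral_map_le _ _
      _ ≤ ∫⁻ q, K * (C + A q.1.1) ∂Q := by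
        refine lintegral_mono_ae ?_
        filter_upwards [hcat, hloop] with q hq hl
        refine (hK _ _ _ hq).trans ?_
        rw [add_comm]
        gcongr
        exact hl.2
      _ = K * (C + ∫⁻ q, A q.1.1 ∂Q) := by
        rw [lintegral_const_mul' _ _ ENNReal.coe_ne_top, lintegral_add_left measurable_const]
        simp
      _ ≤ K * (C + flowAction A ν) := by gcongr; exact hQA A

end Flows

end GeneralizedFlow

end

noncomputable section

namespace GeneralizedFlow

/-! ### Sets in which every small perturbation of the density is realized by loops -/

section Flexible

variable {D : Type*} [MeasurableSpace D]

/-- A perturbation of the density, supported in `S`, bounded by `r`, Lipschitz in time with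
constant `L`, that vanishes at both ends of the time interval. No regularity in space is needed. -/
structure IsPerturbation (μ : Measure D) (S : Set D) (r L : ℝ) (g : unitInterval → D → ℝ) :
    Prop where
  measurable : ∀ t, Measurable (g t)
  bound : ∀ t x, |g t x| ≤ r
  lipschitz : ∀ x (s t : unitInterval), |g s x - g t x| ≤ L * |(s : ℝ) - t|
  zero : ∀ x, g 0 x = 0
  one : ∀ x, g 1 x = 0
  support : ∀ t x, x ∉ S → g t x = 0
  integral : ∀ t, ∫ x, g t x ∂μ = 0

/-- A set in which every perturbation of the density that is small in the uniform norm is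
realized by loops, with a bound on the action that depends on the Lipschitz constant in time. -/
def IsFlexible [MetricSpace D] (μ : Measure D) (A : C(unitInterval, D) → ℝ≥0∞) (S : Set D) :
    Prop :=
  ∃ r > 0, ∀ L : ℝ, ∃ C : ℝ≥0, ∀ g, IsPerturbation μ S r L g → ∃ Λ, IsLoopFlow μ A C g Λ

variable {μ : Measure D} {S T : Set D} {r L : ℝ} {f g : unitInterval → D → ℝ}

theorem IsPerturbation.mono {r' L' : ℝ} (h : IsPerturbation μ S r L g) (hr : r ≤ r')
    (hL : L ≤ L') : IsPerturbation μ S r' L' g :=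
  { h with
    bound := fun t x => (h.bound t x).trans hr
    lipschitz := fun x s t => (h.lipschitz x s t).trans (by gcongr) }

theorem IsPerturbation.integrable [IsFiniteMeasure μ] (h : IsPerturbation μ S r L g)
    (t : unitInterval) : Integrable (g t) μ :=
  Integrable.of_bound (h.measurable t).aestronglyMeasurable r (ae_of_all _ (h.bound t))

theorem IsPerturbation.const_mul (h : IsPerturbation μ S r L g) (a : ℝ) :
    IsPerturbation μ S (|a| * r) (|a| * L) (fun t x => a * g t x) where
  measurable t := (h.measurable t).const_mul a
  bound t x := by
    rw [abs_mul]
    gcongr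
    exact h.bound t x
  lipschitz x s t := by
    rw [← mul_sub, abs_mul, mul_assoc]
    gcongr
    exact h.lipschitz x s t
  zero x := by simp [h.zero]
  one x := by simp [h.one]
  support t x hx := by simp [h.support t x hx]
  integral t := by rw [integral_const_mul, h.integral, mul_zero]

theorem isPerturbation_zero (μ : Measure D) (S : Set D) {r L : ℝ} (hr : 0 ≤ r) (hL : 0 ≤ L) :
    IsPerturbation μ S r L (fun _ _ => 0) := by
  constructor <;> intros <;> simp <;> positivity

/-- Split the perturbation into its parts on `S` and off `S`. Their integrals are opposite but
nonzero, and a multiple of the normalized indicator of `S ∩ T`, which belongs to both sets, corrects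
both. The two families of loops are then averaged. -/
theorem IsFlexible.union [MetricSpace D] [BorelSpace D] [IsProbabilityMeasure μ]
    {A : C(unitInterval, D) → ℝ≥0∞} (hS : MeasurableSet S) (hT : MeasurableSet T)
    (hST : μ (S ∩ T) ≠ 0) (h₁ : IsFlexible μ A S) (h₂ : IsFlexible μ A T) :
    IsFlexible μ A (S ∪ T) := by
  classical
  obtain ⟨r₁, hr₁, h₁⟩ := h₁
  obtain ⟨r₂, hr₂, h₂⟩ := h₂
  set w : ℝ := μ.real (S ∩ T) with hw
  have hw0 : 0 < w := ENNReal.toReal_pos hST (measure_ne_top _ _)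
  -- The factor `2` compensates the weights `1/2` of the average, and `w⁻¹` is the height of the
  -- corrector `χ`. The minimum with `1` in the radius below keeps the densities of both parts
  -- nonnegative.
  set q : ℝ := 2 * (1 + w⁻¹) with hq
  have hq0 : 0 < q := by positivity
  refine ⟨min (min r₁ r₂) 1 / q, by positivity, fun L => ?_⟩
  obtain ⟨C₁, hC₁⟩ := h₁ (q * L)
  obtain ⟨C₂, hC₂⟩ := h₂ (q * L)
  refine ⟨max C₁ C₂, fun g hg => ?_⟩
  set r := min (min r₁ r₂) 1 / q with hr
  let m : unitInterval → ℝ := fun t => ∫ x in S, g t x ∂μ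
  have hmS : ∀ t, |m t| ≤ r := by
    intro t
    have := norm_setIntegral_le_of_norm_le_const (μ := μ) (s := S) (f := g t) (C := r)
      (measure_lt_top _ _) (fun x _ => hg.bound t x)
    refine this.trans ?_
    have h1 : μ.real S ≤ 1 := measureReal_le_one
    have h2 : 0 ≤ r := by positivity
    nlinarith
  -- The mass to be exchanged inherits the Lipschitz bound in time because `μ` has total mass one.
  have hmL : ∀ s t : unitInterval, |m s - m t| ≤ L * |(s : ℝ) - t| := by
    intro s t
    have hb : ∀ x, |g s x - g t x| ≤ L * |(s : ℝ) - t| := fun x => hg.lipschitz x s t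
    have hne : Nonempty D := nonempty_of_isProbabilityMeasure μ
    have h0 : 0 ≤ L * |(s : ℝ) - t| := (abs_nonneg _).trans (hb (Classical.arbitrary D))
    have e : m s - m t = ∫ x in S, (g s x - g t x) ∂μ :=
      (integral_sub (hg.integrable s).integrableOn (hg.integrable t).integrableOn).symm
    rw [e]
    have := norm_setIntegral_le_of_norm_le_const (μ := μ) (s := S)
      (f := fun x => g s x - g t x) (C := L * |(s : ℝ) - t|)
      (measure_lt_top _ _) (fun x _ => hb x)
    refine this.trans ?_
    have h1 : μ.real S ≤ 1 := measureReal_le_one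
    nlinarith
  let χ : D → ℝ := (S ∩ T).indicator fun _ => w⁻¹
  have hχm : Measurable χ := measurable_const.indicator (hS.inter hT)
  have hχ0 : ∀ x, 0 ≤ χ x := fun x => indicator_nonneg (fun _ _ => by positivity) x
  have hχ1 : ∀ x, χ x ≤ w⁻¹ := fun x =>
    indicator_le_self' (fun _ _ => by positivity) x
  have hχi : ∫ x, χ x ∂μ = 1 := by
    rw [integral_indicator (hS.inter hT), setIntegral_const, ← hw, smul_eq_mul,
      mul_inv_cancel₀ hw0.ne']
  have hχI : Integrable χ μ := (integrable_const _).indicator (hS.inter hT)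
  let g₁ : unitInterval → D → ℝ := fun t x => 2 * (S.indicator (g t) x - m t * χ x)
  let g₂ : unitInterval → D → ℝ := fun t x => 2 * (Sᶜ.indicator (g t) x + m t * χ x)
  have hSi : ∀ t, ∫ x, S.indicator (g t) x ∂μ = m t := fun t => integral_indicator hS
  have hSci : ∀ t, ∫ x, Sᶜ.indicator (g t) x ∂μ = -m t := by
    intro t
    rw [integral_indicator hS.compl]
    have := integral_add_compl hS (hg.integrable t)
    rw [hg.integral t] at this
    simp only [m]
    linarith
  have hm0 : ∀ t, (∀ x, g t x = 0) → m t = 0 := fun t h => by simp [m, h]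
  have habs : ∀ (U : Set D) t x, |U.indicator (g t) x| ≤ |g t x| := by
    intro U t x
    by_cases hx : x ∈ U <;> simp [hx]
  have hdiff : ∀ (U : Set D) s t x,
      |U.indicator (g s) x - U.indicator (g t) x| ≤ |g s x - g t x| := by
    intro U s t x
    by_cases hx : x ∈ U <;> simp [hx]
  have hqr : q * r ≤ min (min r₁ r₂) 1 := by
    rw [hr, mul_div_cancel₀ _ hq0.ne']
  have hsum : ∀ a b c k : ℝ, |a| ≤ k → |b| ≤ k → 0 ≤ c → c ≤ w⁻¹ →
      |2 * (a + b * c)| ≤ q * k := by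
    intro a b c k ha hb hc hc'
    rw [abs_mul, abs_two, hq, mul_assoc]
    have : |a + b * c| ≤ (1 + w⁻¹) * k := by
      calc |a + b * c| ≤ |a| + |b * c| := abs_add_le _ _
        _ ≤ k + k * w⁻¹ := by
          rw [abs_mul, abs_of_nonneg hc]
          gcongr
          exact (abs_nonneg _).trans hb
        _ = _ := by ring
    gcongr
  have p₁ : IsPerturbation μ S (q * r) (q * L) g₁ := by
    refine ⟨fun t => ?_, fun t x => ?_, fun x s t => ?_, fun x => ?_, fun x => ?_,
      fun t x hx => ?_, fun t => ?_⟩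
    · exact (((hg.measurable t).indicator hS).sub (hχm.const_mul _)).const_mul _
    · have := hsum (S.indicator (g t) x) (-m t) (χ x) r ((habs S t x).trans (hg.bound t x))
        (by simpa using hmS t) (hχ0 x) (hχ1 x)
      simp only [g₁]
      convert this using 2
      ring
    · have := hsum (S.indicator (g s) x - S.indicator (g t) x) (-(m s - m t)) (χ x)
        (L * |(s : ℝ) - t|) ((hdiff S s t x).trans (hg.lipschitz x s t))
        (by rw [abs_neg]; exact hmL s t) (hχ0 x) (hχ1 x)
      simp only [g₁]
      rw [mul_assoc]
      convert this using 2
      ring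
    · simp [g₁, hm0 0 hg.zero, indicator, hg.zero]
    · simp [g₁, hm0 1 hg.one, indicator, hg.one]
    · have : x ∉ S ∩ T := fun h => hx h.1
      simp [g₁, χ, hx]
    · simp only [g₁]
      rw [integral_const_mul, integral_sub ((hg.integrable t).indicator hS) (hχI.const_mul _),
        hSi, integral_const_mul, hχi]
      ring
  have p₂ : IsPerturbation μ T (q * r) (q * L) g₂ := by
    refine ⟨fun t => ?_, fun t x => ?_, fun x s t => ?_, fun x => ?_, fun x => ?_,
      fun t x hx => ?_, fun t => ?_⟩
    · exact (((hg.measurable t).indicator hS.compl).add (hχm.const_mul _)).const_mul _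
    · exact hsum (Sᶜ.indicator (g t) x) (m t) (χ x) r ((habs Sᶜ t x).trans (hg.bound t x))
        (hmS t) (hχ0 x) (hχ1 x)
    · have := hsum (Sᶜ.indicator (g s) x - Sᶜ.indicator (g t) x) (m s - m t) (χ x)
        (L * |(s : ℝ) - t|) ((hdiff Sᶜ s t x).trans (hg.lipschitz x s t))
        (hmL s t) (hχ0 x) (hχ1 x)
      simp only [g₂]
      rw [mul_assoc]
      convert this using 2
      ring
    · simp [g₂, hm0 0 hg.zero, indicator, hg.zero]
    · simp [g₂, hm0 1 hg.one, indicator, hg.one]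
    · by_cases hxS : x ∈ S
      · simp [g₂, χ, hx, hxS]
      · simp [g₂, χ, hx, hxS, hg.support t x (by simp [hx, hxS])]
    · simp only [g₂]
      rw [integral_const_mul, integral_add ((hg.integrable t).indicator hS.compl)
        (hχI.const_mul _), hSci, integral_const_mul, hχi]
      ring
  obtain ⟨Λ₁, hΛ₁⟩ := hC₁ g₁ (p₁.mono (hqr.trans ((min_le_left _ _).trans (min_le_left _ _)))
    le_rfl)
  obtain ⟨Λ₂, hΛ₂⟩ := hC₂ g₂ (p₂.mono (hqr.trans ((min_le_left _ _).trans (min_le_right _ _)))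
    le_rfl)
  have hone : ∀ {U} {g' : unitInterval → D → ℝ}, IsPerturbation μ U (q * r) (q * L) g' →
      ∀ t x, -1 ≤ g' t x := fun h t x =>
    (abs_le.1 ((h.bound t x).trans (hqr.trans (min_le_right _ _)))).1
  have := hΛ₁.convex hΛ₂ p₁.measurable p₂.measurable (hone p₁) (hone p₂) (a := 1 / 2)
    (b := 1 / 2) (by norm_num) (by norm_num) (by norm_num)
  refine ⟨ENNReal.ofReal (1 / 2) • Λ₁ + ENNReal.ofReal (1 / 2) • Λ₂, ?_⟩
  convert this using 1
  funext t x
  by_cases hxS : x ∈ S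
  · simp [g₁, g₂, hxS]
  · simp [g₁, g₂, hxS]

end Flexible

end GeneralizedFlow

end

noncomputable section

namespace GeneralizedFlow

/-! ### Flows with prescribed density in a flexible domain -/

section FlexibleFlows

variable {D : Type*} [MeasurableSpace D] {μ : Measure D} {S : Set D} {r L : ℝ}
  {f g : unitInterval → D → ℝ}

/-- The affine map of `[0,1]` onto `[0,τ]`. -/
def beforeTime (τ : ℝ) (s : unitInterval) : unitInterval := projIcc 0 1 zero_le_one (τ * s)

/-- The affine map of `[0,1]` onto `[τ,1]`. -/
def afterTime (τ : ℝ) (s : unitInterval) : unitInterval :=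
  projIcc 0 1 zero_le_one (τ + (1 - τ) * s)

theorem abs_projIcc_sub_projIcc (a b : ℝ) :
    |(projIcc (0 : ℝ) 1 zero_le_one a : ℝ) - projIcc (0 : ℝ) 1 zero_le_one b| ≤ |a - b| := by
  rw [coe_projIcc, coe_projIcc]
  refine (abs_max_sub_max_le_max _ _ _ _).trans ?_
  simp only [sub_self, abs_zero]
  refine max_le (abs_nonneg _) ((abs_min_sub_min_le_max _ _ _ _).trans ?_)
  simp

theorem beforeTime_firstTime {τ : ℝ} (h0 : 0 < τ) {t : unitInterval} (ht : (t : ℝ) ≤ τ) :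
    beforeTime τ (firstTime τ t) = t := by
  have h : (t : ℝ) / τ ∈ Icc (0 : ℝ) 1 := ⟨div_nonneg t.2.1 h0.le, (div_le_one h0).2 ht⟩
  rw [beforeTime, firstTime, projIcc_of_mem _ h]
  simp only [mul_div_cancel₀ _ h0.ne']
  exact projIcc_val _ t

theorem afterTime_secondTime {τ : ℝ} (h1 : τ < 1) {t : unitInterval} (ht : τ ≤ (t : ℝ)) :
    afterTime τ (secondTime τ t) = t := by
  have h1' : 0 < 1 - τ := sub_pos.2 h1
  have h : ((t : ℝ) - τ) / (1 - τ) ∈ Icc (0 : ℝ) 1 :=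
    ⟨div_nonneg (sub_nonneg.2 ht) h1'.le, (div_le_one h1').2 (by linarith [t.2.2])⟩
  rw [afterTime, secondTime, projIcc_of_mem _ h]
  simp only [mul_div_cancel₀ _ h1'.ne', add_sub_cancel]
  exact projIcc_val _ t

theorem IsPerturbation.comp_time (h : IsPerturbation μ S r L f) (hL : 0 ≤ L)
    {θ : unitInterval → unitInterval} (hθ : ∀ s t, |(θ s : ℝ) - θ t| ≤ |(s : ℝ) - t|)
    (h0 : ∀ x, f (θ 0) x = 0) (h1 : ∀ x, f (θ 1) x = 0) :
    IsPerturbation μ S r L (fun t => f (θ t)) where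
  measurable _ := h.measurable _
  bound _ := h.bound _
  lipschitz x s t := (h.lipschitz x _ _).trans (mul_le_mul_of_nonneg_left (hθ s t) hL)
  zero := h0
  one := h1
  support _ := h.support _
  integral _ := h.integral _

/-- Stretching `[0,τ]` to `[0,1]` slows time down, so the Lipschitz constant does not grow. -/
theorem IsPerturbation.comp_beforeTime (h : IsPerturbation μ S r L f) (hL : 0 ≤ L) {τ : ℝ}
    (h0 : 0 < τ) (h1 : τ < 1) (hf : ∀ t : unitInterval, τ ≤ (t : ℝ) → ∀ x, f t x = 0) :
    IsPerturbation μ S r L (fun t => f (beforeTime τ t)) := by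
  refine h.comp_time hL (fun s t => (abs_projIcc_sub_projIcc _ _).trans ?_) (fun x => ?_)
    (hf _ ?_)
  · rw [← mul_sub, abs_mul, abs_of_pos h0]
    exact mul_le_of_le_one_left (abs_nonneg _) h1.le
  · simp [beforeTime, h.zero]
  · simp [beforeTime, coe_projIcc]
    exact Or.inr h1.le

theorem IsPerturbation.comp_afterTime (h : IsPerturbation μ S r L f) (hL : 0 ≤ L) {τ : ℝ}
    (h0 : 0 < τ) (h1 : τ < 1) (hf : ∀ t : unitInterval, (t : ℝ) ≤ τ → ∀ x, f t x = 0) :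
    IsPerturbation μ S r L (fun t => f (afterTime τ t)) := by
  refine h.comp_time hL (fun s t => (abs_projIcc_sub_projIcc _ _).trans ?_) (hf _ ?_)
    (fun x => ?_)
  · rw [add_sub_add_left_eq_sub, ← mul_sub, abs_mul, abs_of_pos (sub_pos.2 h1)]
    exact mul_le_of_le_one_left (abs_nonneg _) (by linarith)
  · simp [afterTime, coe_projIcc, h0.le]
  · simp [afterTime, h.one]

/-- The density of two successive flows with densities `1 + f` and `1 + g`. -/
def splice {X : Type*} (τ : ℝ) (f g : unitInterval → X → ℝ) (t : unitInterval) : X → ℝ :=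
  if (t : ℝ) ≤ τ then f (firstTime τ t) else g (secondTime τ t)

theorem abs_clamp_sub_clamp (a b : ℝ) : |max 0 (min 1 a) - max 0 (min 1 b)| ≤ |a - b| := by
  simpa [coe_projIcc] using abs_projIcc_sub_projIcc a b

theorem IsPerturbation.cutoff (h : IsPerturbation μ S r L f) {χ : unitInterval → ℝ}
    (hχ0 : ∀ t, 0 ≤ χ t) (hχ1 : ∀ t, χ t ≤ 1)
    (hχ : ∀ s t : unitInterval, |χ s - χ t| ≤ 3 * |(s : ℝ) - t|) :
    IsPerturbation μ S (2 * r) (6 * r + 2 * L) (fun t x => 2 * (χ t * f t x)) where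
  measurable t := ((h.measurable t).const_mul _).const_mul _
  bound t x := by
    rw [abs_mul, abs_two, abs_mul, abs_of_nonneg (hχ0 t)]
    have := h.bound t x
    have := mul_le_of_le_one_left (abs_nonneg (f t x)) (hχ1 t)
    linarith
  lipschitz x s t := by
    have e : 2 * (χ s * f s x) - 2 * (χ t * f t x) =
        2 * ((χ s - χ t) * f s x + χ t * (f s x - f t x)) := by ring
    have h1 : |(χ s - χ t) * f s x| ≤ 3 * |(s : ℝ) - t| * r := by
      rw [abs_mul]
      have := h.bound s x
      have := hχ s t
      gcongr
    have h2 : |χ t * (f s x - f t x)| ≤ L * |(s : ℝ) - t| := by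
      rw [abs_mul, abs_of_nonneg (hχ0 t)]
      exact (mul_le_of_le_one_left (abs_nonneg _) (hχ1 t)).trans (h.lipschitz x s t)
    rw [e, abs_mul, abs_two]
    have := abs_add_le ((χ s - χ t) * f s x) (χ t * (f s x - f t x))
    linarith
  zero x := by simp [h.zero]
  one x := by simp [h.one]
  support t x hx := by simp [h.support t x hx]
  integral t := by simp [integral_const_mul, h.integral]

/-- Each half runs at double speed, whence `2 * L`. Across the junction, `f` is compared with its
value zero at the end of the first run and at the start of the second. -/
theorem abs_splice_sub_splice {f : unitInterval → D → ℝ} (hf : IsPerturbation μ S r L f)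
    (x : D) (s t : unitInterval) :
    |splice (1 / 2) f f s x - splice (1 / 2) f f t x| ≤ 2 * L * |(s : ℝ) - t| := by
  wlog hst : s ≤ t generalizing s t
  · rw [abs_sub_comm, abs_sub_comm (s : ℝ)]
    exact this t s (le_of_not_ge hst)
  have hst' : (s : ℝ) ≤ t := hst
  have hfirst : ∀ t : unitInterval, (t : ℝ) ≤ 1 / 2 → (firstTime (1 / 2) t : ℝ) = 2 * t := by
    intro t ht
    rw [firstTime, projIcc_of_mem _ ⟨by linarith [t.2.1], by linarith⟩]
    simp
    ring
  have hsecond : ∀ t : unitInterval, ¬(t : ℝ) ≤ 1 / 2 →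
      (secondTime (1 / 2) t : ℝ) = 2 * t - 1 := by
    intro t ht
    rw [secondTime, projIcc_of_mem _ ⟨by rw [le_div_iff₀ (by norm_num)]; linarith, by
      rw [div_le_iff₀ (by norm_num)]; linarith [t.2.2]⟩]
    simp
    ring
  simp only [splice]
  split_ifs with hs ht ht
  · refine (hf.lipschitz x _ _).trans (le_of_eq ?_)
    rw [hfirst s hs, hfirst t ht, ← mul_sub, abs_mul, abs_two]
    ring
  · have h1 := hf.lipschitz x (firstTime (1 / 2) s) 1
    have h2 := hf.lipschitz x 0 (secondTime (1 / 2) t)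
    rw [hf.one, hfirst s hs, sub_zero] at h1
    rw [hf.zero, hsecond t ht, zero_sub, abs_neg] at h2
    simp only [Icc.coe_one, Icc.coe_zero] at h1 h2
    rw [abs_of_nonpos (by linarith : 2 * (s : ℝ) - 1 ≤ 0)] at h1
    rw [abs_of_nonpos (by linarith : (0 : ℝ) - (2 * (t : ℝ) - 1) ≤ 0)] at h2
    rw [abs_of_nonpos (by linarith : (s : ℝ) - t ≤ 0)]
    refine (abs_sub _ _).trans ?_
    linarith
  · exact absurd (hst'.trans ht) hs
  · refine (hf.lipschitz x _ _).trans (le_of_eq ?_)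
    rw [hsecond s hs, hsecond t ht, show 2 * (s : ℝ) - 1 - (2 * t - 1) = 2 * (s - t) by ring,
      abs_mul, abs_two]
    ring

/-- The averaging factor `1/2` cancels the doubled speed: the supremum is halved while the Lipschitz
constant stays `L`. This makes the step iterable. -/
theorem IsPerturbation.splice_half (hf : IsPerturbation μ S r L f) :
    IsPerturbation μ S (r / 2) L (fun t x => 1 / 2 * splice (1 / 2) f f t x) where
  measurable t := by
    refine Measurable.const_mul ?_ _
    unfold splice
    split_ifs <;> exact hf.measurable _
  bound t x := by
    have : |splice (1 / 2) f f t x| ≤ r := by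
      unfold splice
      split_ifs <;> exact hf.bound _ x
    rw [abs_mul, abs_of_pos (by norm_num : (0 : ℝ) < 1 / 2)]
    linarith
  lipschitz x s t := by
    rw [← mul_sub, abs_mul, abs_of_pos (by norm_num : (0 : ℝ) < 1 / 2)]
    linarith [abs_splice_sub_splice hf x s t]
  zero x := by simp [splice, hf.zero]
  one x := by
    have h : ¬((1 : unitInterval) : ℝ) ≤ 1 / 2 := by norm_num
    rw [splice, if_neg h, secondTime_one (by norm_num), hf.one, mul_zero]
  support t x hx := by
    unfold splice
    split_ifs <;> simp [hf.support _ x hx]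
  integral t := by
    unfold splice
    split_ifs <;> simp [integral_const_mul, hf.integral]

theorem one_le_splice {X : Type*} {f g : unitInterval → X → ℝ} (hf : ∀ t x, -1 ≤ f t x)
    (hg : ∀ t x, -1 ≤ g t x) (τ : ℝ) (t : unitInterval) (x : X) : -1 ≤ splice τ f g t x := by
  unfold splice
  split_ifs
  · exact hf _ x
  · exact hg _ x

theorem measurable_splice {f g : unitInterval → D → ℝ} (hf : ∀ t, Measurable (f t))
    (hg : ∀ t, Measurable (g t)) (τ : ℝ) (t : unitInterval) : Measurable (splice τ f g t) := by
  unfold splice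
  split_ifs
  · exact hf _
  · exact hg _

variable [MetricSpace D] [BorelSpace D] [CompactSpace D]
  {A : C(unitInterval, D) → ℝ≥0∞} {η γ : Measure (D × D)}

/-- A perturbation that dies before `τ` is produced by loops on `[0,τ]`; the incompressible flow is
then run on `[τ,1]`. -/
theorem exists_flow_of_support_before (hA : IsPathAction A) {τ : ℝ} (h0 : 0 < τ) (h1 : τ < 1) :
    ∃ K : ℝ≥0, ∀ (r L : ℝ) (C : ℝ≥0) (f : unitInterval → D → ℝ)
      (ν : Measure (C(unitInterval, D) × D)), 0 ≤ L →
      (∀ g, IsPerturbation μ univ r L g → ∃ Λ, IsLoopFlow μ A C g Λ) →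
      IsPerturbation μ univ r L f → (∀ t : unitInterval, τ ≤ (t : ℝ) → ∀ x, f t x = 0) →
      IsFlow μ η γ 0 ν →
      ∃ ν', IsFlow μ η γ f ν' ∧ flowAction A ν' ≤ K * (C + flowAction A ν) := by
  obtain ⟨K, hK⟩ := IsFlow.exists_loop_then_flow (μ := μ) (η := η) (γ := γ) hA h0 h1
  refine ⟨K, fun r L C f ν hL hr hf hft hν => ?_⟩
  obtain ⟨Λ, hΛ⟩ := hr _ (hf.comp_beforeTime hL h0 h1 hft)
  obtain ⟨ν', h, h'⟩ := hK C _ _ Λ ν hΛ hν (by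
    congr 1
    funext x
    simp [beforeTime, hf.zero])
  refine ⟨ν', ?_, h'⟩
  convert h using 1
  funext t
  split_ifs with ht
  · rw [beforeTime_firstTime h0 ht]
  · funext x
    simp [hft t (not_le.1 ht).le]

theorem exists_flow_of_support_after (hA : IsPathAction A) {τ : ℝ} (h0 : 0 < τ) (h1 : τ < 1) :
    ∃ K : ℝ≥0, ∀ (r L : ℝ) (C : ℝ≥0) (f : unitInterval → D → ℝ)
      (ν : Measure (C(unitInterval, D) × D)), 0 ≤ L →
      (∀ g, IsPerturbation μ univ r L g → ∃ Λ, IsLoopFlow μ A C g Λ) →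
      IsPerturbation μ univ r L f → (∀ t : unitInterval, (t : ℝ) ≤ τ → ∀ x, f t x = 0) →
      IsFlow μ η γ 0 ν →
      ∃ ν', IsFlow μ η γ f ν' ∧ flowAction A ν' ≤ K * (C + flowAction A ν) := by
  obtain ⟨K, hK⟩ := IsFlow.exists_flow_then_loop (μ := μ) (η := η) (γ := γ) hA h0 h1
  refine ⟨K, fun r L C f ν hL hr hf hft hν => ?_⟩
  obtain ⟨Λ, hΛ⟩ := hr _ (hf.comp_afterTime hL h0 h1 hft)
  obtain ⟨ν', h, h'⟩ := hK C _ _ Λ ν hΛ hν (by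
    congr 1
    funext x
    refine hft _ ?_ x
    simp [afterTime, coe_projIcc, h0.le])
  refine ⟨ν', ?_, h'⟩
  convert h using 1
  funext t
  split_ifs with ht
  · funext x
    simp [hft t ht]
  · rw [afterTime_secondTime h1 (not_le.1 ht).le]

/-- In a flexible domain, if there is an incompressible flow of finite action then there are flows
with every density close to one, with a bound on their action. -/
theorem exists_flow_of_perturbation (hA : IsPathAction A) (hflex : IsFlexible μ A univ)
    {ν₀ : Measure (C(unitInterval, D) × D)} (hν₀ : IsFlow μ η γ 0 ν₀)
    (hfin : flowAction A ν₀ ≠ ⊤) :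
    ∃ r > 0, r ≤ 1 ∧ ∃ C : ℝ≥0, ∀ f, IsPerturbation μ univ r r f →
      ∃ ν, IsFlow μ η γ f ν ∧ flowAction A ν ≤ C := by
  obtain ⟨r', hr', h⟩ := hflex
  set r := min r' 1 / 2 with hr
  have hr0 : 0 < r := by positivity
  have hrr' : 2 * r ≤ r' := by
    have := min_le_left r' 1
    linarith
  have hr1 : 2 * r ≤ 1 := by
    have := min_le_right r' 1
    linarith
  -- This is the Lipschitz constant of `2 χ f` in `IsPerturbation.cutoff`, with the bound and the
  -- Lipschitz constant of `f` both equal to `r`.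
  obtain ⟨C, hC⟩ := h (6 * r + 2 * r)
  obtain ⟨K₁, hK₁⟩ := exists_flow_of_support_before (μ := μ) (η := η) (γ := γ) hA
    (τ := 2 / 3) (by norm_num) (by norm_num)
  obtain ⟨K₂, hK₂⟩ := exists_flow_of_support_after (μ := μ) (η := η) (γ := γ) hA
    (τ := 1 / 3) (by norm_num) (by norm_num)
  refine ⟨r, hr0, by linarith, (K₁ + K₂) * (C + (flowAction A ν₀).toNNReal), fun f hf => ?_⟩
  -- The incompressible flow needs an interval of time free of perturbation, so `f` is the average
  -- of `2 χ f` and `2 (1 - χ) f`. The first vanishes after `2/3` and the second before `1/3`.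
  let χ : unitInterval → ℝ := fun t => max 0 (min 1 (2 - 3 * (t : ℝ)))
  have hχ : ∀ s t : unitInterval, |χ s - χ t| ≤ 3 * |(s : ℝ) - t| := by
    intro s t
    refine (abs_clamp_sub_clamp _ _).trans (le_of_eq ?_)
    rw [← abs_neg, show -(2 - 3 * (s : ℝ) - (2 - 3 * (t : ℝ))) = 3 * ((s : ℝ) - t) by ring,
      abs_mul]
    norm_num
  have hχ0 : ∀ t, 0 ≤ χ t := fun t => le_max_left _ _
  have hχ1 : ∀ t, χ t ≤ 1 := fun t => max_le zero_le_one (min_le_left _ _)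
  have hχ' : ∀ s t : unitInterval, |(1 - χ s) - (1 - χ t)| ≤ 3 * |(s : ℝ) - t| := by
    intro s t
    rw [sub_sub_sub_cancel_left, abs_sub_comm]
    exact hχ s t
  have p₁ := (hf.cutoff hχ0 hχ1 hχ).mono hrr' le_rfl
  have p₂ := (hf.cutoff (χ := fun t => 1 - χ t) (fun t => sub_nonneg.2 (hχ1 t))
    (fun t => by linarith [hχ0 t]) hχ').mono hrr' le_rfl
  have hL : 0 ≤ 6 * r + 2 * r := by positivity
  obtain ⟨ν₁, hν₁, hA₁⟩ := hK₁ _ _ C _ ν₀ hL hC p₁ (fun t ht x => by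
    have : χ t = 0 := max_eq_left ((min_le_right _ _).trans (by linarith))
    simp [this]) hν₀
  obtain ⟨ν₂, hν₂, hA₂⟩ := hK₂ _ _ C _ ν₀ hL hC p₂ (fun t ht x => by
    have : χ t = 1 := by
      simp only [χ]
      rw [min_eq_left (by linarith), max_eq_right zero_le_one]
    simp [this]) hν₀
  have hone₁ : ∀ t x, -1 ≤ 2 * (χ t * f t x) := fun t x =>
    (abs_le.1 (((hf.cutoff hχ0 hχ1 hχ).bound t x).trans hr1)).1
  have hone₂ : ∀ t x, -1 ≤ 2 * ((1 - χ t) * f t x) := fun t x =>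
    (abs_le.1 (((hf.cutoff (χ := fun t => 1 - χ t) (fun t => sub_nonneg.2 (hχ1 t))
      (fun t => by linarith [hχ0 t]) hχ').bound t x).trans hr1)).1
  refine ⟨ENNReal.ofReal (1 / 2) • ν₁ + ENNReal.ofReal (1 / 2) • ν₂, ?_, ?_⟩
  · convert hν₁.convex hν₂ p₁.measurable p₂.measurable hone₁ hone₂ (a := 1 / 2) (b := 1 / 2)
      (by norm_num) (by norm_num) (by norm_num) using 1
    funext t x
    ring
  · rw [flowAction_convex]
    have h2 : ENNReal.ofReal (1 / 2) ≤ 1 := by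
      rw [ENNReal.ofReal_le_one]
      norm_num
    have e : ((flowAction A ν₀).toNNReal : ℝ≥0∞) = flowAction A ν₀ := ENNReal.coe_toNNReal hfin
    calc _ ≤ 1 * (K₁ * (C + flowAction A ν₀)) + 1 * (K₂ * (C + flowAction A ν₀)) := by
          gcongr
      _ = _ := by
          push_cast
          rw [e]
          ring

/-- A flow with density `1 + f` and loops with density `1 + g` give, by running them one after the
other in both orders, a flow whose density is the average of the densities so obtained. -/
theorem IsFlow.exists_splice_average (hA : IsPathAction A) {r₁ r₂ L₁ L₂ : ℝ} {C : ℝ≥0}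
    {Λ : Measure C(unitInterval, D)} {ν : Measure (C(unitInterval, D) × D)}
    (hf : IsPerturbation μ S r₁ L₁ f) (hr₁ : r₁ ≤ 1) (hg : IsPerturbation μ S r₂ L₂ g)
    (hr₂ : r₂ ≤ 1) (hν : IsFlow μ η γ f ν) (hΛ : IsLoopFlow μ A C g Λ)
    (hfin : flowAction A ν ≠ ⊤) :
    ∃ ν', IsFlow μ η γ (fun t x => 1 / 2 * splice (1 / 2) f g t x +
      1 / 2 * splice (1 / 2) g f t x) ν' ∧ flowAction A ν' ≠ ⊤ := by
  obtain ⟨K₁, hK₁⟩ := IsFlow.exists_flow_then_loop (μ := μ) (η := η) (γ := γ) hA (τ := 1 / 2)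
    (by norm_num) (by norm_num)
  obtain ⟨K₂, hK₂⟩ := IsFlow.exists_loop_then_flow (μ := μ) (η := η) (γ := γ) hA (τ := 1 / 2)
    (by norm_num) (by norm_num)
  have hf1 : ∀ t x, -1 ≤ f t x := fun t x => (abs_le.1 ((hf.bound t x).trans hr₁)).1
  have hg1 : ∀ t x, -1 ≤ g t x := fun t x => (abs_le.1 ((hg.bound t x).trans hr₂)).1
  obtain ⟨ν₁, hν₁, h₁⟩ := hK₁ C g f Λ ν hΛ hν (by
    rw [funext hg.zero, funext hf.one])
  obtain ⟨ν₂, hν₂, h₂⟩ := hK₂ C g f Λ ν hΛ hν (by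
    rw [funext hg.zero, funext hf.zero])
  refine ⟨ENNReal.ofReal (1 / 2) • ν₁ + ENNReal.ofReal (1 / 2) • ν₂,
    IsFlow.convex (f₁ := splice (1 / 2) f g) (f₂ := splice (1 / 2) g f) hν₁ hν₂
      (measurable_splice hf.measurable hg.measurable _)
      (measurable_splice hg.measurable hf.measurable _) (one_le_splice hf1 hg1 _)
      (one_le_splice hg1 hf1 _) (by norm_num) (by norm_num) (by norm_num), ?_⟩
  rw [flowAction_convex]
  have hb : ∀ K : ℝ≥0, (K : ℝ≥0∞) * (C + flowAction A ν) ≠ ⊤ := fun K =>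
    ENNReal.mul_ne_top ENNReal.coe_ne_top (ENNReal.add_ne_top.2 ⟨ENNReal.coe_ne_top, hfin⟩)
  exact ENNReal.add_ne_top.2 ⟨ENNReal.mul_ne_top ENNReal.ofReal_ne_top (ne_top_of_le_ne_top
    (hb _) h₁), ENNReal.mul_ne_top ENNReal.ofReal_ne_top (ne_top_of_le_ne_top (hb _) h₂)⟩

/-- In a flexible domain, if there is a flow of finite action whose density is bounded by `2`, then
there is an incompressible flow of finite action. -/
theorem exists_incompressible_flow (hA : IsPathAction A) (hflex : IsFlexible μ A univ)
    (hL : 0 ≤ L) (hr : r ≤ 1) {ν : Measure (C(unitInterval, D) × D)}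
    (hf : IsPerturbation μ univ r L f) (hν : IsFlow μ η γ f ν) (hfin : flowAction A ν ≠ ⊤) :
    ∃ ν₀, IsFlow μ η γ 0 ν₀ ∧ flowAction A ν₀ ≠ ⊤ := by
  obtain ⟨r', hr', h⟩ := hflex
  obtain ⟨C, hC⟩ := h L
  -- The number of halvings that bring the amplitude `r` below the radius of flexibility.
  obtain ⟨n, hn⟩ : ∃ n : ℕ, r ≤ 2 ^ n * r' := by
    obtain ⟨n, hn⟩ := pow_unbounded_of_one_lt (r / r') one_lt_two
    exact ⟨n, by rw [div_lt_iff₀ hr'] at hn; exact hn.le⟩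
  induction n generalizing r f ν with
  | zero =>
    -- Once the amplitude is small, loops with density `1 - f` exist. Running the flow and these
    -- loops in both orders and averaging cancels `f` on each half of the time interval.
    have hf' : IsPerturbation μ univ r L (fun t x => -1 * f t x) := by
      simpa using hf.const_mul (-1)
    obtain ⟨Λ, hΛ⟩ := hC _ (hf'.mono (by simpa using hn) le_rfl)
    obtain ⟨ν', h1, h2⟩ := hν.exists_splice_average hA hf hr hf' hr hΛ hfin
    refine ⟨ν', ?_, h2⟩
    convert h1 using 1
    funext t x
    simp only [splice]
    split_ifs <;> simp
  | succ n ih =>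
    -- Loops of constant density, run before or after the flow: the average has the perturbation of
    -- `splice_half`, of half the amplitude.
    obtain ⟨Λ, hΛ⟩ := hC _ (isPerturbation_zero μ univ hr'.le hL)
    obtain ⟨ν', h1, h2⟩ := hν.exists_splice_average hA hf hr
      (isPerturbation_zero μ univ zero_le_one hL) le_rfl hΛ hfin
    refine ih (r := r / 2) (by linarith) hf.splice_half ?_ h2 (by rw [pow_succ] at hn; linarith)
    convert h1 using 1
    funext t x
    simp only [splice]
    split_ifs <;> simp

/-- The relaxed distance is controlled by the action of the flows whose density is close to one,
up to an error that is linear in the distance of the density to one. -/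
theorem exists_relaxedDistSq_le (hA : IsPathAction A) (hflex : IsFlexible μ A univ)
    {ν₀ : Measure (C(unitInterval, D) × D)} (hν₀ : IsFlow μ η γ 0 ν₀)
    (hfin : flowAction A ν₀ ≠ ⊤) :
    ∃ K : ℝ≥0, ∀ (s : ℝ≥0) f ν, s ≤ 1 → IsPerturbation μ univ s s f → IsFlow μ η γ f ν →
      relaxedDistSq μ A η γ ≤ flowAction A ν + K * s := by
  have hle : ∀ ν, IsFlow μ η γ 0 ν → relaxedDistSq μ A η γ ≤ flowAction A ν := fun ν h =>
    iInf_le_of_le ν <| iInf_le_of_le h.prob <| iInf_le_of_le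
      (fun t => (h.map_eval t).trans (perturb_zero μ)) <| iInf_le_of_le h.connects le_rfl
  obtain ⟨r, hr, hr1, C, hC⟩ := exists_flow_of_perturbation hA hflex hν₀ hfin
  refine ⟨C / r.toNNReal, fun s f ν hs hf hν => ?_⟩
  -- The scaling `r / s` below needs `s ≠ 0`; for `s = 0` the flow is already incompressible.
  rcases eq_or_ne s 0 with rfl | hs0
  · have : f = 0 := by
      funext t x
      simpa using hf.bound t x
    subst this
    exact (hle ν hν).trans le_self_add
  have hs0' : (0 : ℝ) < s := by
    have := pos_iff_ne_zero.2 hs0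
    exact_mod_cast this
  -- The opposite perturbation, enlarged to the full size `r`: it cancels `f` when given a weight of
  -- order only `s`, and this is why the error is linear.
  have h' := hf.const_mul (-(r / s))
  rw [abs_neg, abs_of_pos (div_pos hr hs0'), div_mul_cancel₀ _ hs0'.ne'] at h'
  obtain ⟨ν', hν', hA'⟩ := hC _ h'
  have hsr : 0 < s + r := by positivity
  have ha : 0 ≤ r / (s + r) := by positivity
  have hb : 0 ≤ s / (s + r) := by positivity
  have hab : r / (s + r) + s / (s + r) = 1 := by
    rw [← add_div, add_comm, div_self hsr.ne']
  have hmix := hν.convex hν' hf.measurable h'.measurable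
    (fun t x => (abs_le.1 ((hf.bound t x).trans (by exact_mod_cast hs))).1)
    (fun t x => (abs_le.1 ((h'.bound t x).trans hr1)).1) ha hb hab
  have h0 : (fun t x => r / (s + r) * f t x + s / (s + r) * (-(r / s) * f t x)) =
      (0 : unitInterval → D → ℝ) := by
    funext t x
    simp only [Pi.zero_apply]
    field_simp
    ring
  rw [h0] at hmix
  refine (hle _ hmix).trans ?_
  rw [flowAction_convex]
  have h1 : ENNReal.ofReal (r / (s + r)) ≤ 1 := ENNReal.ofReal_le_one.2 (by linarith)
  have h2 : ENNReal.ofReal (s / (s + r)) * C ≤ ((C / r.toNNReal : ℝ≥0) : ℝ≥0∞) * s := by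
    have e : s / (s + r) ≤ s / r := by gcongr; linarith
    have e' : (ENNReal.ofReal (s / r)) = ((s / r.toNNReal : ℝ≥0) : ℝ≥0∞) := by
      rw [ENNReal.ofReal, Real.toNNReal_div hs0'.le, Real.toNNReal_coe]
    calc ENNReal.ofReal (s / (s + r)) * C ≤ ENNReal.ofReal (s / r) * C := by gcongr
      _ = ((C / r.toNNReal : ℝ≥0) : ℝ≥0∞) * s := by
        rw [e', ← ENNReal.coe_mul, ← ENNReal.coe_mul]
        congr 1
        ring
  calc _ ≤ 1 * flowAction A ν + ENNReal.ofReal (s / (s + r)) * C := by gcongr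
    _ ≤ _ := by
      rw [one_mul]
      gcongr

end FlexibleFlows

end GeneralizedFlow

end

noncomputable section

namespace GeneralizedFlow

/-! ### Existence of the pressure functional in a flexible domain -/

section HahnBanach

variable {X : Type*} [AddCommGroup X] [Module ℝ X]

/-- A convex set in `X × ℝ` that lies above the graph of `-K N`, for an extended seminorm `N`, lies
above the graph of a linear form that is bounded by a multiple of `N`. -/
theorem exists_linearMap_le_of_convex {N : X → ℝ≥0∞} (hadd : ∀ f g, N (f + g) ≤ N f + N g)
    (hsmul : ∀ (c : ℝ) f, N (c • f) = ‖c‖ₑ * N f) {S : Set (X × ℝ)} (hS : Convex ℝ S) {K : ℝ≥0}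
    (hfin : ∀ q ∈ S, N q.1 ≠ ⊤) (hlow : ∀ q ∈ S, -(K * (N q.1).toReal) ≤ q.2) :
    ∃ p : X →ₗ[ℝ] ℝ, (∀ f, ‖p f‖ₑ ≤ (K + 1 : ℝ≥0) * N f) ∧ ∀ q ∈ S, p q.1 ≤ q.2 := by
  rcases S.eq_empty_or_nonempty with rfl | ⟨q₀, hq₀⟩
  · exact ⟨0, by simp, by simp⟩
  -- The extended seminorm is finite on `W`, and the separation takes place there.
  let W : Submodule ℝ X :=
    { carrier := {f | N f ≠ ⊤}
      add_mem' := fun {f g} hf hg =>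
        ne_top_of_le_ne_top (ENNReal.add_ne_top.2 ⟨hf, hg⟩) (hadd f g)
      zero_mem' := by
        have := hsmul 0 0
        simp only [zero_smul, enorm_zero, zero_mul] at this
        simp [this]
      smul_mem' := fun c f hf => by
        simp only [mem_ofPred_eq, hsmul]
        exact ENNReal.mul_ne_top enorm_ne_top hf }
  let n : X → ℝ := fun f => (N f).toReal
  have nadd : ∀ f g : X, f ∈ W → g ∈ W → n (f + g) ≤ n f + n g := fun f g hf hg => by
    simp only [n]
    rw [← ENNReal.toReal_add hf hg]
    exact ENNReal.toReal_mono (ENNReal.add_ne_top.2 ⟨hf, hg⟩) (hadd f g)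
  have nsmul : ∀ (c : ℝ) f, 0 ≤ c → n (c • f) = c * n f := fun c f hc => by
    simp [n, hsmul, ENNReal.toReal_mul, abs_of_nonneg hc]
  have nneg : ∀ f, n (-f) = n f := fun f => by
    simp only [n]
    rw [← neg_one_smul ℝ f, hsmul]
    simp
  have n0 : ∀ f, 0 ≤ n f := fun f => ENNReal.toReal_nonneg
  -- The cone generated by `S` and by the epigraph of `K n`. A functional `b - p w` that is
  -- nonnegative on it encodes both required inequalities.
  let s : ConvexCone ℝ (W × ℝ) :=
    { carrier := {z | ∃ t : ℝ, 0 ≤ t ∧ ∃ q ∈ S, K * n (z.1 - t • q.1) + t * q.2 ≤ z.2}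
      smul_mem' := by
        rintro c hc z ⟨t, ht, q, hq, h⟩
        refine ⟨c * t, by positivity, q, hq, ?_⟩
        have e : ((c • z).1 : X) - (c * t) • q.1 = c • ((z.1 : X) - t • q.1) := by
          simp [smul_sub, mul_smul]
        rw [e, nsmul _ _ hc.le]
        have := mul_le_mul_of_nonneg_left h hc.le
        simp only [Prod.smul_snd, smul_eq_mul]
        linarith
      add_mem' := by
        rintro z ⟨t, ht, q, hq, h⟩ z' ⟨t', ht', q', hq', h'⟩
        have hmem : ∀ (z : W × ℝ) (t : ℝ) (q : X × ℝ), q ∈ S → (z.1 : X) - t • q.1 ∈ W :=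
          fun z t q hq => W.sub_mem z.1.2 (W.smul_mem _ (hfin q hq))
        have hK : (0 : ℝ) ≤ K := K.2
        have key := mul_le_mul_of_nonneg_left
          (nadd _ _ (hmem z t q hq) (hmem z' t' q' hq')) hK
        rcases eq_or_lt_of_le (add_nonneg ht ht') with h0 | h0
        · have ht0 : t = 0 := by linarith
          have ht0' : t' = 0 := by linarith
          subst ht0 ht0'
          refine ⟨0, le_rfl, q, hq, ?_⟩
          simp only [zero_smul, sub_zero, zero_mul, add_zero] at h h' key ⊢
          have e : (((z + z').1 : W) : X) = z.1 + z'.1 := rfl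
          have e2 : (z + z').2 = z.2 + z'.2 := rfl
          rw [e, e2]
          linarith
        · refine ⟨t + t', h0.le, (t / (t + t')) • q + (t' / (t + t')) • q', hS hq hq'
            (by positivity) (by positivity) (by rw [← add_div, div_self h0.ne']), ?_⟩
          have e3 : (t + t') • ((t / (t + t')) • q + (t' / (t + t')) • q') = t • q + t' • q' := by
            rw [smul_add, smul_smul, smul_smul, mul_div_cancel₀ _ h0.ne',
              mul_div_cancel₀ _ h0.ne']
          have e3a := congrArg Prod.fst e3
          have e3b := congrArg Prod.snd e3
          simp only [Prod.smul_fst, Prod.smul_snd, Prod.fst_add, Prod.snd_add,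
            smul_eq_mul] at e3a e3b
          have e : (((z + z').1 : W) : X) - (t + t') •
              ((t / (t + t')) • q + (t' / (t + t')) • q').1 =
              ((z.1 : X) - t • q.1) + ((z'.1 : X) - t' • q'.1) := by
            simp only [Prod.smul_fst, Prod.fst_add]
            rw [e3a]
            push_cast
            abel
          have e2 : (z + z').2 = z.2 + z'.2 := rfl
          rw [e, e2]
          simp only [Prod.smul_snd, Prod.snd_add, smul_eq_mul]
          rw [e3b]
          linarith }
  have hzero : (0 : X) ∈ W := W.zero_mem
  let f₀ : (W × ℝ) →ₗ.[ℝ] ℝ :=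
    { domain := LinearMap.ker (LinearMap.fst ℝ W ℝ)
      toFun := (LinearMap.snd ℝ W ℝ).comp (Submodule.subtype _) }
  have hs0 : s.Pointed := ⟨0, le_rfl, q₀, hq₀, by
    have : n 0 = 0 := by simpa using nsmul 0 0 le_rfl
    simp [this]⟩
  -- The M. Riesz extension theorem, starting from `(0, b) ↦ b`. Positivity on the cone over `w = 0`
  -- is exactly the hypothesis that `S` lies above `-K N`.
  obtain ⟨G, hG, hGs⟩ := riesz_extension (s.toPointedCone hs0) f₀ (by
      rintro ⟨⟨w, b⟩, hw⟩ hwb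
      obtain ⟨t, ht, q, hq, h⟩ : (w, b) ∈ s := hwb
      have hw' : w = 0 := hw
      subst hw'
      change 0 ≤ b
      simp only [ZeroMemClass.coe_zero, zero_sub] at h
      rw [nneg, nsmul _ _ ht] at h
      have := mul_le_mul_of_nonneg_left (hlow q hq) ht
      simp only [n] at h
      linarith) (by
      rintro ⟨w, b⟩
      refine ⟨⟨(0, K * n w - b), by simp [f₀]⟩, 0, le_rfl, q₀, hq₀, by simp⟩)
  let p₀ : W →ₗ[ℝ] ℝ := -(G.comp (LinearMap.inl ℝ W ℝ))
  have hGb : ∀ (w : W) (b : ℝ), G (w, b) = b - p₀ w := by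
    intro w b
    have h1 : G (0, b) = b := hG ⟨(0, b), by simp [f₀]⟩
    have h2 : ((w, b) : W × ℝ) = (w, 0) + (0, b) := by simp
    rw [h2, map_add, h1]
    simp [p₀, add_comm]
  -- Any algebraic extension serves: off `W` the seminorm is infinite and there is nothing to bound.
  obtain ⟨p, hp⟩ := LinearMap.exists_extend p₀
  have hpW : ∀ w : W, p w = p₀ w := fun w => congrArg (fun l => l w) hp
  have hle : ∀ w : W, p w ≤ K * n w := by
    intro w
    have := hGs (w, K * n w) ⟨0, le_rfl, q₀, hq₀, by simp⟩
    rw [hGb] at this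
    rw [hpW]
    linarith
  refine ⟨p, fun f => ?_, fun q hq => ?_⟩
  · by_cases hf : N f = ⊤
    -- The constant is `K + 1` and not `K` because `0 * ⊤ = 0`.
    · rw [hf, ENNReal.mul_top (by positivity)]
      exact le_top
    · have h1 := hle ⟨f, hf⟩
      have h2 := hle (-⟨f, hf⟩)
      simp only [NegMemClass.coe_neg, map_neg, nneg] at h1 h2
      have h3 : ‖p f‖ ≤ (K + 1 : ℝ≥0) * n f := by
        rw [Real.norm_eq_abs, abs_le]
        push_cast
        constructor <;> nlinarith [n0 f]
      rw [← ofReal_norm]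
      refine (ENNReal.ofReal_le_ofReal h3).trans ?_
      rw [ENNReal.ofReal_mul (by positivity), ENNReal.ofReal_coe_nnreal,
        ENNReal.ofReal_toReal hf]
  · have := hGs (⟨q.1, hfin q hq⟩, q.2) ⟨1, zero_le_one, q, hq, by
      have : n 0 = 0 := by simpa using nsmul 0 0 le_rfl
      simp [this]⟩
    rw [hGb, ← hpW] at this
    linarith

end HahnBanach

/-! ### The uniform norm combined with the Lipschitz constant in time -/

section TimeNorm

variable {X : Type*}

/-- The maximum of the uniform norm and of the best Lipschitz constant in time. -/
def timeNorm (F : unitInterval × X → ℝ) : ℝ≥0∞ :=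
  max (⨆ z, ‖F z‖ₑ) (⨆ (x : X) (s : unitInterval) (t : unitInterval),
    ‖F (s, x) - F (t, x)‖ₑ / edist s t)

theorem timeNorm_le_iff {F : unitInterval × X → ℝ} {K : ℝ≥0∞} :
    timeNorm F ≤ K ↔
      (∀ z, ‖F z‖ₑ ≤ K) ∧ ∀ x s t, ‖F (s, x) - F (t, x)‖ₑ ≤ K * edist s t := by
  simp only [timeNorm, max_le_iff, iSup_le_iff]
  refine and_congr_right fun _ => forall_congr' fun x => forall_congr' fun s =>
    forall_congr' fun t => ?_
  rcases eq_or_ne s t with rfl | hst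
  · simp
  · rw [ENNReal.div_le_iff (edist_pos.2 hst).ne' (edist_ne_top _ _)]

theorem timeNorm_add_le (F G : unitInterval × X → ℝ) :
    timeNorm (F + G) ≤ timeNorm F + timeNorm G := by
  have hF := timeNorm_le_iff.1 (le_refl (timeNorm F))
  have hG := timeNorm_le_iff.1 (le_refl (timeNorm G))
  refine timeNorm_le_iff.2 ⟨fun z => (enorm_add_le _ _).trans (add_le_add (hF.1 z) (hG.1 z)),
    fun x s t => ?_⟩
  have e : (F + G) (s, x) - (F + G) (t, x) = (F (s, x) - F (t, x)) + (G (s, x) - G (t, x)) := by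
    simp only [Pi.add_apply]
    ring
  rw [e, add_mul]
  exact (enorm_add_le _ _).trans (add_le_add (hF.2 x s t) (hG.2 x s t))

theorem timeNorm_smul_le (c : ℝ) (F : unitInterval × X → ℝ) :
    timeNorm (c • F) ≤ ‖c‖ₑ * timeNorm F := by
  have hF := timeNorm_le_iff.1 (le_refl (timeNorm F))
  refine timeNorm_le_iff.2 ⟨fun z => ?_, fun x s t => ?_⟩
  · rw [Pi.smul_apply, enorm_smul]
    gcongr
    exact hF.1 z
  · rw [Pi.smul_apply, Pi.smul_apply, ← smul_sub, enorm_smul, mul_assoc]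
    gcongr
    exact hF.2 x s t

theorem timeNorm_smul (c : ℝ) (F : unitInterval × X → ℝ) :
    timeNorm (c • F) = ‖c‖ₑ * timeNorm F := by
  refine le_antisymm (timeNorm_smul_le c F) ?_
  rcases eq_or_ne c 0 with rfl | hc
  · simp
  have h := timeNorm_smul_le c⁻¹ (c • F)
  rw [smul_smul, inv_mul_cancel₀ hc, one_smul] at h
  calc ‖c‖ₑ * timeNorm F ≤ ‖c‖ₑ * (‖c⁻¹‖ₑ * timeNorm (c • F)) := by gcongr
    _ = timeNorm (c • F) := by
      rw [← mul_assoc, ← enorm_mul, mul_inv_cancel₀ hc]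
      simp

end TimeNorm

/-! ### From flexibility to the pressure functional -/

section Pressure

variable {D : Type*} [MeasurableSpace D] [MetricSpace D] [BorelSpace D]
  {μ : Measure D} {A : C(unitInterval, D) → ℝ≥0∞} {η γ : Measure (D × D)}

/-- The flow has the density `1 + f`, for a perturbation `f` that is almost everywhere equal to
`ρ - 1` and that vanishes at both ends of the time interval. -/
theorem exists_isFlow_of_hasDensity [IsProbabilityMeasure μ] (hη : IsPlan μ η)
    (hγ : IsPlan μ γ) {ν : Measure (C(unitInterval, D) × D)} [IsProbabilityMeasure ν]
    {ρ : unitInterval × D → ℝ} (hρ : HasDensity μ ν ρ)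
    (hm : ∀ t, Measurable fun x => ρ (t, x)) {s : ℝ≥0} (hs : timeNorm (ρ - 1) ≤ s)
    (hν : Connects ν η γ) :
    ∃ f, IsPerturbation μ univ s s f ∧ IsFlow μ η γ f ν := by
  have hs' := timeNorm_le_iff.1 hs
  have hb : ∀ t x, |ρ (t, x) - 1| ≤ s := by
    intro t x
    have := hs'.1 (t, x)
    rw [enorm_le_coe] at this
    exact_mod_cast this
  have hl : ∀ x t t', |(ρ (t, x) - 1) - (ρ (t', x) - 1)| ≤ s * |(t : ℝ) - t'| := by
    intro x t t'
    have := hs'.2 x t t'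
    rw [edist_nndist, ← ENNReal.coe_mul, enorm_le_coe] at this
    have h2 : ‖(ρ - 1) (t, x) - (ρ - 1) (t', x)‖ ≤ s * dist t t' := by exact_mod_cast this
    exact h2
  have hend : ∀ t, μ.withDensity (fun x => ENNReal.ofReal (ρ (t, x))) = μ →
      ∀ᵐ x ∂μ, ρ (t, x) - 1 = 0 := by
    intro t ht
    have h1 : μ.withDensity (fun x => ENNReal.ofReal (ρ (t, x))) = μ.withDensity 1 := by
      rw [ht, withDensity_one]
    have h2 := (withDensity_eq_iff (hm t).ennreal_ofReal.aemeasurable aemeasurable_one (by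
      rw [← setLIntegral_univ, ← withDensity_apply _ MeasurableSet.univ, ht]
      exact measure_ne_top _ _)).1 h1
    filter_upwards [h2] with x hx
    have h3 := congrArg ENNReal.toReal hx
    rw [ENNReal.toReal_ofReal (hρ.nonneg _)] at h3
    simp at h3
    linarith
  have he : ∀ t : unitInterval, Measurable fun z : C(unitInterval, D) × D => (z.1 t, z.2) :=
    fun t => ((measurable_eval t).comp measurable_fst).prodMk measurable_snd
  have h0 := hend 0 (by
    rw [← hρ.map_eval, ← hη.fst, ← hν.initial, Measure.map_map measurable_fst (he 0)]
    rfl)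
  have h1 := hend 1 (by
    rw [← hρ.map_eval, ← hγ.fst, ← hν.final, Measure.map_map measurable_fst (he 1)]
    rfl)
  -- The marginals of the plans give `ρ = 1` at times `0` and `1` only almost everywhere.
  -- Multiplying `ρ - 1` by the indicator of `N` makes it vanish there everywhere, without changing
  -- the measures.
  set N : Set D := {x | ρ (0, x) - 1 = 0 ∧ ρ (1, x) - 1 = 0} with hN
  have hNm : MeasurableSet N :=
    (measurableSet_eq_fun ((hm 0).sub_const 1) measurable_const).inter
      (measurableSet_eq_fun ((hm 1).sub_const 1) measurable_const)
  have hNae : ∀ᵐ x ∂μ, x ∈ N := by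
    filter_upwards [h0, h1] with x h h'
    exact ⟨h, h'⟩
  let f : unitInterval → D → ℝ := fun t => N.indicator fun x => ρ (t, x) - 1
  have hfae : ∀ t, f t =ᵐ[μ] fun x => ρ (t, x) - 1 := by
    intro t
    filter_upwards [hNae] with x hx
    simp [f, hx]
  have hmap : ∀ t : unitInterval, ν.map (fun z => z.1 t) = perturb μ (f t) := by
    intro t
    rw [perturb_congr_ae (hfae t), hρ.map_eval, perturb]
    simp
  refine ⟨f, ⟨fun t => ((hm t).sub_const 1).indicator hNm, fun t x => ?_, fun x t t' => ?_,
    fun x => ?_, fun x => ?_, fun t x hx => absurd (mem_univ x) hx, fun t => ?_⟩,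
    ⟨inferInstance, hmap, hν⟩⟩
  · by_cases hx : x ∈ N
    · simp only [f, indicator_of_mem hx, hb]
    · simp [f, hx]
  · by_cases hx : x ∈ N
    · simp only [f, indicator_of_mem hx, hl]
    · simp only [f, indicator_of_notMem hx, sub_self, abs_zero]
      positivity
  · by_cases hx : x ∈ N
    · simp [f, hx, hx.1]
    · simp [f, hx]
  · by_cases hx : x ∈ N
    · simp [f, hx, hx.2]
    · simp [f, hx]
  -- The integral of `ρ - 1` is zero because `μ` and the laws of the positions both have total mass
  -- one.
  · rw [integral_congr_ae (hfae t)]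
    have hint : Integrable (fun x => ρ (t, x) - 1) μ :=
      Integrable.of_bound ((hm t).sub_const 1).aestronglyMeasurable s (ae_of_all _ (hb t))
    have hint' : Integrable (fun x => ρ (t, x)) μ := by
      refine (hint.add (integrable_const (1 : ℝ))).congr (ae_of_all _ fun x => ?_)
      simp
    rw [integral_sub hint' (integrable_const _)]
    have : ∫ x, ρ (t, x) ∂μ = 1 := by
      rw [integral_eq_lintegral_of_nonneg_ae (ae_of_all _ fun x => hρ.nonneg _)
        (hm t).aestronglyMeasurable]
      have h3 : ν.map (fun z => z.1 t) univ = 1 := by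
        have ht : Measurable fun z : C(unitInterval, D) × D => z.1 t :=
          (measurable_eval t).comp measurable_fst
        rw [Measure.map_apply ht MeasurableSet.univ]
        simp
      rw [hρ.map_eval, withDensity_apply _ MeasurableSet.univ, setLIntegral_univ] at h3
      simp [h3]
    simp [this]

/-- Existence of the pressure, as a linear form on functions that is bounded in terms of the
uniform norm and of the Lipschitz constant in time. -/
theorem exists_pressure [CompactSpace D] [IsProbabilityMeasure μ] (hA : IsPathAction A)
    (hflex : IsFlexible μ A univ) (hη : IsPlan μ η) (hγ : IsPlan μ γ) :
    ∃ p : (unitInterval × D → ℝ) →ₗ[ℝ] ℝ, (∃ K : ℝ≥0, ∀ F, ‖p F‖ₑ ≤ K * timeNorm F) ∧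
      ∀ (ν : Measure (C(unitInterval, D) × D)) (ρ : unitInterval × D → ℝ),
        IsProbabilityMeasure ν → HasDensity μ ν ρ → (∀ t, Measurable fun x => ρ (t, x)) →
        timeNorm (ρ - 1) ≤ 2⁻¹ → Connects ν η γ →
        ((p (ρ - 1) : ℝ) : EReal) + (relaxedDistSq μ A η γ : EReal) ≤
          (flowAction A ν : EReal) := by
  have hflow : ∀ (ν : Measure (C(unitInterval, D) × D)) (ρ : unitInterval × D → ℝ),
      IsProbabilityMeasure ν → HasDensity μ ν ρ → (∀ t, Measurable fun x => ρ (t, x)) →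
      timeNorm (ρ - 1) ≤ 2⁻¹ → Connects ν η γ → ∃ f, (timeNorm (ρ - 1)).toNNReal ≤ 1 ∧
      IsPerturbation μ univ (timeNorm (ρ - 1)).toNNReal (timeNorm (ρ - 1)).toNNReal f ∧
      IsFlow μ η γ f ν := by
    intro ν ρ hp hρ hm hN hc
    have hfin : timeNorm (ρ - 1) ≠ ⊤ := ne_top_of_le_ne_top (by simp) hN
    obtain ⟨f, h1, h2⟩ := exists_isFlow_of_hasDensity hη hγ hρ hm
      (ENNReal.coe_toNNReal hfin).ge hc
    refine ⟨f, ?_, h1, h2⟩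
    rw [← ENNReal.coe_le_coe, ENNReal.coe_toNNReal hfin]
    exact hN.trans (by simp)
  let R : Set (Measure (C(unitInterval, D) × D) × (unitInterval × D → ℝ)) :=
    {z | IsProbabilityMeasure z.1 ∧ HasDensity μ z.1 z.2 ∧ (∀ t, Measurable fun x => z.2 (t, x)) ∧
      timeNorm (z.2 - 1) ≤ 2⁻¹ ∧ Connects z.1 η γ ∧ flowAction A z.1 ≠ ⊤}
  rcases R.eq_empty_or_nonempty with hR | ⟨⟨ν₁, ρ₁⟩, h1, h2, h3, h4, h5, h6⟩
  · refine ⟨0, ⟨0, by simp⟩, fun ν ρ hp hρ hm hN hc => ?_⟩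
    have : flowAction A ν = ⊤ := by
      by_contra h
      have : (ν, ρ) ∈ R := ⟨hp, hρ, hm, hN, hc, h⟩
      simp [hR] at this
    simp [this]
  obtain ⟨f₁, hf1, hf2, hf3⟩ := hflow ν₁ ρ₁ h1 h2 h3 h4 h5
  obtain ⟨ν₀, hν₀, hν₀fin⟩ := exists_incompressible_flow hA hflex (NNReal.coe_nonneg _)
    (by exact_mod_cast hf1) hf2 hf3 h6
  obtain ⟨K, hK⟩ := exists_relaxedDistSq_le hA hflex hν₀ hν₀fin
  have hδ : relaxedDistSq μ A η γ ≠ ⊤ := ne_top_of_le_ne_top hν₀fin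
    (iInf_le_of_le ν₀ <| iInf_le_of_le hν₀.prob <| iInf_le_of_le
      (fun t => (hν₀.map_eval t).trans (perturb_zero μ)) <| iInf_le_of_le hν₀.connects le_rfl)
  set δ := relaxedDistSq μ A η γ with hδdef
  -- Subtracting `δ` places the supporting hyperplane through the origin, so that a linear form,
  -- rather than an affine one, is obtained.
  let S : Set ((unitInterval × D → ℝ) × ℝ) :=
    {q | ∃ z ∈ R, q = (z.2 - 1, (flowAction A z.1).toReal - δ.toReal)}
  have hS : Convex ℝ S := by
    rintro _ ⟨z, ⟨a1, a2, a3, a4, a5, a6⟩, rfl⟩ _ ⟨z', ⟨b1, b2, b3, b4, b5, b6⟩, rfl⟩ a b ha hb hab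
    obtain ⟨f, -, c1, c2⟩ := hflow z.1 z.2 a1 a2 a3 a4 a5
    have hA : flowAction A (ENNReal.ofReal a • z.1 + ENNReal.ofReal b • z'.1) =
      ENNReal.ofReal a * flowAction A z.1 + ENNReal.ofReal b * flowAction A z'.1 :=
      flowAction_convex _ _ _ _ _
    have hfl : ∀ w : Measure (C(unitInterval, D) × D) × (unitInterval × D → ℝ),
        IsProbabilityMeasure w.1 → HasDensity μ w.1 w.2 → Connects w.1 η γ →
        IsFlow μ η γ (fun t x => w.2 (t, x) - 1) w.1 := by
      intro w k1 k2 k3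
      refine ⟨k1, fun t => ?_, k3⟩
      rw [k2.map_eval, perturb]
      simp
    have hmix := (hfl z a1 a2 a5).convex (hfl z' b1 b2 b5) (fun t => (a3 t).sub_const 1)
      (fun t => (b3 t).sub_const 1) (fun t x => by linarith [a2.nonneg (t, x)])
      (fun t x => by linarith [b2.nonneg (t, x)]) ha hb hab
    have e : a • z.2 + b • z'.2 - 1 = a • (z.2 - 1) + b • (z'.2 - 1) := by
      have : (1 : unitInterval × D → ℝ) = (a + b) • 1 := by rw [hab, one_smul]
      nth_rewrite 1 [this]
      module
    refine ⟨(ENNReal.ofReal a • z.1 + ENNReal.ofReal b • z'.1, a • z.2 + b • z'.2),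
      ⟨hmix.prob, ⟨fun w => ?_, fun t => ?_⟩, fun t => ?_, ?_, hmix.connects, ?_⟩, ?_⟩
    · exact add_nonneg (mul_nonneg ha (a2.nonneg w)) (mul_nonneg hb (b2.nonneg w))
    · rw [hmix.map_eval, perturb]
      congr 1
      funext x
      congr 1
      simp only [Pi.add_apply, Pi.smul_apply, smul_eq_mul]
      linear_combination -hab
    · exact ((a3 t).const_mul a).add ((b3 t).const_mul b)
    · simp only
      rw [e]
      refine (timeNorm_add_le _ _).trans ?_
      rw [timeNorm_smul, timeNorm_smul]
      calc ‖a‖ₑ * timeNorm (z.2 - 1) + ‖b‖ₑ * timeNorm (z'.2 - 1)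
          ≤ ‖a‖ₑ * 2⁻¹ + ‖b‖ₑ * 2⁻¹ := by gcongr
        _ = 2⁻¹ := by
          rw [← add_mul, Real.enorm_of_nonneg ha, Real.enorm_of_nonneg hb,
            ← ENNReal.ofReal_add ha hb, hab]
          simp
    · simp only
      rw [hA]
      exact ENNReal.add_ne_top.2 ⟨ENNReal.mul_ne_top ENNReal.ofReal_ne_top a6,
        ENNReal.mul_ne_top ENNReal.ofReal_ne_top b6⟩
    · refine Prod.ext ?_ ?_
      · simp only [Prod.fst_add, Prod.smul_fst]
        rw [e]
      · simp only [Prod.snd_add, Prod.smul_snd, smul_eq_mul]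
        rw [hA, ENNReal.toReal_add (ENNReal.mul_ne_top ENNReal.ofReal_ne_top a6)
          (ENNReal.mul_ne_top ENNReal.ofReal_ne_top b6), ENNReal.toReal_mul, ENNReal.toReal_mul,
          ENNReal.toReal_ofReal ha, ENNReal.toReal_ofReal hb]
        linear_combination -δ.toReal * hab
  have hfin : ∀ z ∈ R, timeNorm (z.2 - 1) ≠ ⊤ := fun z hz =>
    ne_top_of_le_ne_top (by simp) hz.2.2.2.1
  obtain ⟨p, hp, hpS⟩ := exists_linearMap_le_of_convex (N := timeNorm (X := D)) timeNorm_add_le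
    timeNorm_smul hS (K := K) (by
      rintro _ ⟨z, hz, rfl⟩
      exact hfin z hz) (by
      rintro _ ⟨z, hz, rfl⟩
      obtain ⟨a1, a2, a3, a4, a5, a6⟩ := id hz
      obtain ⟨f, c0, c1, c2⟩ := hflow z.1 z.2 a1 a2 a3 a4 a5
      have := hK _ f z.1 c0 c1 c2
      rw [ENNReal.coe_toNNReal (hfin z hz)] at this
      have h7 := ENNReal.toReal_mono (ENNReal.add_ne_top.2 ⟨a6, ENNReal.mul_ne_top
        ENNReal.coe_ne_top (hfin z hz)⟩) this
      rw [ENNReal.toReal_add a6 (ENNReal.mul_ne_top ENNReal.coe_ne_top (hfin z hz)),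
        ENNReal.toReal_mul, ENNReal.coe_toReal] at h7
      simp only
      linarith)
  refine ⟨p, ⟨K + 1, hp⟩, fun ν ρ k1 k2 k3 k4 k5 => ?_⟩
  by_cases hν : flowAction A ν = ⊤
  · simp [hν]
  have := hpS _ ⟨(ν, ρ), ⟨k1, k2, k3, k4, k5, hν⟩, rfl⟩
  simp only at this
  rw [← ENNReal.ofReal_toReal hδ, ← ENNReal.ofReal_toReal hν,
    EReal.coe_ennreal_ofReal, EReal.coe_ennreal_ofReal, max_eq_left ENNReal.toReal_nonneg,
    max_eq_left ENNReal.toReal_nonneg]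
  exact_mod_cast (by linarith : p (ρ - 1) + δ.toReal ≤ (flowAction A ν).toReal)

end Pressure

end GeneralizedFlow

end

noncomputable section

namespace GeneralizedFlow

/-! ### Coordinate patches are flexible -/

section Patch

/-- Clamping sends an interval of length `1 + u` to `0` and one of length `1 - u` to `1`; between
them it is a translation onto `[0,1]`. The middle term is therefore free of `u`. -/
theorem lintegral_clamp {u : ℝ} (hu : |u| ≤ 1) (H : ℝ → ℝ≥0∞) :
    ∫⁻ m in Icc (0 : ℝ) 3, H (max 0 (min 1 (m - 1 - u))) =
      ENNReal.ofReal (1 + u) * H 0 + (∫⁻ s in Icc (0 : ℝ) 1, H s) +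
        ENNReal.ofReal (1 - u) * H 1 := by
  obtain ⟨h1, h2⟩ := abs_le.1 hu
  have e : Icc (0 : ℝ) 3 = (Ico 0 (1 + u) ∪ Icc (1 + u) (2 + u)) ∪ Ioc (2 + u) 3 := by
    ext m
    simp only [mem_Icc, mem_union, mem_Ico, mem_Ioc]
    constructor
    · rintro ⟨h, h'⟩
      rcases lt_or_ge m (1 + u) with h3 | h3
      · exact Or.inl (Or.inl ⟨h, h3⟩)
      · rcases le_or_gt m (2 + u) with h4 | h4
        · exact Or.inl (Or.inr ⟨h3, h4⟩)
        · exact Or.inr ⟨h4, h'⟩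
    · rintro ((⟨h, h'⟩ | ⟨h, h'⟩) | ⟨h, h'⟩) <;> constructor <;> linarith
  rw [e, lintegral_union measurableSet_Ioc, lintegral_union measurableSet_Icc]
  rotate_left
  · rw [Set.disjoint_left]
    rintro m ⟨-, h⟩ ⟨h', -⟩
    linarith
  · rw [Set.disjoint_left]
    rintro m (⟨-, h⟩ | ⟨-, h⟩) ⟨h', -⟩ <;> linarith
  have i1 : ∫⁻ m in Ico 0 (1 + u), H (max 0 (min 1 (m - 1 - u))) =
      ENNReal.ofReal (1 + u) * H 0 := by
    rw [setLIntegral_congr_fun measurableSet_Ico (g := fun _ => H 0)]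
    · simp [mul_comm]
    · rintro m ⟨h, h'⟩
      simp only
      rw [max_eq_left ((min_le_right _ _).trans (by linarith))]
  have i3 : ∫⁻ m in Ioc (2 + u) 3, H (max 0 (min 1 (m - 1 - u))) =
      ENNReal.ofReal (1 - u) * H 1 := by
    rw [setLIntegral_congr_fun measurableSet_Ioc (g := fun _ => H 1)]
    · simp only [lintegral_const, MeasurableSet.univ, Measure.restrict_apply, univ_inter,
        Real.volume_Ioc]
      rw [mul_comm]
      congr 2
      ring
    · rintro m ⟨h, h'⟩
      simp only
      rw [min_eq_left (by linarith), max_eq_right zero_le_one]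
  have i2 : ∫⁻ m in Icc (1 + u) (2 + u), H (max 0 (min 1 (m - 1 - u))) =
      ∫⁻ s in Icc (0 : ℝ) 1, H s := by
    rw [← lintegral_indicator measurableSet_Icc, ← lintegral_indicator measurableSet_Icc,
      ← lintegral_sub_right_eq_self (μ := volume) ((Icc (0 : ℝ) 1).indicator H) (1 + u)]
    congr 1
    funext m
    by_cases hm : m ∈ Icc (1 + u) (2 + u)
    · have hm' : m - (1 + u) ∈ Icc (0 : ℝ) 1 := ⟨by linarith [hm.1], by linarith [hm.2]⟩
      rw [indicator_of_mem hm, indicator_of_mem hm',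
        min_eq_right (by linarith [hm.2]), max_eq_right (by linarith [hm.1])]
      congr 1
      ring
    · rw [indicator_of_notMem hm, indicator_of_notMem]
      rintro ⟨h, h'⟩
      exact hm ⟨by linarith, by linarith⟩
  rw [i1, i2, i3]

variable {E : Type*} [NormedAddCommGroup E] [NormedSpace ℝ E] [MeasurableSpace E]

/-- The Jacobian contributes `s⁻¹` to the power of the dimension, and `s⁻¹ ≤ 2`. -/
theorem lintegral_homothety_le [BorelSpace E] [FiniteDimensional ℝ E] (vol : Measure E) [vol.IsAddHaarMeasure] {H : E → ℝ≥0∞}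
    (hH : Measurable H) (a : E) {s : ℝ} (hs : 1 / 2 ≤ s) :
    ∫⁻ y, H (a + s • y) ∂vol ≤ 2 ^ Module.finrank ℝ E * ∫⁻ y, H y ∂vol := by
  have hs0 : 0 < s := by linarith
  have hm : Measurable fun y : E => s • y := measurable_const_smul s
  have h1 : ∫⁻ y, H (a + s • y) ∂vol = ∫⁻ y, H (a + y) ∂(vol.map fun y => s • y) := by
    rw [lintegral_map (f := fun y => H (a + y)) (hH.comp (measurable_const_add a)) hm]
  have h2 := Measure.map_addHaar_smul vol hs0.ne'
  rw [h1]
  erw [h2]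
  rw [lintegral_smul_measure, lintegral_add_left_eq_self, smul_eq_mul]
  gcongr
  rw [abs_of_pos (by positivity), ← inv_pow, ENNReal.ofReal_pow (by positivity)]
  gcongr
  rw [← ENNReal.ofReal_ofNat]
  refine ENNReal.ofReal_le_ofReal ?_
  rw [inv_le_comm₀ hs0 (by norm_num)]
  linarith

variable {D : Type*} [MeasurableSpace D] [MetricSpace D]

/-- A convex coordinate patch `ψ : B → D`, with inverse `φ`, on which `μ` is comparable to the
Lebesgue measure of the coordinates, and Lipschitz paths in the coordinates have bounded action. -/
structure IsPatch (vol : Measure E) (μ : Measure D) (A : C(unitInterval, D) → ℝ≥0∞) (B : Set E)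
    (ψ : E → D) (φ : D → E) (lam : Measure E) : Prop where
  convex : Convex ℝ B
  compact : IsCompact B
  measurable : Measurable ψ
  continuousOn : ContinuousOn ψ B
  continuousOn_inv : ContinuousOn φ (ψ '' B)
  left_inv : ∀ y ∈ B, φ (ψ y) = y
  action_le : ∀ L : ℝ, ∃ C : ℝ≥0, ∀ c : C(unitInterval, D), (∀ t, c t ∈ ψ '' B) →
    (∀ s t, dist (φ (c s)) (φ (c t)) ≤ L * |(s : ℝ) - t|) → A c ≤ C
  le_vol : ∃ C : ℝ≥0, lam ≤ C • vol.restrict B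
  map_eq : lam.map ψ = μ.restrict (ψ '' B)
  map_vol_le : ∃ C : ℝ≥0, (vol.restrict B).map ψ ≤ C • μ
  measure_ne_zero : μ (ψ '' B) ≠ 0

variable {vol : Measure E} {μ : Measure D}
  {A : C(unitInterval, D) → ℝ≥0∞} {B : Set E} {ψ : E → D} {φ : D → E} {lam : Measure E}

theorem lintegral_mono_smul_measure {X : Type*} [MeasurableSpace X] {m m' : Measure X} {C : ℝ≥0}
    (h : m ≤ C • m') (f : X → ℝ≥0∞) : ∫⁻ x, f x ∂m ≤ C * ∫⁻ x, f x ∂m' := by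
  refine (lintegral_mono' h le_rfl).trans (le_of_eq ?_)
  rw [lintegral_smul_measure]
  rfl

theorem IsPatch.ae_mem [BorelSpace E] (h : IsPatch vol μ A B ψ φ lam) : ∀ᵐ y ∂lam, y ∈ B := by
  obtain ⟨C, hC⟩ := h.le_vol
  have : lam ≪ vol.restrict B :=
    (Measure.absolutelyContinuous_of_le hC).trans (Measure.smul_absolutelyContinuous)
  exact this.ae_le (ae_restrict_mem h.compact.measurableSet)

theorem IsPatch.isFiniteMeasure [IsFiniteMeasureOnCompacts vol] (h : IsPatch vol μ A B ψ φ lam) : IsFiniteMeasure lam := by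
  obtain ⟨C, hC⟩ := h.le_vol
  have : IsFiniteMeasure (vol.restrict B) := ⟨by
    rw [Measure.restrict_apply_univ]
    exact h.compact.measure_lt_top⟩
  exact isFiniteMeasure_of_le _ hC

variable [BorelSpace E] [FiniteDimensional ℝ E] [vol.IsAddHaarMeasure]

/-- The points of the segments between independent points of the patch have a law with bounded
density. -/
theorem IsPatch.exists_lintegral_lineMap_le (h : IsPatch vol μ A B ψ φ lam) :
    ∃ C : ℝ≥0, ∀ H : D → ℝ≥0∞, Measurable H → ∀ s ∈ Icc (0 : ℝ) 1,
      ∫⁻ x, ∫⁻ y, H (ψ (AffineMap.lineMap x y s)) ∂lam ∂lam ≤ C * ∫⁻ x, H x ∂μ := by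
  have := h.isFiniteMeasure
  obtain ⟨C₀, hC₀⟩ := h.le_vol
  obtain ⟨C₁, hC₁⟩ := h.map_vol_le
  have hBm := h.compact.measurableSet
  have key : ∀ H : D → ℝ≥0∞, Measurable H → ∀ x ∈ B, ∀ s ∈ Icc (1 / 2 : ℝ) 1,
      ∫⁻ y, H (ψ (AffineMap.lineMap x y s)) ∂lam ≤
        C₀ * (2 ^ Module.finrank ℝ E * (C₁ * ∫⁻ x, H x ∂μ)) := by
    intro H hH x hx s hs
    let G : E → ℝ≥0∞ := B.indicator fun y => H (ψ y)
    have hG : Measurable G := (hH.comp h.measurable).indicator hBm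
    calc ∫⁻ y, H (ψ (AffineMap.lineMap x y s)) ∂lam
        ≤ C₀ * ∫⁻ y in B, H (ψ (AffineMap.lineMap x y s)) ∂vol := lintegral_mono_smul_measure hC₀ _
      _ ≤ C₀ * ∫⁻ y, G ((1 - s) • x + s • y) ∂vol := by
        refine mul_le_mul' le_rfl ?_
        rw [← lintegral_indicator hBm]
        refine lintegral_mono fun y => ?_
        by_cases hy : y ∈ B
        · have hmem : (1 - s) • x + s • y ∈ B :=
            h.convex hx hy (by linarith [hs.2]) (by linarith [hs.1]) (by ring)
          rw [indicator_of_mem hy, AffineMap.lineMap_apply_module]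
          simp only [G, indicator_of_mem hmem, le_refl]
        · simp [hy]
      _ ≤ C₀ * (2 ^ Module.finrank ℝ E * ∫⁻ y, G y ∂vol) := by
        gcongr
        exact lintegral_homothety_le vol hG _ hs.1
      _ ≤ C₀ * (2 ^ Module.finrank ℝ E * (C₁ * ∫⁻ x, H x ∂μ)) := by
        gcongr
        rw [lintegral_indicator hBm, ← lintegral_map hH h.measurable]
        exact lintegral_mono_smul_measure hC₁ _
  refine ⟨C₀ * (2 ^ Module.finrank ℝ E * C₁) * (lam univ).toNNReal, fun H hH s hs => ?_⟩
  have key' : ∀ H : D → ℝ≥0∞, Measurable H → ∀ s ∈ Icc (1 / 2 : ℝ) 1,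
      ∫⁻ x, ∫⁻ y, H (ψ (AffineMap.lineMap x y s)) ∂lam ∂lam ≤
        (C₀ * (2 ^ Module.finrank ℝ E * C₁) * (lam univ).toNNReal : ℝ≥0) * ∫⁻ x, H x ∂μ := by
    intro H hH s hs
    calc ∫⁻ x, ∫⁻ y, H (ψ (AffineMap.lineMap x y s)) ∂lam ∂lam
        ≤ ∫⁻ _, C₀ * (2 ^ Module.finrank ℝ E * (C₁ * ∫⁻ x, H x ∂μ)) ∂lam := by
          refine lintegral_mono_ae ?_
          filter_upwards [h.ae_mem] with x hx
          exact key H hH x hx s hs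
      _ = _ := by
        rw [lintegral_const]
        push_cast
        rw [ENNReal.coe_toNNReal (measure_ne_top _ _)]
        ring
  -- With one endpoint fixed, the map of the other is a homothety of ratio `s` or `1 - s`. The
  -- endpoint whose ratio is at least `1/2` is the one integrated first.
  rcases le_total (1 / 2) s with hs' | hs'
  · exact key' H hH s ⟨hs', hs.2⟩
  · rw [lintegral_lintegral_swap]
    · have := key' H hH (1 - s) ⟨by linarith, by linarith [hs.1]⟩
      simpa only [AffineMap.lineMap_apply_one_sub] using this
    · refine Measurable.aemeasurable ?_
      refine hH.comp (h.measurable.comp ?_)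
      simp only [AffineMap.lineMap_apply_module]
      fun_prop

variable [BorelSpace D]

theorem measure_add_right_cancel {X : Type*} [MeasurableSpace X] {m₁ m₂ m : Measure X}
    [IsFiniteMeasure m] (h : m₁ + m = m₂ + m) : m₁ = m₂ := by
  ext s hs
  have := congrArg (fun k : Measure X => k s) h
  simp only [Measure.add_apply] at this
  exact (ENNReal.add_left_inj (measure_ne_top m s)).1 this

open Classical in
/-- The path along the segment between two points of the patch, with position `θ`. -/
def segmentPath (hB : Convex ℝ B) (hψ : ContinuousOn ψ B) (b : E)
    (θ : unitInterval → ℝ) (x y : E) : C(unitInterval, D) :=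
  if h : x ∈ B ∧ y ∈ B ∧ Continuous θ ∧ ∀ t, θ t ∈ Icc (0 : ℝ) 1 then
    ⟨fun t => ψ (AffineMap.lineMap x y (θ t)), by
      refine hψ.comp_continuous ?_ fun t => ?_
      · exact AffineMap.lineMap_continuous.comp h.2.2.1
      · exact hB.lineMap_mem h.1 h.2.1 (h.2.2.2 t)⟩
  else ContinuousMap.const _ (ψ b)

-- Random segments carry a small fraction `κ` of the loops, and the rest of the mass stands still.
-- Waiting times at the two ends of each segment are modulated by `u = k g`, so that only the
-- density of the starting points varies with time.
set_option maxHeartbeats 1000000 in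
theorem IsPatch.isFlexible [CompactSpace D] [IsProbabilityMeasure μ] (hA : IsPathAction A)
    (h : IsPatch vol μ A B ψ φ lam) : IsFlexible μ A (ψ '' B) := by
  classical
  have := h.isFiniteMeasure
  have hBm := h.compact.measurableSet
  set S := ψ '' B with hS
  have hSc : IsCompact S := h.compact.image_of_continuousOn h.continuousOn
  have hSm : MeasurableSet S := hSc.measurableSet
  obtain ⟨C₂, hC₂⟩ := h.exists_lintegral_lineMap_le
  obtain ⟨b, hb⟩ : B.Nonempty := by
    rw [nonempty_iff_ne_empty]
    rintro rfl
    exact h.measure_ne_zero (by simp)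
  have hlamS : lam univ = μ S := by
    have := congrArg (fun m : Measure D => m univ) h.map_eq
    simpa [Measure.map_apply h.measurable] using this
  set w : ℝ := μ.real S with hw
  have hw0 : 0 < w := ENNReal.toReal_pos h.measure_ne_zero (measure_ne_top _ _)
  have hlamw : lam univ = ENNReal.ofReal w := by
    rw [hlamS, hw, ofReal_measureReal]
  -- `κ` is the fraction of the mass that moves in the patch
  set κ : ℝ := 1 / (2 * w + C₂) with hκ
  have hκ0 : 0 < κ := by positivity
  have hκ1 : κ * (2 * w + C₂) = 1 := by
    rw [hκ, one_div, inv_mul_cancel₀ (by positivity)]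
  -- A modulation `u` at the starting points changes the total density by `κ * w * u`, so `u = k g`
  -- produces exactly `g`. The radius `1 / k` ensures `|u| ≤ 1`.
  set k : ℝ := 1 / (κ * w) with hk
  have hk0 : 0 < k := by positivity
  have hkw : κ * w * k = 1 := by
    rw [hk, mul_one_div, div_self (by positivity)]
  obtain ⟨R, hR⟩ : ∃ R : ℝ, ∀ x ∈ B, ∀ y ∈ B, dist x y ≤ R :=
    ⟨Metric.diam B, fun x hx y hy => Metric.dist_le_diam_of_mem h.compact.isBounded hx hy⟩
  refine ⟨1 / k, by positivity, fun L' => ?_⟩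
  set L := max L' 0 with hLdef
  obtain ⟨C, hC⟩ := h.action_le (k * L * R)
  refine ⟨C, fun g hg' => ?_⟩
  have hg := hg'.mono le_rfl (le_max_left L' 0)
  rw [← hLdef] at hg
  have hL0 : 0 ≤ L := le_max_right _ _
  have hgc : ∀ x, Continuous fun t => g t x := fun x =>
    (LipschitzWith.of_dist_le_mul (K := ⟨L, hL0⟩) fun s t => hg.lipschitz x s t).continuous
  let u : unitInterval → E → ℝ := fun t x => k * g t (ψ x)
  have hu : ∀ t x, |u t x| ≤ 1 := by
    intro t x
    have := hg.bound t (ψ x)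
    rw [le_div_iff₀ hk0] at this
    simp only [u]
    rw [abs_mul, abs_of_pos hk0]
    linarith
  have hum : ∀ t, Measurable (u t) := fun t =>
    ((hg.measurable t).comp h.measurable).const_mul k
  -- For fixed `x` and `m` the parameter is Lipschitz in time, and equal at times `0` and `1`
  -- because `g` vanishes there: the path is a loop.
  let θ : E → ℝ → unitInterval → ℝ := fun x m t => max 0 (min 1 (m - 1 - u t x))
  have hθI : ∀ x m t, θ x m t ∈ Icc (0 : ℝ) 1 := fun x m t =>
    ⟨le_max_left _ _, max_le zero_le_one (min_le_left _ _)⟩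
  have hθc : ∀ x m, Continuous (θ x m) := by
    intro x m
    have := hgc (ψ x)
    simp only [θ, u]
    fun_prop
  let Φ : (E × E) × ℝ → C(unitInterval, D) := fun z =>
    segmentPath h.convex h.continuousOn b (θ z.1.1 z.2) z.1.1 z.1.2
  have hΦ : ∀ z : (E × E) × ℝ, z.1.1 ∈ B → z.1.2 ∈ B → ∀ t,
      Φ z t = ψ (AffineMap.lineMap z.1.1 z.1.2 (θ z.1.1 z.2 t)) := by
    intro z h1 h2 t
    simp only [Φ, segmentPath]
    rw [dif_pos ⟨h1, h2, hθc _ _, hθI _ _⟩]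
    rfl
  have hΦ' : ∀ z : (E × E) × ℝ, ¬(z.1.1 ∈ B ∧ z.1.2 ∈ B) → Φ z = ContinuousMap.const _ (ψ b) := by
    intro z hz
    simp only [Φ, segmentPath]
    rw [dif_neg fun h => hz ⟨h.1, h.2.1⟩]
  have hline : ∀ t, Measurable fun z : (E × E) × ℝ =>
      ψ (AffineMap.lineMap z.1.1 z.1.2 (θ z.1.1 z.2 t)) := by
    intro t
    refine h.measurable.comp ?_
    have := hum t
    simp only [AffineMap.lineMap_apply_module, θ]
    fun_prop
  have hΦm : Measurable Φ := by
    refine measurable_of_eval fun t => ?_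
    have : (fun z => Φ z t) = fun z : (E × E) × ℝ => if z.1.1 ∈ B ∧ z.1.2 ∈ B then
        ψ (AffineMap.lineMap z.1.1 z.1.2 (θ z.1.1 z.2 t)) else ψ b := by
      funext z
      split_ifs with hz
      · exact hΦ z hz.1 hz.2 t
      · rw [hΦ' z hz]
        rfl
    rw [this]
    exact Measurable.ite ((hBm.preimage (measurable_fst.comp measurable_fst)).inter
      (hBm.preimage (measurable_snd.comp measurable_fst))) (hline t) measurable_const
  let P : Measure ((E × E) × ℝ) := (lam.prod lam).prod (volume.restrict (Icc (0 : ℝ) 3))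
  let occ : Measure D := ((lam.prod lam).prod (volume.restrict (Icc (0 : ℝ) 1))).map
    fun z => ψ (AffineMap.lineMap z.1.1 z.1.2 z.2)
  have hoccm : Measurable fun z : (E × E) × ℝ => ψ (AffineMap.lineMap z.1.1 z.1.2 z.2) := by
    refine h.measurable.comp ?_
    simp only [AffineMap.lineMap_apply_module]
    fun_prop
  have hocc : occ ≤ C₂ • μ := by
    refine Measure.le_iff.2 fun s hs => ?_
    have hH : Measurable (s.indicator (1 : D → ℝ≥0∞)) := measurable_one.indicator hs
    have hHo : Measurable fun z : (E × E) × ℝ =>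
        s.indicator (1 : D → ℝ≥0∞) (ψ (AffineMap.lineMap z.1.1 z.1.2 z.2)) := hH.comp hoccm
    rw [← lintegral_indicator_one hs, lintegral_map hH hoccm, lintegral_prod_symm' _ hHo]
    calc _ ≤ ∫⁻ _ in Icc (0 : ℝ) 1, C₂ * ∫⁻ x, s.indicator 1 x ∂μ := by
          refine setLIntegral_mono' measurableSet_Icc fun r hr => ?_
          have hHr : Measurable fun q : E × E =>
              s.indicator (1 : D → ℝ≥0∞) (ψ (AffineMap.lineMap q.1 q.2 r)) :=
            hH.comp (h.measurable.comp (by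
              simp only [AffineMap.lineMap_apply_module]
              fun_prop))
          rw [lintegral_prod _ hHr.aemeasurable]
          exact hC₂ _ hH r hr
      _ = _ := by
          rw [lintegral_indicator_one hs]
          simp
  have hlamint : ∀ t, ∫ x, u t x ∂lam = 0 := by
    intro t
    simp only [u]
    rw [integral_const_mul]
    have e : ∫ x, g t (ψ x) ∂lam = ∫ x, g t x ∂(lam.map ψ) :=
      (integral_map h.measurable.aemeasurable (hg.measurable t).aestronglyMeasurable).symm
    rw [e, h.map_eq, setIntegral_eq_integral_of_forall_compl_eq_zero (hg.support t),
      hg.integral, mul_zero]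
  have hmass : ∀ t, ∫⁻ x, ENNReal.ofReal (1 - u t x) ∂lam = ENNReal.ofReal w := by
    intro t
    have hui : Integrable (u t) lam :=
      Integrable.of_bound (hum t).aestronglyMeasurable 1 (ae_of_all _ (hu t))
    have hui' : Integrable (fun x => 1 - u t x) lam := (integrable_const 1).sub hui
    rw [← ofReal_integral_eq_lintegral_ofReal hui' (ae_of_all _ fun x => sub_nonneg.2
      (abs_le.1 (hu t x)).2), integral_sub (integrable_const _) hui, hlamint]
    simp only [integral_const, smul_eq_mul, mul_one, sub_zero]
    rw [Measure.real, hlamw, ENNReal.toReal_ofReal hw0.le]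
  let μS : Measure D := μ.restrict S
  -- The three terms are the particles waiting at `x`, in transit, and waiting at `y`. In the last
  -- one the factor `1 - u(t,x)` is integrated independently of `y`, and its integral is `w` since
  -- `u` has mean zero.
  have hlaw : ∀ t, P.map (fun z => Φ z t) = ENNReal.ofReal w •
      μS.withDensity (fun x => ENNReal.ofReal (1 + k * g t x)) + occ + ENNReal.ofReal w • μS := by
    intro t
    refine Measure.ext_of_lintegral _ fun H hH => ?_
    have hden : Measurable fun x => ENNReal.ofReal (1 + k * g t x) := by
      have := hg.measurable t
      fun_prop
    have hHψ : Measurable fun x => H (ψ x) := hH.comp h.measurable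
    have hΦt : Measurable fun z => Φ z t := (measurable_eval t).comp hΦm
    have hHl : Measurable fun z : (E × E) × ℝ =>
        H (ψ (AffineMap.lineMap z.1.1 z.1.2 (θ z.1.1 z.2 t))) := hH.comp (hline t)
    have hHo : Measurable fun z : (E × E) × ℝ =>
        H (ψ (AffineMap.lineMap z.1.1 z.1.2 z.2)) := hH.comp hoccm
    have e1 : ∫⁻ x, H x ∂(P.map fun z => Φ z t) =
        ∫⁻ z, H (ψ (AffineMap.lineMap z.1.1 z.1.2 (θ z.1.1 z.2 t))) ∂P := by
      rw [lintegral_map hH hΦt]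
      have hae : ∀ᵐ z ∂P, z.1.1 ∈ B ∧ z.1.2 ∈ B := by
        have h2 : ∀ᵐ q ∂(lam.prod lam), q.1 ∈ B ∧ q.2 ∈ B :=
          (Measure.quasiMeasurePreserving_fst.ae h.ae_mem).and
            (Measure.quasiMeasurePreserving_snd.ae h.ae_mem)
        exact Measure.quasiMeasurePreserving_fst.ae h2
      refine lintegral_congr_ae ?_
      filter_upwards [hae] with z hz
      rw [hΦ z hz.1 hz.2 t]
    have e2 : ∀ q : E × E, ∫⁻ m in Icc (0 : ℝ) 3,
        H (ψ (AffineMap.lineMap q.1 q.2 (θ q.1 m t))) =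
        ENNReal.ofReal (1 + u t q.1) * H (ψ q.1) +
          (∫⁻ s in Icc (0 : ℝ) 1, H (ψ (AffineMap.lineMap q.1 q.2 s))) +
          ENNReal.ofReal (1 - u t q.1) * H (ψ q.2) := by
      intro q
      have := lintegral_clamp (hu t q.1) (fun s => H (ψ (AffineMap.lineMap q.1 q.2 s)))
      simpa [θ] using this
    have hu1 : Measurable fun x => ENNReal.ofReal (1 + u t x) := by
      have := hum t
      fun_prop
    have hu2 : Measurable fun x => ENNReal.ofReal (1 - u t x) := by
      have := hum t
      fun_prop
    have m1 : Measurable fun q : E × E => ENNReal.ofReal (1 + u t q.1) * H (ψ q.1) :=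
      (hu1.comp measurable_fst).mul (hHψ.comp measurable_fst)
    have m3 : Measurable fun q : E × E => ENNReal.ofReal (1 - u t q.1) * H (ψ q.2) :=
      (hu2.comp measurable_fst).mul (hHψ.comp measurable_snd)
    have t1 : ∫⁻ q, ENNReal.ofReal (1 + u t q.1) * H (ψ q.1) ∂(lam.prod lam) =
        ENNReal.ofReal w * ∫⁻ x, H x ∂(μS.withDensity fun x => ENNReal.ofReal (1 + k * g t x)) := by
      rw [lintegral_prod _ m1.aemeasurable]
      simp only [lintegral_const]
      have hu1ψ : Measurable fun x => ENNReal.ofReal (1 + u t x) * H (ψ x) := hu1.mul hHψ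
      rw [lintegral_mul_const _ hu1ψ, hlamw, mul_comm]
      congr 1
      rw [lintegral_withDensity_eq_lintegral_mul _ hden hH]
      simp only [μS, S]
      rw [← h.map_eq, lintegral_map (hden.mul hH) h.measurable]
      rfl
    have t2 : ∫⁻ q, (∫⁻ s in Icc (0 : ℝ) 1, H (ψ (AffineMap.lineMap q.1 q.2 s))) ∂(lam.prod lam)
        = ∫⁻ x, H x ∂occ := by
      rw [lintegral_map hH hoccm, lintegral_prod _ hHo.aemeasurable]
    have t3 : ∫⁻ q, ENNReal.ofReal (1 - u t q.1) * H (ψ q.2) ∂(lam.prod lam) =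
        ENNReal.ofReal w * ∫⁻ x, H x ∂μS := by
      rw [lintegral_prod_mul hu2.aemeasurable hHψ.aemeasurable, hmass]
      congr 1
      simp only [μS, S]
      rw [← h.map_eq, lintegral_map hH h.measurable]
    rw [e1, lintegral_prod _ hHl.aemeasurable]
    simp only [e2]
    rw [lintegral_add_right _ m3, lintegral_add_left m1, t1, t2, t3, lintegral_add_measure,
      lintegral_add_measure, lintegral_smul_measure, lintegral_smul_measure]
    rfl
  -- The law of the moving particles for `u = 0`. The choice of `κ` makes it at most `μ`, so the
  -- remainder `static` is a measure.
  let moving : Measure D := ENNReal.ofReal κ • (ENNReal.ofReal w • μS + occ + ENNReal.ofReal w • μS)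
  have hmoving : moving ≤ μ := by
    refine Measure.le_iff.2 fun s hs => ?_
    have o1 : occ s ≤ C₂ * μ s := Measure.le_iff.1 hocc s hs
    have o2 : μS s ≤ μ s := Measure.restrict_le_self s
    simp only [moving, Measure.smul_apply, Measure.add_apply, smul_eq_mul]
    calc _ ≤ ENNReal.ofReal κ * (ENNReal.ofReal w * μ s + C₂ * μ s + ENNReal.ofReal w * μ s) := by
          gcongr
      _ = ENNReal.ofReal (κ * (2 * w + C₂)) * μ s := by
          rw [ENNReal.ofReal_mul hκ0.le, ENNReal.ofReal_add (by positivity) (by positivity),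
            ENNReal.ofReal_mul (by norm_num), ENNReal.ofReal_ofNat, ENNReal.ofReal_coe_nnreal]
          ring
      _ = μ s := by rw [hκ1]; simp
  have : IsFiniteMeasure moving := isFiniteMeasure_of_le _ hmoving
  let static : Measure D := μ - moving
  have hstatic : static + moving = μ := Measure.sub_add_cancel_of_le hmoving
  let cst : D → C(unitInterval, D) := fun x => ContinuousMap.const _ x
  have hcst : Measurable cst := measurable_of_eval fun t => measurable_id
  let Λ : Measure C(unitInterval, D) := ENNReal.ofReal κ • P.map Φ + static.map cst
  have hΛt : ∀ t, Λ.map (fun c => c t) = perturb μ (g t) := by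
    intro t
    have e0 : Λ.map (fun c => c t) = ENNReal.ofReal κ • P.map (fun z => Φ z t) + static := by
      simp only [Λ]
      rw [Measure.map_add _ _ (measurable_eval t), Measure.map_smul,
        Measure.map_map (measurable_eval t) hΦm, Measure.map_map (measurable_eval t) hcst]
      congr 1
      exact Measure.map_id
    rw [e0, hlaw]
    let a : ℝ≥0∞ := ENNReal.ofReal κ * ENNReal.ofReal w
    have ha : a ≠ ⊤ := ENNReal.mul_ne_top ENNReal.ofReal_ne_top ENNReal.ofReal_ne_top
    have : IsFiniteMeasure (a • μS) := by
      simp only [μS]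
      exact Measure.smul_finite _ ha
    -- Adding the unperturbed term at the starting points completes `static` to `μ` and avoids
    -- computing with a difference of measures.
    refine measure_add_right_cancel (m := a • μS) ?_
    have hden : Measurable fun x => ENNReal.ofReal (1 + k * g t x) := by
      have := hg.measurable t
      fun_prop
    have hden' : Measurable fun x => ENNReal.ofReal (1 + g t x) := by
      have := hg.measurable t
      fun_prop
    have e1 : ENNReal.ofReal κ • (ENNReal.ofReal w •
        μS.withDensity (fun x => ENNReal.ofReal (1 + k * g t x)) + occ + ENNReal.ofReal w • μS) +
        static + a • μS =
        a • μS.withDensity (fun x => ENNReal.ofReal (1 + k * g t x)) + μ := by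
      have e1' : a • μS.withDensity (fun x => ENNReal.ofReal (1 + k * g t x)) + μ =
          a • μS.withDensity (fun x => ENNReal.ofReal (1 + k * g t x)) + (static + moving) := by
        rw [hstatic]
      rw [e1']
      simp only [moving, smul_add, smul_smul, a]
      abel
    rw [e1, perturb]
    have e2 : a • μS.withDensity (fun x => ENNReal.ofReal (1 + k * g t x)) =
        μ.withDensity (S.indicator fun x => a * ENNReal.ofReal (1 + k * g t x)) := by
      rw [withDensity_indicator hSm, ← withDensity_smul _ hden]
      rfl
    have e3 : a • μS = μ.withDensity (S.indicator fun _ => a) := by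
      rw [withDensity_indicator hSm, withDensity_const]
    rw [e2, e3, ← withDensity_add_left hden']
    nth_rewrite 2 [← withDensity_one (μ := μ)]
    rw [← withDensity_add_left ((hden.const_mul a).indicator hSm)]
    congr 1
    funext x
    by_cases hx : x ∈ S
    · simp only [Pi.add_apply, indicator_of_mem hx, Pi.one_apply]
      have hk1 : -1 ≤ k * g t x := by
        have := hg.bound t x
        rw [le_div_iff₀ hk0] at this
        have h3 : |k * g t x| ≤ 1 := by
          rwa [abs_mul, abs_of_pos hk0, mul_comm]
        exact (abs_le.1 h3).1
      have haw : a = ENNReal.ofReal (κ * w) := (ENNReal.ofReal_mul hκ0.le).symm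
      have hκw : κ * w ≤ 1 := by nlinarith [C₂.2]
      have hg1 : -1 ≤ g t x := by
        have e : g t x = κ * w * (k * g t x) := by rw [← mul_assoc, hkw, one_mul]
        have : 0 < κ * w := by positivity
        nlinarith
      rw [haw, ← ENNReal.ofReal_mul (by positivity), ← ENNReal.ofReal_one,
        ← ENNReal.ofReal_add (mul_nonneg (by positivity) (by linarith)) zero_le_one,
        ← ENNReal.ofReal_add (by linarith) (by positivity)]
      congr 1
      linear_combination g t x * hkw
    · simp [hx, hg.support t x hx]
  refine ⟨Λ, ⟨?_⟩, hΛt, ?_⟩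
  · have h1 : Λ.map (fun c => c 0) univ = Λ univ := by
      rw [Measure.map_apply (measurable_eval 0) MeasurableSet.univ, preimage_univ]
    rw [← h1, hΛt 0, funext hg.zero]
    have := perturb_zero μ
    rw [show (fun _ : D => (0 : ℝ)) = 0 from rfl, this]
    exact measure_univ
  · have hloopm : MeasurableSet {c : C(unitInterval, D) | c 0 = c 1} :=
      measurableSet_eq_fun (measurable_eval 0) (measurable_eval 1)
    -- The action need not be measurable, so its bound is not transported directly to the image
    -- measure. The closed set `N` is, and the action is bounded on it.
    let N : Set C(unitInterval, D) := {c | (∀ t, c t ∈ S) ∧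
      ∀ s t, dist (φ (c s)) (φ (c t)) ≤ k * L * R * |(s : ℝ) - t|}
    have hN : IsClosed N := by
      have e : N = ⋂ (s : unitInterval) (t : unitInterval), (fun c : C(unitInterval, D) =>
          (c s, c t)) ⁻¹' ((S ×ˢ S) ∩ (fun p : D × D => dist (φ p.1) (φ p.2)) ⁻¹'
            Iic (k * L * R * |(s : ℝ) - t|)) := by
        ext c
        simp only [N, mem_ofPred_eq, mem_iInter, mem_preimage, mem_inter_iff, mem_prod, mem_Iic]
        exact ⟨fun hc s t => ⟨⟨hc.1 s, hc.1 t⟩, hc.2 s t⟩,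
          fun hc => ⟨fun t => (hc t t).1.1, fun s t => (hc s t).2⟩⟩
      rw [e]
      refine isClosed_iInter fun s => isClosed_iInter fun t => ?_
      refine IsClosed.preimage ((continuous_eval_const s).prodMk (continuous_eval_const t)) ?_
      refine ContinuousOn.preimage_isClosed_of_isClosed ?_ (hSc.isClosed.prod hSc.isClosed)
        isClosed_Iic
      have c1 : ContinuousOn (fun p : D × D => φ p.1) (S ×ˢ S) :=
        h.continuousOn_inv.comp continuousOn_fst fun p hp => hp.1
      have c2 : ContinuousOn (fun p : D × D => φ p.2) (S ×ˢ S) :=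
        h.continuousOn_inv.comp continuousOn_snd fun p hp => hp.2
      exact continuous_dist.comp_continuousOn (c1.prodMk c2)
    have hR0 : 0 ≤ R := (dist_nonneg).trans (hR b hb b hb)
    have hΦN : ∀ z, Φ z ∈ N := by
      intro z
      by_cases hz : z.1.1 ∈ B ∧ z.1.2 ∈ B
      · have hmem : ∀ t, AffineMap.lineMap z.1.1 z.1.2 (θ z.1.1 z.2 t) ∈ B := fun t =>
          h.convex.lineMap_mem hz.1 hz.2 (hθI _ _ t)
        refine ⟨fun t => ?_, fun s t => ?_⟩
        · rw [hΦ z hz.1 hz.2]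
          exact mem_image_of_mem _ (hmem t)
        · rw [hΦ z hz.1 hz.2, hΦ z hz.1 hz.2, h.left_inv _ (hmem s), h.left_inv _ (hmem t),
            dist_lineMap_lineMap, Real.dist_eq]
          have h1 : |θ z.1.1 z.2 s - θ z.1.1 z.2 t| ≤ k * L * |(s : ℝ) - t| := by
            refine (abs_clamp_sub_clamp _ _).trans ?_
            have e : z.2 - 1 - u s z.1.1 - (z.2 - 1 - u t z.1.1) =
                -(k * (g s (ψ z.1.1) - g t (ψ z.1.1))) := by
              simp only [u]
              ring
            rw [e, abs_neg, abs_mul, abs_of_pos hk0, mul_assoc]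
            gcongr
            exact hg.lipschitz _ s t
          calc _ ≤ k * L * |(s : ℝ) - t| * R := by
                gcongr
                exact hR _ hz.1 _ hz.2
            _ = _ := by ring
      · rw [hΦ' z hz]
        refine ⟨fun t => mem_image_of_mem _ hb, fun s t => ?_⟩
        simp only [ContinuousMap.const_apply, dist_self]
        positivity
    have hΦloop : ∀ z, Φ z 0 = Φ z 1 := by
      intro z
      by_cases hz : z.1.1 ∈ B ∧ z.1.2 ∈ B
      · rw [hΦ z hz.1 hz.2, hΦ z hz.1 hz.2]
        simp [θ, u, hg.zero, hg.one]
      · rw [hΦ' z hz]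
        rfl
    have hconst : IsClosed {c : C(unitInterval, D) | ∀ t, c t = c 0} := by
      simp only [ofPred_forall]
      exact isClosed_iInter fun t =>
        isClosed_eq (continuous_eval_const t) (continuous_eval_const 0)
    rw [ae_add_measure_iff]
    refine ⟨Measure.ae_smul_measure ?_ _, ?_⟩
    · have h1 : ∀ᵐ c ∂(P.map Φ), c 0 = c 1 ∧ c ∈ N := by
        have hm : MeasurableSet {c : C(unitInterval, D) | c 0 = c 1 ∧ c ∈ N} :=
          hloopm.inter hN.measurableSet
        rw [ae_map_iff hΦm.aemeasurable hm]
        exact ae_of_all _ fun z => ⟨hΦloop z, hΦN z⟩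
      filter_upwards [h1] with c hc
      exact ⟨hc.1, hC c hc.2.1 hc.2.2⟩
    · have h1 : ∀ᵐ c ∂(static.map cst), ∀ t, c t = c 0 := by
        rw [ae_map_iff hcst.aemeasurable hconst.measurableSet]
        exact ae_of_all _ fun z t => rfl
      filter_upwards [h1] with c hc
      refine ⟨(hc 1).symm, ?_⟩
      have : c = ContinuousMap.const _ (c 0) := ContinuousMap.ext hc
      rw [this, hA.const]
      exact zero_le

end Patch

end GeneralizedFlow

end

noncomputable section

namespace GeneralizedFlow

/-! ### The action of concatenated paths -/

section Action

/-- Monotonicity keeps disjoint intervals disjoint, and the Lipschitz bound controls the sum of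
their lengths. -/
theorem absolutelyContinuousOnInterval_comp_monotone {X : Type*} [PseudoMetricSpace X]
    {g : ℝ → X} {m : ℝ → ℝ} {K : ℝ≥0} (hg : AbsolutelyContinuousOnInterval g 0 1)
    (hm : Monotone m) (hK : LipschitzWith K m) (h01 : ∀ t, m t ∈ Icc (0 : ℝ) 1) :
    AbsolutelyContinuousOnInterval (g ∘ m) 0 1 := by
  rw [absolutelyContinuousOnInterval_iff] at hg ⊢
  intro ε hε
  obtain ⟨δ, hδ, h⟩ := hg ε hε
  refine ⟨δ / (K + 1), by positivity, fun E hE hsum => ?_⟩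
  refine h (E.1, fun i => (m (E.2 i).1, m (E.2 i).2)) ⟨fun i _ => ?_, fun i hi j hj hij => ?_⟩ ?_
  · simpa [uIcc_of_le (zero_le_one' ℝ)] using And.intro (h01 (E.2 i).1) (h01 (E.2 i).2)
  · have hd := hE.2 hi hj hij
    simp only [Function.onFun] at hd ⊢
    rw [Set.disjoint_left] at hd ⊢
    intro x hx hx'
    simp only [uIoc, mem_Ioc, ← hm.map_min, ← hm.map_max] at hx hx'
    have h1 := hm.reflect_lt (hx.1.trans_le hx.2)
    have h2 := hm.reflect_lt (hx'.1.trans_le hx'.2)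
    have h3 := hm.reflect_lt (hx.1.trans_le hx'.2)
    have h4 := hm.reflect_lt (hx'.1.trans_le hx.2)
    exact hd (a := min (max (E.2 i).1 (E.2 i).2) (max (E.2 j).1 (E.2 j).2))
      ⟨lt_min h1 h3, min_le_left _ _⟩ ⟨lt_min h4 h2, min_le_right _ _⟩
  · calc ∑ i ∈ Finset.range E.1, dist (m (E.2 i).1) (m (E.2 i).2)
        ≤ ∑ i ∈ Finset.range E.1, (K + 1) * dist (E.2 i).1 (E.2 i).2 :=
          Finset.sum_le_sum fun i _ => (hK.dist_le_mul _ _).trans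
            (mul_le_mul_of_nonneg_right (by simp) dist_nonneg)
      _ < δ := by
          rw [← Finset.mul_sum, mul_comm]
          exact (lt_div_iff₀ (by positivity)).1 hsum

variable {D : Type*}

theorem extendPath_apply [TopologicalSpace D] (c : C(unitInterval, D)) {t : ℝ}
    (ht : t ∈ Icc (0 : ℝ) 1) : extendPath c t = c ⟨t, ht⟩ :=
  IccExtend_of_mem _ _ ht

theorem extendPath_first [MetricSpace D] {τ : ℝ} {c₁ c₂ c : C(unitInterval, D)}
    (hc : IsConcat τ c₁ c₂ c) (h1 : τ < 1) {t : ℝ} (ht : t ∈ Icc (0 : ℝ) τ) :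
    extendPath c t = extendPath c₁ (t / τ) := by
  rw [extendPath_apply c ⟨ht.1, ht.2.trans h1.le⟩, hc.first _ ht.2]
  rfl

theorem extendPath_second [MetricSpace D] {τ : ℝ} {c₁ c₂ c : C(unitInterval, D)}
    (hc : IsConcat τ c₁ c₂ c) (h0 : 0 < τ) {t : ℝ} (ht : t ∈ Icc (τ : ℝ) 1) :
    extendPath c t = extendPath c₂ ((t - τ) / (1 - τ)) := by
  rw [extendPath_apply c ⟨h0.le.trans ht.1, ht.2⟩, hc.second _ ht.1]
  rfl

theorem extendPath_projIcc [TopologicalSpace D] (c : C(unitInterval, D)) (t : ℝ) :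
    extendPath c (projIcc 0 1 (zero_le_one' ℝ) t) = extendPath c t := by
  simp [extendPath, IccExtend]

theorem absolutelyContinuousOnInterval_extendPath_comp [PseudoMetricSpace D]
    {c : C(unitInterval, D)} (hc : AbsolutelyContinuousOnInterval (extendPath c) 0 1) {a : ℝ}
    (ha : 0 ≤ a) (b : ℝ) :
    AbsolutelyContinuousOnInterval (fun t => extendPath c (a * t + b)) 0 1 := by
  have h := absolutelyContinuousOnInterval_comp_monotone (K := Real.toNNReal a) hc
    (m := fun t => (projIcc 0 1 (zero_le_one' ℝ) (a * t + b) : ℝ))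
    (fun s t hst => monotone_projIcc _
      (add_le_add_left (mul_le_mul_of_nonneg_left hst ha) b)) ?_ fun t => Subtype.prop _
  · simpa only [Function.comp_def, extendPath_projIcc] using h
  · refine LipschitzWith.of_dist_le_mul fun s t => ?_
    refine ((LipschitzWith.projIcc (zero_le_one' ℝ)).dist_le_mul _ _).trans ?_
    simp only [Real.dist_eq, Real.coe_toNNReal a ha, NNReal.coe_one, one_mul,
      add_sub_add_right_eq_sub, ← mul_sub, abs_mul, abs_of_nonneg ha]
    exact le_rfl

/-- Reparametrized and extended by constants, `c₁` stays at the junction point after `τ` and `c₂`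
before it. Increments of `c` are thus bounded by the sum of the increments of two absolutely
continuous curves. -/
theorem IsConcat.absolutelyContinuousOnInterval [MetricSpace D] {τ : ℝ}
    {c₁ c₂ c : C(unitInterval, D)} (hc : IsConcat τ c₁ c₂ c) (h0 : 0 < τ) (h1 : τ < 1)
    (hc₁ : AbsolutelyContinuousOnInterval (extendPath c₁) 0 1)
    (hc₂ : AbsolutelyContinuousOnInterval (extendPath c₂) 0 1) :
    AbsolutelyContinuousOnInterval (extendPath c) 0 1 := by
  have h0' := h0
  have h1' : (0 : ℝ) < 1 - τ := sub_pos.2 h1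
  have k₁ := absolutelyContinuousOnInterval_extendPath_comp hc₁ (inv_nonneg.2 h0'.le) 0
  have k₂ := absolutelyContinuousOnInterval_extendPath_comp hc₂ (inv_nonneg.2 h1'.le)
    (-τ / (1 - τ))
  have e₁ : ∀ t ∈ Icc (0 : ℝ) τ, extendPath c t = extendPath c₁ ((τ : ℝ)⁻¹ * t + 0) :=
    fun t ht => by rw [extendPath_first hc h1 ht]; congr 1; ring
  have e₂ : ∀ t ∈ Icc (τ : ℝ) 1,
      extendPath c t = extendPath c₂ ((1 - τ : ℝ)⁻¹ * t + -τ / (1 - τ)) :=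
    fun t ht => by rw [extendPath_second hc h0 ht]; congr 1; ring
  have f₁ : ∀ t ∈ Icc (τ : ℝ) 1, extendPath c₁ ((τ : ℝ)⁻¹ * t + 0) = extendPath c τ := by
    intro t ht
    rw [e₁ τ ⟨h0'.le, le_rfl⟩]
    have : 1 ≤ (τ : ℝ)⁻¹ * t + 0 := by
      rw [add_zero, ← div_eq_inv_mul, one_le_div h0']; exact ht.1
    rw [extendPath, IccExtend_of_right_le _ _ this, IccExtend_of_right_le]
    simp [h0'.ne']
  have f₂ : ∀ t ∈ Icc (0 : ℝ) τ,
      extendPath c₂ ((1 - τ : ℝ)⁻¹ * t + -τ / (1 - τ)) = extendPath c τ := by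
    intro t ht
    rw [e₂ τ ⟨le_rfl, h1.le⟩]
    have : ∀ t ≤ (τ : ℝ), (1 - τ : ℝ)⁻¹ * t + -τ / (1 - τ) ≤ 0 := by
      intro t ht
      rw [← div_eq_inv_mul, ← add_div]
      exact div_nonpos_of_nonpos_of_nonneg (by linarith) h1'.le
    rw [extendPath, IccExtend_of_le_left _ _ (this t ht.2), IccExtend_of_le_left _ _ (this τ le_rfl)]
  have key : ∀ s ∈ Icc (0 : ℝ) 1, ∀ t ∈ Icc (0 : ℝ) 1, s ≤ t →
      dist (extendPath c s) (extendPath c t) ≤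
      dist (extendPath c₁ ((τ : ℝ)⁻¹ * s + 0)) (extendPath c₁ ((τ : ℝ)⁻¹ * t + 0)) +
      dist (extendPath c₂ ((1 - τ : ℝ)⁻¹ * s + -τ / (1 - τ)))
        (extendPath c₂ ((1 - τ : ℝ)⁻¹ * t + -τ / (1 - τ))) := by
    intro s hs t ht hst
    rcases le_total t τ with h | h
    · rw [e₁ s ⟨hs.1, hst.trans h⟩, e₁ t ⟨ht.1, h⟩]
      exact le_add_of_nonneg_right dist_nonneg
    rcases le_total s τ with h' | h'
    · rw [f₁ t ⟨h, ht.2⟩, f₂ s ⟨hs.1, h'⟩, ← e₁ s ⟨hs.1, h'⟩, ← e₂ t ⟨h, ht.2⟩]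
      exact dist_triangle _ _ _
    · rw [e₂ s ⟨h', hs.2⟩, e₂ t ⟨h, ht.2⟩]
      exact le_add_of_nonneg_left dist_nonneg
  refine squeeze_zero' (Filter.Eventually.of_forall fun E =>
    Finset.sum_nonneg fun i _ => dist_nonneg) ?_ (by
      have := Filter.Tendsto.add k₁ k₂
      rwa [add_zero] at this)
  rw [Filter.eventually_inf_principal]
  refine Filter.Eventually.of_forall fun E hE => ?_
  rw [← Finset.sum_add_distrib]
  refine Finset.sum_le_sum fun i hi => ?_
  have hh := hE.1 i hi
  rw [uIcc_of_le (zero_le_one' ℝ)] at hh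
  rcases le_total (E.2 i).1 (E.2 i).2 with h | h
  · exact key _ hh.1 _ hh.2 h
  · have := key _ hh.2 _ hh.1 h
    simpa only [dist_comm] using this

theorem lintegral_comp_affine (h : ℝ → ℝ≥0∞) {a : ℝ} (ha : 0 < a) (b : ℝ) :
    ∫⁻ t, h (a * t + b) = ENNReal.ofReal a⁻¹ * ∫⁻ t, h t := by
  have e : MeasurableEmbedding fun t : ℝ => a * t + b :=
    ((Homeomorph.mulLeft₀ a ha.ne').trans (Homeomorph.addRight b)).measurableEmbedding
  have : (volume : Measure ℝ).map (fun t => a * t + b) = ENNReal.ofReal a⁻¹ • volume := by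
    have := Measure.map_map (μ := (volume : Measure ℝ)) (measurable_id.add_const b)
      (measurable_id.const_mul a)
    simp only [id, Function.comp_def] at this
    rw [← this, Real.map_volume_mul_left ha.ne', Measure.map_smul, map_add_right_eq_self,
      abs_of_pos (inv_pos.2 ha)]
  rw [← e.lintegral_map, this, lintegral_smul_measure, smul_eq_mul]

/-- A functional that measures the speed of a curve at a given time. -/
structure IsSpeed [TopologicalSpace D] (speed : (ℝ → D) → ℝ → ℝ≥0∞) : Prop where
  const : ∀ x t, speed (fun _ => x) t = 0
  congr : ∀ f g t, f =ᶠ[𝓝 t] g → speed f t = speed g t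
  comp_le : ∀ f a b t, 0 < a →
    speed (fun s => f (a * s + b)) t ≤ ENNReal.ofReal a * speed f (a * t + b)

open Classical in
/-- The action `∫₀¹ ½ |ω'(t)|² dt` for a given notion of speed. -/
def speedAction [PseudoMetricSpace D] (speed : (ℝ → D) → ℝ → ℝ≥0∞) (c : C(unitInterval, D)) :
    ℝ≥0∞ :=
  if AbsolutelyContinuousOnInterval (extendPath c) 0 1 then
    ∫⁻ t in Icc (0 : ℝ) 1, 2⁻¹ * speed (extendPath c) t ^ 2
  else ⊤

/-- The squared speed contributes `a ^ 2` and the change of variables `a⁻¹`, which leaves `a`. -/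
theorem IsSpeed.setLIntegral_le [TopologicalSpace D] {speed : (ℝ → D) → ℝ → ℝ≥0∞}
    (hs : IsSpeed speed) {f g : ℝ → D} {a b p q : ℝ} (ha : 0 < a)
    (hfg : ∀ t ∈ Ioo p q, f t = g (a * t + b))
    (hpq : ∀ t ∈ Ioo p q, a * t + b ∈ Icc (0 : ℝ) 1) :
    ∫⁻ t in Ioo p q, 2⁻¹ * speed f t ^ 2 ≤
      ENNReal.ofReal a * ∫⁻ t in Icc (0 : ℝ) 1, 2⁻¹ * speed g t ^ 2 := by
  set h : ℝ → ℝ≥0∞ := (Icc (0 : ℝ) 1).indicator fun t => 2⁻¹ * speed g t ^ 2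
  calc ∫⁻ t in Ioo p q, 2⁻¹ * speed f t ^ 2
      ≤ ∫⁻ t in Ioo p q, ENNReal.ofReal a ^ 2 * h (a * t + b) := by
        refine setLIntegral_mono' measurableSet_Ioo fun t ht => ?_
        rw [hs.congr f (fun s => g (a * s + b)) t
          (Filter.eventuallyEq_of_mem (Ioo_mem_nhds ht.1 ht.2) hfg)]
        simp only [h, indicator_of_mem (hpq t ht)]
        grw [hs.comp_le g a b t ha]
        rw [mul_pow, mul_left_comm]
    _ ≤ ∫⁻ t, ENNReal.ofReal a ^ 2 * h (a * t + b) := setLIntegral_le_lintegral _ _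
    _ = ENNReal.ofReal a * ∫⁻ t in Icc (0 : ℝ) 1, 2⁻¹ * speed g t ^ 2 := by
        rw [lintegral_const_mul' _ _ (by finiteness), lintegral_comp_affine h ha b,
          lintegral_indicator measurableSet_Icc, ← mul_assoc]
        congr 1
        rw [sq, mul_assoc, ← ENNReal.ofReal_mul ha.le, mul_inv_cancel₀ ha.ne', ENNReal.ofReal_one,
          mul_one]

theorem IsSpeed.isPathAction [MetricSpace D] {speed : (ℝ → D) → ℝ → ℝ≥0∞}
    (hs : IsSpeed speed) : IsPathAction (speedAction speed) where
  const x := by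
    have : extendPath (ContinuousMap.const unitInterval x) = fun _ => x := rfl
    rw [speedAction, this, if_pos]
    · simp [hs.const]
    · exact (LipschitzWith.const x).lipschitzOnWith.absolutelyContinuousOnInterval
  concat τ h0 h1 := by
    have h0' := h0
    have h1' : (0 : ℝ) < 1 - τ := sub_pos.2 h1
    refine ⟨Real.toNNReal (τ : ℝ)⁻¹ + Real.toNNReal (1 - τ : ℝ)⁻¹, fun c₁ c₂ c hc => ?_⟩
    have hpos : ((Real.toNNReal (τ : ℝ)⁻¹ + Real.toNNReal (1 - τ : ℝ)⁻¹ : ℝ≥0) : ℝ≥0∞) ≠ 0 := by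
      simpa using fun h => absurd h (not_le.2 h0')
    by_cases hc₁ : AbsolutelyContinuousOnInterval (extendPath c₁) 0 1
    swap
    · simp only [speedAction, if_neg hc₁, top_add, ENNReal.mul_top hpos, le_top]
    by_cases hc₂ : AbsolutelyContinuousOnInterval (extendPath c₂) 0 1
    swap
    · simp only [speedAction, if_neg hc₂, add_top, ENNReal.mul_top hpos, le_top]
    simp only [speedAction, if_pos hc₁, if_pos hc₂,
      if_pos (hc.absolutelyContinuousOnInterval h0 h1 hc₁ hc₂)]
    have hsub : Ioo (0 : ℝ) 1 ⊆ (Ioo (0 : ℝ) τ ∪ Ioo (τ : ℝ) 1) ∪ {(τ : ℝ)} := by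
      intro t ht
      rcases lt_trichotomy t τ with h | h | h
      · exact .inl (.inl ⟨ht.1, h⟩)
      · exact .inr h
      · exact .inl (.inr ⟨h, ht.2⟩)
    have i₁ := hs.setLIntegral_le (f := extendPath c) (g := extendPath c₁) (p := 0) (q := τ)
      (b := 0) (inv_pos.2 h0')
      (fun t ht => by rw [extendPath_first hc h1 ⟨ht.1.le, ht.2.le⟩]; congr 1; ring)
      (fun t ht => by
        rw [add_zero, ← div_eq_inv_mul]
        exact ⟨div_nonneg ht.1.le h0'.le, (div_le_one h0').2 ht.2.le⟩)
    have i₂ := hs.setLIntegral_le (f := extendPath c) (g := extendPath c₂) (p := τ) (q := 1)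
      (b := -τ / (1 - τ)) (inv_pos.2 h1')
      (fun t ht => by rw [extendPath_second hc h0 ⟨ht.1.le, ht.2.le⟩]; congr 1; ring)
      (fun t ht => by
        rw [← div_eq_inv_mul, ← add_div]
        exact ⟨div_nonneg (by linarith [ht.1]) h1'.le, (div_le_one h1').2 (by linarith [ht.2])⟩)
    rw [← restrict_Ioo_eq_restrict_Icc]
    calc ∫⁻ t in Ioo (0 : ℝ) 1, 2⁻¹ * speed (extendPath c) t ^ 2
        ≤ ∫⁻ t in (Ioo (0 : ℝ) τ ∪ Ioo (τ : ℝ) 1) ∪ {(τ : ℝ)}, 2⁻¹ * speed (extendPath c) t ^ 2 :=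
          lintegral_mono_set hsub
      _ ≤ (∫⁻ t in Ioo (0 : ℝ) τ, 2⁻¹ * speed (extendPath c) t ^ 2) +
          (∫⁻ t in Ioo (τ : ℝ) 1, 2⁻¹ * speed (extendPath c) t ^ 2) + 0 := by
          refine (lintegral_union_le _ _ _).trans ?_
          refine add_le_add (lintegral_union_le _ _ _) ?_
          rw [setLIntegral_measure_zero _ _ (by simp)]
      _ ≤ _ := by
          rw [add_zero, restrict_Ioo_eq_restrict_Icc (a := (0 : ℝ)) (b := 1), mul_add,
            ENNReal.coe_add]
          refine add_le_add (i₁.trans ?_) (i₂.trans ?_)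
          · exact mul_le_mul_left (le_add_of_nonneg_right zero_le) _
          · exact mul_le_mul_left (le_add_of_nonneg_left zero_le) _

variable {d : ℕ} {M : Type*} [MetricSpace M] [ChartedSpace (EuclideanSpace ℝ (Fin d)) M]
  [RiemannianBundle (fun x : M => TangentSpace (𝓡 d) x)]

variable (d) in
theorem isSpeed_enorm_mfderiv : IsSpeed fun (f : ℝ → M) t =>
    ‖mfderiv 𝓘(ℝ, ℝ) (𝓡 d) f t (1 : ℝ)‖ₑ where
  const x t := by
    rw [mfderiv_const]
    exact enorm_zero
  congr f g t h := by
    have e := h.mfderiv_eq (I := 𝓘(ℝ, ℝ)) (I' := 𝓡 d)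
    -- The derivatives live in the tangent spaces at `f t` and `g t`. Generalizing first allows the
    -- base points to be identified before the norms are compared.
    have e' := h.eq_of_nhds
    show ‖mfderiv 𝓘(ℝ, ℝ) (𝓡 d) f t (1 : ℝ)‖ₑ = ‖mfderiv 𝓘(ℝ, ℝ) (𝓡 d) g t (1 : ℝ)‖ₑ
    generalize mfderiv 𝓘(ℝ, ℝ) (𝓡 d) f t = A at e
    generalize mfderiv 𝓘(ℝ, ℝ) (𝓡 d) g t = B at e
    generalize f t = u at *
    subst e'
    have : A = B := e
    rw [this]
  comp_le f a b t ha := by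
    have hd : ∀ p q s : ℝ, HasMFDerivAt 𝓘(ℝ, ℝ) 𝓘(ℝ, ℝ) (fun s : ℝ => p * s + q) s
        (p • ContinuousLinearMap.id ℝ ℝ) := fun p q s =>
      (((hasFDerivAt_id s).const_mul p).add_const q).hasMFDerivAt
    by_cases h : MDifferentiableAt 𝓘(ℝ, ℝ) (𝓡 d) (fun s => f (a * s + b)) t
    · have hf : MDifferentiableAt 𝓘(ℝ, ℝ) (𝓡 d) f (a * t + b) := by
        have e : f = (fun s => f (a * s + b)) ∘ fun s : ℝ => a⁻¹ * s + -(a⁻¹ * b) := by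
          funext s
          simp only [Function.comp_apply]
          congr 1
          field_simp
          ring
        rw [e]
        refine MDifferentiableAt.comp _ ?_ (hd _ _ _).mdifferentiableAt
        convert h using 1
        field_simp
        ring
      have := (hf.hasMFDerivAt.comp t (hd a b t)).mfderiv
      simp only [Function.comp_def] at this
      rw [this]
      have e2 : (mfderiv 𝓘(ℝ, ℝ) (𝓡 d) f (a * t + b) ∘SL (a • ContinuousLinearMap.id ℝ ℝ)) (1 : ℝ)
          = a • mfderiv 𝓘(ℝ, ℝ) (𝓡 d) f (a * t + b) (1 : ℝ) :=
        (mfderiv 𝓘(ℝ, ℝ) (𝓡 d) f (a * t + b)).map_smul a (1 : ℝ)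
      refine le_of_eq ?_
      refine (congrArg enorm e2).trans ?_
      rw [enorm_smul, Real.enorm_eq_ofReal ha.le]
    -- Where the curve is not differentiable its derivative is zero by convention.
    · rw [mfderiv_zero_of_not_mdifferentiableAt h]
      exact enorm_zero.trans_le zero_le

variable (d) in
theorem isPathAction_pathAction : IsPathAction (pathAction d : C(unitInterval, M) → ℝ≥0∞) :=
  (isSpeed_enorm_mfderiv d).isPathAction

theorem isSpeed_enorm_deriv : IsSpeed fun (f : ℝ → unitCube d) t =>
    ‖deriv (fun s => (f s : EuclideanSpace ℝ (Fin d))) t‖ₑ where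
  const x t := by simp
  congr f g t h := congrArg enorm (h.fun_comp Subtype.val).deriv_eq
  comp_le f a b t ha := by
    refine le_of_eq ?_
    have h := deriv_comp_mul_left a (fun s => (f (s + b) : EuclideanSpace ℝ (Fin d))) t
    have h' := deriv_comp_add_const (fun s => (f s : EuclideanSpace ℝ (Fin d))) b (a * t)
    rw [h, h', enorm_smul, Real.enorm_eq_ofReal ha.le]

theorem isPathAction_cubePathAction :
    IsPathAction (cubePathAction : C(unitInterval, unitCube d) → ℝ≥0∞) :=
  isSpeed_enorm_deriv.isPathAction

end Action

end GeneralizedFlow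

end

noncomputable section

namespace GeneralizedFlow

/-! ### Lipschitz paths and differentiable functions of time -/

section Lipschitz

theorem lipschitzWith_comp_extendPath {D E : Type*} [TopologicalSpace D] [PseudoMetricSpace E]
    {φ : D → E} {c : C(unitInterval, D)} {L : ℝ}
    (hc : ∀ s t : unitInterval, dist (φ (c s)) (φ (c t)) ≤ L * |(s : ℝ) - t|) :
    LipschitzWith (Real.toNNReal L) fun t => φ (extendPath c t) := by
  refine LipschitzWith.of_dist_le_mul fun s t => ?_
  refine (hc _ _).trans ?_
  refine mul_le_mul (Real.le_coe_toNNReal L) ?_ (abs_nonneg _) NNReal.zero_le_coe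
  have := (LipschitzWith.projIcc (zero_le_one' ℝ)).dist_le_mul s t
  rwa [NNReal.coe_one, one_mul] at this

theorem speedAction_le {D : Type*} [PseudoMetricSpace D] {speed : (ℝ → D) → ℝ → ℝ≥0∞}
    {c : C(unitInterval, D)} (hc : AbsolutelyContinuousOnInterval (extendPath c) 0 1) {C : ℝ≥0}
    (hC : ∀ t, speed (extendPath c) t ≤ C) : speedAction speed c ≤ (C ^ 2 : ℝ≥0) := by
  rw [speedAction, if_pos hc]
  calc ∫⁻ t in Icc (0 : ℝ) 1, 2⁻¹ * speed (extendPath c) t ^ 2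
      ≤ ∫⁻ _ in Icc (0 : ℝ) 1, (C : ℝ≥0∞) ^ 2 := by
        refine lintegral_mono fun t => ?_
        grw [hC t]
        exact mul_le_of_le_one_left' (by simp)
    _ = (C ^ 2 : ℝ≥0) := by simp

theorem enorm_sub_le_of_enorm_derivWithin_le {g : ℝ → ℝ} (hg : DifferentiableOn ℝ g (Icc 0 1))
    {K : ℝ≥0∞} (hK : ∀ t ∈ Icc (0 : ℝ) 1, ‖derivWithin g (Icc 0 1) t‖ₑ ≤ K) {s t : ℝ}
    (hs : s ∈ Icc (0 : ℝ) 1) (ht : t ∈ Icc (0 : ℝ) 1) : ‖g s - g t‖ₑ ≤ K * edist s t := by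
  rcases eq_or_ne s t with rfl | hst
  · simp
  induction K with
  | top => rw [ENNReal.top_mul (by simpa using hst)]; exact le_top
  | coe K =>
    have := (convex_Icc (0 : ℝ) 1).lipschitzOnWith_of_nnnorm_derivWithin_le hg
      (C := K) fun t ht => by exact_mod_cast hK t ht
    have := this hs ht
    rwa [edist_eq_enorm_sub] at this

end Lipschitz

/-! ### The cube -/

section CubePatch

variable {d : ℕ}

theorem isCompact_unitCube : IsCompact (unitCube d) := by
  have h : unitCube d = (EuclideanSpace.equiv (Fin d) ℝ).toHomeomorph ⁻¹'
      (Set.pi univ fun _ => Icc (0 : ℝ) 1) := by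
    ext x
    exact ⟨fun h i _ => h i, fun h i => h i trivial⟩
  rw [h, Homeomorph.isCompact_preimage]
  exact isCompact_univ_pi fun _ => isCompact_Icc

instance compactSpace_unitCube : CompactSpace (unitCube d) :=
  isCompact_iff_compactSpace.1 isCompact_unitCube

theorem convex_unitCube : Convex ℝ (unitCube d) := by
  intro x hx y hy a b ha hb hab i
  exact convex_Icc (0 : ℝ) 1 (hx i) (hy i) ha hb hab

theorem volume_unitCube : volume (unitCube d) = 1 := by
  have h : unitCube d = (MeasurableEquiv.toLp 2 (Fin d → ℝ)).symm ⁻¹'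
      (Set.pi univ fun _ => Icc (0 : ℝ) 1) := by
    ext x
    exact ⟨fun h i _ => h i, fun h i => h i trivial⟩
  rw [h, ((EuclideanSpace.volume_preserving_symm_measurableEquiv_toLp (Fin d))).measure_preimage
    (MeasurableSet.univ_pi fun _ => measurableSet_Icc).nullMeasurableSet, volume_pi_pi]
  simp

theorem measurableSet_unitCube : MeasurableSet (unitCube d) :=
  isCompact_unitCube.isClosed.measurableSet

instance isProbabilityMeasure_cubeVolume : IsProbabilityMeasure (cubeVolume d) :=
  ⟨by rw [cubeVolume, comap_subtype_coe_apply measurableSet_unitCube, image_univ,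
    Subtype.range_coe, volume_unitCube]⟩

open Classical in
/-- A measurable left inverse of the inclusion of the cube. -/
def toCube (x : EuclideanSpace ℝ (Fin d)) : unitCube d :=
  if h : x ∈ unitCube d then ⟨x, h⟩ else ⟨0, fun i => by simp⟩

theorem toCube_of_mem {x : EuclideanSpace ℝ (Fin d)} (h : x ∈ unitCube d) :
    toCube x = ⟨x, h⟩ := dif_pos h

theorem measurable_toCube : Measurable (toCube : EuclideanSpace ℝ (Fin d) → unitCube d) := by
  classical
  refine measurable_of_restrict_of_restrict_compl measurableSet_unitCube ?_ ?_
  · convert! measurable_id (α := unitCube d) using 1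
    exact funext fun x => toCube_of_mem x.2
  · convert! measurable_const (a := (⟨0, fun i => by simp⟩ : unitCube d)) using 1
    exact funext fun x => dif_neg x.2

theorem image_toCube : toCube '' unitCube d = univ :=
  eq_univ_of_forall fun x => ⟨x, x.2, toCube_of_mem x.2⟩

theorem map_toCube : (volume.restrict (unitCube d)).map toCube = cubeVolume d := by
  ext s hs
  rw [Measure.map_apply measurable_toCube hs, Measure.restrict_apply (measurable_toCube hs),
    cubeVolume, comap_subtype_coe_apply measurableSet_unitCube]
  congr 1
  ext x
  constructor
  · rintro ⟨h1, h2⟩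
    rw [mem_preimage, toCube_of_mem h2] at h1
    exact ⟨_, h1, rfl⟩
  · rintro ⟨y, hy, rfl⟩
    refine ⟨?_, y.2⟩
    rwa [mem_preimage, toCube_of_mem y.2]

/-- The cube is compact and convex, so it is one patch in its own coordinates. Segments remain
inside, and its boundary needs no special treatment. -/
theorem isPatch_cube : IsPatch (volume : Measure (EuclideanSpace ℝ (Fin d))) (cubeVolume d)
    cubePathAction (unitCube d) toCube (↑) (volume.restrict (unitCube d)) where
  convex := convex_unitCube
  compact := isCompact_unitCube
  measurable := measurable_toCube
  continuousOn := by
    rw [continuousOn_iff_continuous_domRestrict]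
    exact continuous_id.congr fun x => (toCube_of_mem x.2).symm
  continuousOn_inv := continuous_subtype_val.continuousOn
  left_inv y hy := by rw [toCube_of_mem hy]
  action_le L := by
    refine ⟨Real.toNNReal L ^ 2, fun c _ hc => ?_⟩
    have h := lipschitzWith_comp_extendPath hc
    refine speedAction_le (speed := fun (f : ℝ → unitCube d) t =>
      ‖deriv (fun s => (f s : EuclideanSpace ℝ (Fin d))) t‖ₑ) ?_ fun t => ?_
    · exact LipschitzOnWith.absolutelyContinuousOnInterval (K := Real.toNNReal L)
        fun s _ t _ => h s t
    · have := norm_deriv_le_of_lipschitz (x₀ := t) h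
      rw [enorm_le_coe]
      exact_mod_cast this
  le_vol := ⟨1, by simp⟩
  map_eq := by rw [image_toCube, Measure.restrict_univ, map_toCube]
  map_vol_le := ⟨1, by rw [map_toCube]; simp⟩
  measure_ne_zero := by simp [image_toCube]

theorem cubeExtend_apply (f : unitInterval × unitCube d → ℝ) (t : unitInterval) (x : unitCube d) :
    cubeExtend f (t, x) = f (t, x) :=
  dif_pos ⟨t.2, x.2⟩

theorem timeNorm_le_cubeC1Norm (f : cubeC1 d) : timeNorm f.1 ≤ cubeC1Norm f := by
  have hle := fun z => le_iSup (fun z : unitInterval × unitCube d =>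
    max ‖f.1 z‖ₑ (max ‖cubeTimeDeriv f z‖ₑ ‖cubeSpaceDeriv f z‖ₑ)) z
  refine timeNorm_le_iff.2 ⟨fun z => (le_max_left _ _).trans (hle z), fun x s t => ?_⟩
  have hf : ContDiffOn ℝ 1 (cubeExtend f.1) (Icc (0 : ℝ) 1 ×ˢ unitCube d) := f.2
  have h := enorm_sub_le_of_enorm_derivWithin_le (g := fun s => cubeExtend f.1 (s, x))
    (K := cubeC1Norm f) ?_ ?_ s.2 t.2
  · rwa [cubeExtend_apply, cubeExtend_apply] at h
  · exact (hf.differentiableOn one_ne_zero).comp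
      (differentiableOn_id.prodMk (differentiableOn_const _)) fun t ht => ⟨ht, x.2⟩
  · intro t ht
    exact ((le_max_left _ _).trans (le_max_right _ _)).trans (hle (⟨t, ht⟩, x))

theorem measurable_cubeC1 (f : cubeC1 d) (t : unitInterval) : Measurable fun x => f.1 (t, x) := by
  have hf : ContDiffOn ℝ 1 (cubeExtend f.1) (Icc (0 : ℝ) 1 ×ˢ unitCube d) := f.2
  refine Continuous.measurable ?_
  have := hf.continuousOn.comp_continuous (f := fun x : unitCube d =>
    ((t : ℝ), (x : EuclideanSpace ℝ (Fin d)))) (by fun_prop) fun x => ⟨t.2, x.2⟩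
  exact this.congr fun x => cubeExtend_apply f.1 t x

theorem exists_pressure_cube {η γ : Measure (unitCube d × unitCube d)}
    (hη : IsPlan (cubeVolume d) η) (hγ : IsPlan (cubeVolume d) γ) :
    ∃ p : cubeC1 d →ₗ[ℝ] ℝ, (∃ K : ℝ≥0, ∀ f : cubeC1 d, ‖p f‖ₑ ≤ K * cubeC1Norm f) ∧
      ∀ (ν : Measure (C(unitInterval, unitCube d) × unitCube d)) (ρ : cubeC1 d),
        IsProbabilityMeasure ν →
        HasDensity (cubeVolume d) ν ρ.1 → cubeC1Norm (ρ - 1) ≤ 2⁻¹ → Connects ν η γ →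
        ((p (ρ - 1) : ℝ) : EReal) +
            (relaxedDistSq (cubeVolume d) cubePathAction η γ : EReal) ≤
          (flowAction cubePathAction ν : EReal) := by
  have hA := isPathAction_cubePathAction (d := d)
  have hflex := isPatch_cube.isFlexible hA
  rw [image_toCube] at hflex
  obtain ⟨p, ⟨K, hK⟩, hp⟩ := exists_pressure hA hflex hη hγ
  refine ⟨p ∘ₗ (cubeC1 d).val.toLinearMap, ⟨K, fun f => ?_⟩, fun ν ρ hν hρ hn hc => ?_⟩
  · refine (hK f.1).trans ?_
    gcongr
    exact timeNorm_le_cubeC1Norm f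
  · exact hp ν ρ.1 hν hρ (measurable_cubeC1 ρ)
      ((timeNorm_le_cubeC1Norm (ρ - 1)).trans hn) hc

end CubePatch

end GeneralizedFlow

end

noncomputable section

namespace GeneralizedFlow

/-! ### Charts of a Riemannian manifold -/

section Chart

variable {d : ℕ} {M : Type*} [MetricSpace M] [ChartedSpace (EuclideanSpace ℝ (Fin d)) M]
  [RiemannianBundle (fun x : M => TangentSpace (𝓡 d) x)]

variable (d M) in
theorem isContinuousRiemannianBundle [IsManifold (𝓡 d) 1 M] {n : ℕ∞ω}
    [h : IsContMDiffRiemannianBundle (𝓡 d) n (EuclideanSpace ℝ (Fin d))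
      (fun x : M => TangentSpace (𝓡 d) x)] :
    IsContinuousRiemannianBundle (EuclideanSpace ℝ (Fin d))
      (fun x : M => TangentSpace (𝓡 d) x) := by
  obtain ⟨g, hg, hg'⟩ := h.exists_contMDiff
  exact ⟨g, hg.continuous, hg'⟩

attribute [local instance] normedAddCommGroupTangentSpaceVectorSpace
attribute [local instance] normedSpaceTangentSpaceVectorSpace

theorem eventually_enorm_mfderiv_chartAt_le [IsManifold (𝓡 d) 1 M]
    [IsContinuousRiemannianBundle (EuclideanSpace ℝ (Fin d))
      (fun x : M => TangentSpace (𝓡 d) x)] (x : M) :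
    ∃ C : ℝ≥0, ∀ᶠ y in 𝓝 x, ∀ v : TangentSpace (𝓡 d) y,
      ‖(mfderiv (𝓡 d) (𝓡 d) (chartAt (EuclideanSpace ℝ (Fin d)) x) y v :
        EuclideanSpace ℝ (Fin d))‖ₑ ≤ C * ‖v‖ₑ := by
  obtain ⟨C, -, h⟩ := eventually_enorm_mfderiv_extChartAt_lt (𝓡 d) x
  refine ⟨C, h.mono fun y hy v => ?_⟩
  refine (ContinuousLinearMap.le_opENorm
    (mfderiv (𝓡 d) (𝓡 d) (chartAt (EuclideanSpace ℝ (Fin d)) x) y) v).trans ?_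
  gcongr
  exact hy.le

theorem eventually_enorm_mfderiv_chartAt_symm_le [IsManifold (𝓡 d) 1 M]
    [IsContinuousRiemannianBundle (EuclideanSpace ℝ (Fin d))
      (fun x : M => TangentSpace (𝓡 d) x)] (x : M) :
    ∃ C : ℝ≥0, ∀ᶠ y in 𝓝 (chartAt (EuclideanSpace ℝ (Fin d)) x x),
      ∀ v : EuclideanSpace ℝ (Fin d),
        ‖mfderiv (𝓡 d) (𝓡 d) (chartAt (EuclideanSpace ℝ (Fin d)) x).symm y v‖ₑ ≤ C * ‖v‖ₑ := by
  obtain ⟨C, -, h⟩ := eventually_enorm_mfderivWithin_symm_extChartAt_lt (𝓡 d) x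
  simp only [modelWithCornersSelf_coe, range_id, nhdsWithin_univ, mfderivWithin_univ] at h
  refine ⟨C, h.mono fun y hy v => ?_⟩
  refine (ContinuousLinearMap.le_opENorm
    (mfderiv (𝓡 d) (𝓡 d) (chartAt (EuclideanSpace ℝ (Fin d)) x).symm y) v).trans ?_
  exact mul_le_mul' hy.le le_rfl

end Chart

/-! ### Comparison of the Euclidean and Riemannian metrics in a chart -/

section ChartBall

variable {d : ℕ} {M : Type*} [MetricSpace M] [ChartedSpace (EuclideanSpace ℝ (Fin d)) M]

theorem mfderiv_comp_mfderiv_symm [IsManifold (𝓡 d) 1 M]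
    {φ : OpenPartialHomeomorph M (EuclideanSpace ℝ (Fin d))}
    (hφ : φ ∈ atlas (EuclideanSpace ℝ (Fin d)) M) {y : EuclideanSpace ℝ (Fin d)}
    (hy : y ∈ φ.target) (v : EuclideanSpace ℝ (Fin d)) :
    mfderiv (𝓡 d) (𝓡 d) φ (φ.symm y) (mfderiv (𝓡 d) (𝓡 d) φ.symm y v) = v := by
  have h1 := (mdifferentiableAt_atlas (I := 𝓡 d) hφ (φ.map_target hy)).hasMFDerivAt
  have h2 := (mdifferentiableAt_atlas_symm (I := 𝓡 d) hφ hy).hasMFDerivAt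
  have h3 := (h1.comp y h2).mfderiv
  have h4 : φ ∘ φ.symm =ᶠ[𝓝 y] id :=
    Filter.eventuallyEq_of_mem (φ.open_target.mem_nhds hy) fun z hz => φ.right_inv hz
  have h5 := h4.mfderiv_eq (I := 𝓡 d) (I' := 𝓡 d)
  rw [mfderiv_id] at h5
  have h6 := h3.symm.trans h5
  exact congrArg (fun A : EuclideanSpace ℝ (Fin d) →L[ℝ] EuclideanSpace ℝ (Fin d) => A v) h6

variable [RiemannianBundle (fun x : M => TangentSpace (𝓡 d) x)]

/-- The chart `φ` is defined over the convex set `B`, on which the Euclidean metric and the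
Riemannian metric are comparable up to the factor `C`. -/
structure IsComparable (φ : OpenPartialHomeomorph M (EuclideanSpace ℝ (Fin d))) (C : ℝ≥0)
    (B : Set (EuclideanSpace ℝ (Fin d))) : Prop where
  convex : Convex ℝ B
  subset_target : B ⊆ φ.target
  enorm_le : ∀ y ∈ B, ∀ v : EuclideanSpace ℝ (Fin d),
    ‖mfderiv (𝓡 d) (𝓡 d) φ.symm y v‖ₑ ≤ C * ‖v‖ₑ
  le_enorm : ∀ y ∈ B, ∀ v : EuclideanSpace ℝ (Fin d),
    ‖v‖ₑ ≤ C * ‖mfderiv (𝓡 d) (𝓡 d) φ.symm y v‖ₑ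

theorem exists_isComparable [IsManifold (𝓡 d) 1 M]
    [IsContinuousRiemannianBundle (EuclideanSpace ℝ (Fin d))
      (fun x : M => TangentSpace (𝓡 d) x)] (x : M) :
    ∃ (C : ℝ≥0) (r : ℝ), 0 < r ∧ IsComparable (chartAt (EuclideanSpace ℝ (Fin d)) x) C
      (Metric.closedBall (chartAt (EuclideanSpace ℝ (Fin d)) x x) r) := by
  set φ := chartAt (EuclideanSpace ℝ (Fin d)) x
  obtain ⟨C₁, h₁⟩ := eventually_enorm_mfderiv_chartAt_le (d := d) x
  obtain ⟨C₂, h₂⟩ := eventually_enorm_mfderiv_chartAt_symm_le (d := d) x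
  have hx : φ x ∈ φ.target := mem_chart_target _ x
  have hc : Filter.Tendsto φ.symm (𝓝 (φ x)) (𝓝 x) := by
    have := (φ.continuousAt_symm hx).tendsto
    rwa [φ.left_inv (mem_chart_source _ x)] at this
  obtain ⟨r, r0, hr⟩ := Metric.nhds_basis_closedBall.eventually_iff.1
    ((φ.open_target.eventually_mem hx).and (h₂.and (hc.eventually h₁)))
  refine ⟨max C₁ C₂, r, r0, convex_closedBall _ _, fun y hy => (hr hy).1, fun y hy v => ?_,
    fun y hy v => ?_⟩
  · refine ((hr hy).2.1 v).trans ?_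
    gcongr
    exact le_max_right _ _
  · have := (hr hy).2.2 (mfderiv (𝓡 d) (𝓡 d) φ.symm y v)
    rw [mfderiv_comp_mfderiv_symm (chart_mem_atlas _ x) (hr hy).1] at this
    refine this.trans ?_
    gcongr
    exact le_max_left _ _

variable {φ : OpenPartialHomeomorph M (EuclideanSpace ℝ (Fin d))} {C : ℝ≥0}
  {B : Set (EuclideanSpace ℝ (Fin d))}

/-- The Riemannian distance is at most the length of the image of the coordinate segment, which
stays in the convex set `B`. -/
theorem IsComparable.edist_le [IsManifold (𝓡 d) 1 M] [IsRiemannianManifold (𝓡 d) M]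
    (h : IsComparable φ C B) (hφ : φ ∈ IsManifold.maximalAtlas (𝓡 d) 1 M)
    {y z : EuclideanSpace ℝ (Fin d)} (hy : y ∈ B) (hz : z ∈ B) :
    edist (φ.symm y) (φ.symm z) ≤ C * edist y z := by
  rw [IsRiemannianManifold.out (I := 𝓡 d) (φ.symm y) (φ.symm z)]
  let η := ContinuousAffineMap.lineMap (R := ℝ) y z
  have hη : MapsTo η (Icc 0 1) B := by
    intro t ht
    simp only [η, ContinuousAffineMap.coe_lineMap_eq]
    exact h.convex.lineMap_mem hy hz ht
  have hs : ContMDiff 𝓘(ℝ, ℝ) (𝓡 d) 1 η := (ContinuousAffineMap.contDiff η).contMDiff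
  have hγ : ContMDiffOn 𝓘(ℝ, ℝ) (𝓡 d) 1 (φ.symm ∘ η) (Icc 0 1) :=
    (contMDiffOn_symm_of_mem_maximalAtlas hφ).comp hs.contMDiffOn
      fun t ht => h.subset_target (hη ht)
  refine (Manifold.riemannianEDist_le_pathELength hγ (by simp [η, ContinuousAffineMap.coe_lineMap_eq])
    (by simp [η, ContinuousAffineMap.coe_lineMap_eq]) zero_le_one).trans ?_
  rw [← lintegral_fderiv_lineMap_eq_edist, Manifold.pathELength_eq_lintegral_mfderivWithin_Icc,
    ← lintegral_const_mul' _ _ ENNReal.coe_ne_top]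
  refine setLIntegral_mono' measurableSet_Icc fun t ht => ?_
  have hd := (((contMDiffOn_symm_of_mem_maximalAtlas hφ).contMDiffAt
    (φ.open_target.mem_nhds (h.subset_target (hη ht)))).mdifferentiableAt
      one_ne_zero).hasMFDerivAt
  have hc := (hd.comp_hasMFDerivWithinAt (s := Icc 0 1) t
    (hs.mdifferentiable one_ne_zero t).mdifferentiableWithinAt.hasMFDerivWithinAt).mfderivWithin
    (by
      rw [uniqueMDiffWithinAt_iff_uniqueDiffWithinAt]
      exact uniqueDiffOn_Icc zero_lt_one t ht)
  rw [hc]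
  refine (h.enorm_le _ (hη ht) _).trans_eq ?_
  rw [mfderivWithin_eq_fderivWithin]
  rfl

end ChartBall

end GeneralizedFlow

end

noncomputable section

namespace GeneralizedFlow

/-! ### Action and volume density in a chart -/

section ChartAction

variable {d : ℕ} {M : Type*} [MetricSpace M] [ChartedSpace (EuclideanSpace ℝ (Fin d)) M]
  [RiemannianBundle (fun x : M => TangentSpace (𝓡 d) x)]
  {φ : OpenPartialHomeomorph M (EuclideanSpace ℝ (Fin d))} {C : ℝ≥0}
  {B : Set (EuclideanSpace ℝ (Fin d))}

theorem IsComparable.pathAction_le [IsManifold (𝓡 d) 1 M] [IsRiemannianManifold (𝓡 d) M]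
    (h : IsComparable φ C B) (hφ : φ ∈ atlas (EuclideanSpace ℝ (Fin d)) M)
    {c : C(unitInterval, M)} {L : ℝ} (hc : ∀ t, c t ∈ φ.symm '' B)
    (hL : ∀ s t : unitInterval, dist (φ (c s)) (φ (c t)) ≤ L * |(s : ℝ) - t|) :
    pathAction d c ≤ ((C * Real.toNNReal L) ^ 2 : ℝ≥0) := by
  have hy := lipschitzWith_comp_extendPath hL
  set y : ℝ → EuclideanSpace ℝ (Fin d) := fun t => φ (extendPath c t)
  have hB : ∀ t, y t ∈ B ∧ φ.symm (y t) = extendPath c t := by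
    intro t
    obtain ⟨b, hb, hbt⟩ := hc (projIcc 0 1 zero_le_one t)
    have e : extendPath c t = φ.symm b := hbt.symm
    have : y t = b := by
      show φ (extendPath c t) = b
      rw [e, φ.right_inv (h.subset_target hb)]
    rw [this, e]
    exact ⟨hb, rfl⟩
  have hmax : φ ∈ IsManifold.maximalAtlas (𝓡 d) 1 M :=
    IsManifold.subset_maximalAtlas hφ
  refine speedAction_le (speed := fun (f : ℝ → M) t =>
    ‖mfderiv 𝓘(ℝ, ℝ) (𝓡 d) f t (1 : ℝ)‖ₑ) ?_ fun t => ?_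
  · refine LipschitzOnWith.absolutelyContinuousOnInterval (K := C * Real.toNNReal L)
      fun s _ t _ => ?_
    rw [← (hB s).2, ← (hB t).2]
    refine (h.edist_le hmax (hB s).1 (hB t).1).trans ?_
    rw [ENNReal.coe_mul, mul_assoc]
    gcongr
    exact hy s t
  · by_cases hd : MDifferentiableAt 𝓘(ℝ, ℝ) (𝓡 d) (extendPath c) t
    · have hsrc : extendPath c t ∈ φ.source := by
        rw [← (hB t).2]
        exact φ.map_target (h.subset_target (hB t).1)
      have hyd : MDifferentiableAt 𝓘(ℝ, ℝ) (𝓡 d) y t :=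
        (mdifferentiableAt_atlas (I := 𝓡 d) hφ hsrc).comp t hd
      have e : extendPath c = φ.symm ∘ y := funext fun s => (hB s).2.symm
      have hcomp := ((mdifferentiableAt_atlas_symm (I := 𝓡 d) hφ
        (h.subset_target (hB t).1)).hasMFDerivAt.comp t hyd.hasMFDerivAt).mfderiv
      show ‖mfderiv 𝓘(ℝ, ℝ) (𝓡 d) (extendPath c) t (1 : ℝ)‖ₑ ≤ _
      rw [e, hcomp]
      refine (h.enorm_le _ (hB t).1 (mfderiv 𝓘(ℝ, ℝ) (𝓡 d) y t (1 : ℝ))).trans ?_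
      rw [ENNReal.coe_mul]
      gcongr
      rw [mfderiv_eq_fderiv]
      have := norm_deriv_le_of_lipschitz (x₀ := t) hy
      rw [← fderiv_apply_one_eq_deriv] at this
      refine enorm_le_coe.2 ?_
      exact_mod_cast this
    · simp only [mfderiv_zero_of_not_mdifferentiableAt hd]
      exact enorm_zero.trans_le zero_le

theorem inner_tangentSpace_congr {p q : M} (h : p = q) {v w : TangentSpace (𝓡 d) p}
    {v' w' : TangentSpace (𝓡 d) q}
    (hv : (v : EuclideanSpace ℝ (Fin d)) = (v' : EuclideanSpace ℝ (Fin d)))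
    (hw : (w : EuclideanSpace ℝ (Fin d)) = (w' : EuclideanSpace ℝ (Fin d))) :
    (inner ℝ v w : ℝ) = inner ℝ v' w' := by
  subst h
  have hv : v = v' := hv
  have hw : w = w' := hw
  rw [hv, hw]

/-- The matrix of the Riemannian metric in the chart `φ`. -/
def gram (φ : OpenPartialHomeomorph M (EuclideanSpace ℝ (Fin d)))
    (y : EuclideanSpace ℝ (Fin d)) : Matrix (Fin d) (Fin d) ℝ :=
  Matrix.of fun i j => inner ℝ (coordVector φ y i) (coordVector φ y j)

theorem gram_quadratic (φ : OpenPartialHomeomorph M (EuclideanSpace ℝ (Fin d)))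
    (y v w : EuclideanSpace ℝ (Fin d)) :
    (v : Fin d → ℝ) ⬝ᵥ (gram φ y).mulVec w =
      inner ℝ (mfderiv (𝓡 d) (𝓡 d) φ.symm y v) (mfderiv (𝓡 d) (𝓡 d) φ.symm y w) := by
  have hv : ∀ v : EuclideanSpace ℝ (Fin d), mfderiv (𝓡 d) (𝓡 d) φ.symm y v =
      ∑ i, v i • coordVector φ y i := by
    intro v
    conv_lhs => rw [← (EuclideanSpace.basisFun (Fin d) ℝ).sum_repr v]
    refine (map_sum (mfderiv (𝓡 d) (𝓡 d) φ.symm y) _ _).trans ?_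
    refine Finset.sum_congr rfl fun i _ => ?_
    refine ((mfderiv (𝓡 d) (𝓡 d) φ.symm y).map_smul _ _).trans ?_
    rw [EuclideanSpace.basisFun_apply]
    rfl
  rw [hv v, hv w, sum_inner]
  simp only [dotProduct, Matrix.mulVec, inner_sum, real_inner_smul_left, real_inner_smul_right,
    gram, Matrix.of_apply, Finset.mul_sum]
  refine Finset.sum_congr rfl fun i _ => Finset.sum_congr rfl fun j _ => ?_
  ring

theorem isHermitian_gram (φ : OpenPartialHomeomorph M (EuclideanSpace ℝ (Fin d)))
    (y : EuclideanSpace ℝ (Fin d)) : (gram φ y).IsHermitian := by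
  ext i j
  simp [gram, real_inner_comm]

/-- On a unit eigenvector `u` the eigenvalue is the squared Riemannian norm of the image of `u`.
Comparability bounds every eigenvalue above by `C ^ 2` and below by its inverse. -/
theorem IsComparable.det_gram_mem (h : IsComparable φ C B) {y : EuclideanSpace ℝ (Fin d)}
    (hy : y ∈ B) : (gram φ y).det ≤ ((C : ℝ) ^ 2) ^ d ∧ 1 ≤ ((C : ℝ) ^ 2) ^ d * (gram φ y).det := by
  have hG := isHermitian_gram φ y
  set u : Fin d → EuclideanSpace ℝ (Fin d) := fun i => hG.eigenvectorBasis i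
  have hev : ∀ i, hG.eigenvalues i = ‖mfderiv (𝓡 d) (𝓡 d) φ.symm y (u i)‖ ^ 2 := by
    intro i
    rw [hG.eigenvalues_eq, ← real_inner_self_eq_norm_sq, ← gram_quadratic]
    rfl
  have hu : ∀ i, ‖u i‖ = 1 := fun i => hG.eigenvectorBasis.orthonormal.1 i
  have h1 : ∀ i, hG.eigenvalues i ≤ (C : ℝ) ^ 2 := by
    intro i
    have := h.enorm_le y hy (u i)
    rw [← ofReal_norm (u i), hu, ENNReal.ofReal_one, mul_one, enorm_le_coe] at this
    rw [hev]
    exact pow_le_pow_left₀ (norm_nonneg _) (by exact_mod_cast this) 2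
  have h2 : ∀ i, 1 ≤ (C : ℝ) ^ 2 * hG.eigenvalues i := by
    intro i
    have := h.le_enorm y hy (u i)
    rw [← ofReal_norm (u i), hu, ENNReal.ofReal_one, ← ofReal_norm] at this
    have h0 := norm_nonneg (mfderiv (𝓡 d) (𝓡 d) φ.symm y (u i))
    rw [hev, ← mul_pow]
    generalize ‖mfderiv (𝓡 d) (𝓡 d) φ.symm y (u i)‖ = t at this h0
    rw [← ENNReal.ofReal_coe_nnreal, ← ENNReal.ofReal_mul C.coe_nonneg, ← ENNReal.ofReal_one,
      ENNReal.ofReal_le_ofReal_iff (mul_nonneg C.coe_nonneg h0)] at this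
    exact one_le_pow₀ this
  have hdet : (gram φ y).det = ∏ i, hG.eigenvalues i := hG.det_eq_prod_eigenvalues
  have hcard : ((C : ℝ) ^ 2) ^ d = ∏ _i : Fin d, (C : ℝ) ^ 2 := by simp
  have h0 : ∀ i, 0 ≤ hG.eigenvalues i := fun i => by rw [hev]; positivity
  rw [hdet, hcard]
  refine ⟨Finset.prod_le_prod (fun i _ => h0 i) fun i _ => h1 i, ?_⟩
  rw [← Finset.prod_mul_distrib]
  calc (1 : ℝ) = ∏ _i : Fin d, 1 := by simp
    _ ≤ _ := Finset.prod_le_prod (fun _ _ => zero_le_one) fun i _ => h2 i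

theorem IsComparable.volumeDensity_le (h : IsComparable φ C B) {y : EuclideanSpace ℝ (Fin d)}
    (hy : y ∈ B) : volumeDensity φ y ≤ C ^ d := by
  refine Real.sqrt_le_iff.2 ⟨by positivity, (h.det_gram_mem hy).1.trans_eq ?_⟩
  ring

theorem IsComparable.one_le_volumeDensity (h : IsComparable φ C B) {y : EuclideanSpace ℝ (Fin d)}
    (hy : y ∈ B) : 1 ≤ C ^ d * volumeDensity φ y := by
  have h1 : (C : ℝ) ^ d = √ (((C : ℝ) ^ 2) ^ d) := by
    rw [← pow_mul, mul_comm, pow_mul, Real.sqrt_sq (by positivity)]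
  rw [h1, volumeDensity, ← Real.sqrt_mul (by positivity), Real.one_le_sqrt]
  exact (h.det_gram_mem hy).2

/-- With `J` the derivative of the transition map, the chain rule gives `gram ψ = Jᵀ * gram φ * J`;
take determinants and square roots. -/
theorem volumeDensity_eq_abs_det_mul [IsManifold (𝓡 d) 1 M]
    {φ ψ : OpenPartialHomeomorph M (EuclideanSpace ℝ (Fin d))}
    (hφ : φ ∈ atlas (EuclideanSpace ℝ (Fin d)) M) (hψ : ψ ∈ atlas (EuclideanSpace ℝ (Fin d)) M)
    {y : EuclideanSpace ℝ (Fin d)} (hy : y ∈ ψ.target) (hy' : ψ.symm y ∈ φ.source) :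
    HasFDerivAt (φ ∘ ψ.symm) (fderiv ℝ (φ ∘ ψ.symm) y) y ∧
    volumeDensity ψ y = |(fderiv ℝ (φ ∘ ψ.symm) y).det| * volumeDensity φ (φ (ψ.symm y)) := by
  have d1 := mdifferentiableAt_atlas_symm (I := 𝓡 d) hψ hy
  have d2 := mdifferentiableAt_atlas (I := 𝓡 d) hφ hy'
  have d3 : MDifferentiableAt (𝓡 d) (𝓡 d) (φ ∘ ψ.symm) y := d2.comp y d1
  have d4 : DifferentiableAt ℝ (φ ∘ ψ.symm) y := mdifferentiableAt_iff_differentiableAt.1 d3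
  refine ⟨d4.hasFDerivAt, ?_⟩
  set J := fderiv ℝ (φ ∘ ψ.symm) y with hJ
  have hφy : φ (ψ.symm y) ∈ φ.target := φ.map_source hy'
  have hback : φ.symm (φ (ψ.symm y)) = ψ.symm y := φ.left_inv hy'
  have hev : ψ.symm =ᶠ[𝓝 y] φ.symm ∘ (φ ∘ ψ.symm) := by
    filter_upwards [(ψ.isOpen_inter_preimage_symm φ.open_source).mem_nhds ⟨hy, hy'⟩] with z hz
    exact (φ.left_inv hz.2).symm
  have hchain : ∀ v : EuclideanSpace ℝ (Fin d),
      (mfderiv (𝓡 d) (𝓡 d) ψ.symm y v : EuclideanSpace ℝ (Fin d)) =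
        mfderiv (𝓡 d) (𝓡 d) φ.symm (φ (ψ.symm y)) (J v) := by
    intro v
    have e1 := hev.mfderiv_eq (I := 𝓡 d) (I' := 𝓡 d)
    have e2 := ((mdifferentiableAt_atlas_symm (I := 𝓡 d) hφ hφy).hasMFDerivAt.comp y
      d3.hasMFDerivAt).mfderiv
    rw [mfderiv_eq_fderiv] at e2
    have e3 := e1.trans e2
    exact congrArg (fun A : EuclideanSpace ℝ (Fin d) →L[ℝ] EuclideanSpace ℝ (Fin d) => A v) e3
  let b := (EuclideanSpace.basisFun (Fin d) ℝ).toBasis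
  let P := LinearMap.toMatrix b b J.toLinearMap
  have hPapp : ∀ i j, P i j = J (EuclideanSpace.single j 1) i := by
    intro i j
    simp [P, b, LinearMap.toMatrix_apply]
  have hgram : gram ψ y = P.transpose * gram φ (φ (ψ.symm y)) * P := by
    ext i j
    have e1 : gram ψ y i j = inner ℝ
        (mfderiv (𝓡 d) (𝓡 d) φ.symm (φ (ψ.symm y)) (J (EuclideanSpace.single i 1)))
        (mfderiv (𝓡 d) (𝓡 d) φ.symm (φ (ψ.symm y)) (J (EuclideanSpace.single j 1))) :=
      inner_tangentSpace_congr hback.symm (hchain _) (hchain _)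
    rw [e1, ← gram_quadratic, Matrix.mul_assoc]
    simp only [Matrix.mul_apply, Matrix.transpose_apply, dotProduct, Matrix.mulVec, hPapp]
  have hdet : (gram ψ y).det = J.det ^ 2 * (gram φ (φ (ψ.symm y))).det := by
    have : P.det = J.det := LinearMap.det_toMatrix b J.toLinearMap
    rw [hgram, Matrix.det_mul, Matrix.det_mul, Matrix.det_transpose, this]
    ring
  show √ (gram ψ y).det = _
  rw [hdet, Real.sqrt_mul (sq_nonneg _), Real.sqrt_sq_eq_abs]
  rfl

end ChartAction

end GeneralizedFlow

end

noncomputable section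

namespace GeneralizedFlow

section ChartPatch

variable {d : ℕ} {M : Type*} [MetricSpace M]
  {φ : OpenPartialHomeomorph M (EuclideanSpace ℝ (Fin d))}
  {B : Set (EuclideanSpace ℝ (Fin d))}

open Classical in
/-- The inverse of the chart `φ` on `B`, extended to a measurable map. -/
def chartPatch (φ : OpenPartialHomeomorph M (EuclideanSpace ℝ (Fin d)))
    (B : Set (EuclideanSpace ℝ (Fin d))) (x : M) : EuclideanSpace ℝ (Fin d) → M :=
  B.piecewise φ.symm fun _ => x

open Classical in
theorem chartPatch_of_mem {x : M} {y : EuclideanSpace ℝ (Fin d)} (hy : y ∈ B) :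
    chartPatch φ B x y = φ.symm y :=
  piecewise_eq_of_mem _ _ _ hy

theorem image_chartPatch (x : M) : chartPatch φ B x '' B = φ.symm '' B :=
  image_congr fun _ hy => chartPatch_of_mem hy

end ChartPatch

/-! ### Riemannian volume in a chart, and coordinate patches -/

section ChartVolume

variable {d : ℕ} {M : Type*} [MetricSpace M] [MeasurableSpace M] [BorelSpace M]
  [ChartedSpace (EuclideanSpace ℝ (Fin d)) M]
  [RiemannianBundle (fun x : M => TangentSpace (𝓡 d) x)]
  {φ ψ : OpenPartialHomeomorph M (EuclideanSpace ℝ (Fin d))}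

theorem chartVolume_apply (φ : OpenPartialHomeomorph M (EuclideanSpace ℝ (Fin d))) {A : Set M}
    (hA : MeasurableSet A) : chartVolume φ A =
      ∫⁻ y in φ.symm ⁻¹' A ∩ φ.target, ENNReal.ofReal (volumeDensity φ y) := by
  have h : AEMeasurable φ.symm ((volume.restrict φ.target).withDensity
      (fun y => ENNReal.ofReal (volumeDensity φ y))) :=
    (φ.continuousOn_symm.aemeasurable φ.open_target.measurableSet).mono_ac
      (withDensity_absolutelyContinuous _ _)
  rw [chartVolume, Measure.map_apply_of_aemeasurable h hA, withDensity_apply',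
    Measure.restrict_restrict' φ.open_target.measurableSet]

/-- The change of variables formula for the transition map, whose Jacobian is the ratio of the
volume densities. -/
theorem restrict_chartVolume_le [IsManifold (𝓡 d) 1 M]
    (hφ : φ ∈ atlas (EuclideanSpace ℝ (Fin d)) M) (hψ : ψ ∈ atlas (EuclideanSpace ℝ (Fin d)) M) :
    (chartVolume ψ).restrict φ.source ≤ chartVolume φ := by
  refine Measure.le_iff.2 fun A hA => ?_
  rw [Measure.restrict_apply hA, chartVolume_apply ψ (hA.inter φ.open_source.measurableSet),
    chartVolume_apply φ hA]
  set V := ψ.symm ⁻¹' (A ∩ φ.source) ∩ ψ.target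
  have hV : ∀ y ∈ V, y ∈ ψ.target ∧ ψ.symm y ∈ φ.source := fun y hy => ⟨hy.2, hy.1.2⟩
  have hVm : MeasurableSet V := by
    classical
    have hp : Measurable (ψ.target.piecewise ψ.symm fun _ => ψ.symm 0) :=
      ψ.continuousOn_symm.measurable_piecewise continuousOn_const ψ.open_target.measurableSet
    have : V = (ψ.target.piecewise ψ.symm fun _ => ψ.symm 0) ⁻¹' (A ∩ φ.source) ∩ ψ.target := by
      ext y
      refine and_congr_left fun hy => ?_
      simp only [mem_preimage, piecewise_eq_of_mem _ _ _ hy]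
    rw [this]
    exact (hp (hA.inter φ.open_source.measurableSet)).inter ψ.open_target.measurableSet
  have hinj : InjOn (φ ∘ ψ.symm) V := fun y hy z hz hyz =>
    ψ.symm.injOn (hV y hy).1 (hV z hz).1 (φ.injOn (hV y hy).2 (hV z hz).2 hyz)
  calc ∫⁻ y in V, ENNReal.ofReal (volumeDensity ψ y)
      = ∫⁻ y in V, ENNReal.ofReal |(fderiv ℝ (φ ∘ ψ.symm) y).det| *
          ENNReal.ofReal (volumeDensity φ ((φ ∘ ψ.symm) y)) := by
        refine setLIntegral_congr_fun hVm fun y hy => ?_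
        rw [(volumeDensity_eq_abs_det_mul hφ hψ (hV y hy).1 (hV y hy).2).2,
          ENNReal.ofReal_mul (abs_nonneg _)]
        rfl
    _ = ∫⁻ y in (φ ∘ ψ.symm) '' V, ENNReal.ofReal (volumeDensity φ y) :=
        (lintegral_image_eq_lintegral_abs_det_fderiv_mul volume hVm (fun y hy =>
          (volumeDensity_eq_abs_det_mul hφ hψ (hV y hy).1 (hV y hy).2).1.hasFDerivWithinAt)
          hinj fun y => ENNReal.ofReal (volumeDensity φ y)).symm
    _ ≤ ∫⁻ y in φ.symm ⁻¹' A ∩ φ.target, ENNReal.ofReal (volumeDensity φ y) := by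
        refine lintegral_mono_set ?_
        rintro _ ⟨y, hy, rfl⟩
        refine ⟨?_, φ.map_source (hV y hy).2⟩
        rw [mem_preimage, Function.comp_apply, φ.left_inv (hV y hy).2]
        exact hy.1.1

theorem restrict_riemannianVolume_source [IsManifold (𝓡 d) 1 M] (x : M) :
    (riemannianVolume d M).restrict (chartAt (EuclideanSpace ℝ (Fin d)) x).source =
      (chartVolume (chartAt (EuclideanSpace ℝ (Fin d)) x)).restrict
        (chartAt (EuclideanSpace ℝ (Fin d)) x).source := by
  set φ := chartAt (EuclideanSpace ℝ (Fin d)) x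
  have hm : MeasurableSet φ.source := φ.open_source.measurableSet
  refine le_antisymm ?_ (Measure.restrict_mono le_rfl (le_iSup (fun x : M =>
    chartVolume (chartAt (EuclideanSpace ℝ (Fin d)) x)) x))
  -- It suffices to bound each chart volume: its part over `φ.source` is below `chartVolume φ`, the
  -- other part below the total volume. Restricting to `φ.source` then removes the second term.
  have h : riemannianVolume d M ≤
      chartVolume φ + (riemannianVolume d M).restrict φ.sourceᶜ := by
    refine iSup_le fun z => ?_
    rw [← Measure.restrict_add_restrict_compl (μ := chartVolume _) hm]
    exact add_le_add (restrict_chartVolume_le (chart_mem_atlas _ x) (chart_mem_atlas _ z))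
      (Measure.restrict_mono le_rfl (le_iSup (fun x : M =>
        chartVolume (chartAt (EuclideanSpace ℝ (Fin d)) x)) z))
  refine (Measure.restrict_mono (le_refl φ.source) h).trans ?_
  rw [Measure.restrict_add, Measure.restrict_restrict hm, inter_compl_self,
    Measure.restrict_empty, add_zero]

variable {B : Set (EuclideanSpace ℝ (Fin d))}

theorem isPatch_chartPatch [IsManifold (𝓡 d) 1 M] [IsRiemannianManifold (𝓡 d) M] {x : M} {C : ℝ≥0}
    (hB : IsCompact B) (hB0 : volume B ≠ 0)
    (h : IsComparable (chartAt (EuclideanSpace ℝ (Fin d)) x) C B) :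
    IsPatch volume (riemannianVolume d M) (pathAction d) B
      (chartPatch (chartAt (EuclideanSpace ℝ (Fin d)) x) B x)
      (chartAt (EuclideanSpace ℝ (Fin d)) x)
      ((volume.restrict B).withDensity fun y =>
        ENNReal.ofReal (volumeDensity (chartAt (EuclideanSpace ℝ (Fin d)) x) y)) := by
  set φ := chartAt (EuclideanSpace ℝ (Fin d)) x
  set S := φ.symm '' B with hS
  have hBm : MeasurableSet B := hB.isClosed.measurableSet
  have hcont : ContinuousOn φ.symm B := φ.continuousOn_symm.mono h.subset_target
  have hSm : MeasurableSet S := (hB.image_of_continuousOn hcont).isClosed.measurableSet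
  have hSsub : S ⊆ φ.source := by
    rintro _ ⟨y, hy, rfl⟩
    exact φ.map_target (h.subset_target hy)
  have hmeas : Measurable (chartPatch φ B x) := by
    classical
    exact hcont.measurable_piecewise continuousOn_const hBm
  have hmap : ((volume.restrict B).withDensity fun y => ENNReal.ofReal (volumeDensity φ y)).map
      (chartPatch φ B x) = (riemannianVolume d M).restrict S := by
    have e : (riemannianVolume d M).restrict S = (chartVolume φ).restrict S := by
      rw [← inter_eq_left.2 hSsub, ← Measure.restrict_restrict hSm,
        restrict_riemannianVolume_source, Measure.restrict_restrict hSm]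
    rw [e]
    ext A hA
    rw [Measure.map_apply hmeas hA, withDensity_apply', Measure.restrict_restrict' hBm,
      Measure.restrict_apply hA, chartVolume_apply φ (hA.inter hSm)]
    congr 2
    ext y
    constructor
    · rintro ⟨h1, h2⟩
      rw [mem_preimage, chartPatch_of_mem h2] at h1
      exact ⟨⟨h1, mem_image_of_mem _ h2⟩, h.subset_target h2⟩
    · rintro ⟨⟨h1, b, hb, hby⟩, h2⟩
      have : b = y := φ.symm.injOn (h.subset_target hb) h2 hby
      subst this
      refine ⟨?_, hb⟩
      rwa [mem_preimage, chartPatch_of_mem hb]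
  have hvol : (volume.restrict B).map (chartPatch φ B x) ≤
      (C ^ d : ℝ≥0) • riemannianVolume d M := by
    refine le_trans ?_ (Measure.le_iff'.2 fun A => mul_le_mul_right
      (Measure.le_iff'.1 (Measure.restrict_le_self (s := S)) A) _ :
        (C ^ d : ℝ≥0) • (riemannianVolume d M).restrict S ≤ (C ^ d : ℝ≥0) • riemannianVolume d M)
    rw [← hmap, ← Measure.map_smul]
    refine Measure.map_mono ?_ hmeas
    refine Measure.le_iff.2 fun A hA => ?_
    rw [Measure.smul_apply, withDensity_apply', Measure.restrict_restrict hA, ENNReal.smul_def,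
      smul_eq_mul, ← lintegral_const_mul' _ _ ENNReal.coe_ne_top, Measure.restrict_apply hA,
      ← setLIntegral_one]
    refine setLIntegral_mono' (hA.inter hBm) fun y hy => ?_
    rw [← ENNReal.ofReal_coe_nnreal, ← ENNReal.ofReal_mul (NNReal.coe_nonneg _),
      ENNReal.one_le_ofReal]
    exact_mod_cast h.one_le_volumeDensity hy.2
  rw [← image_chartPatch x] at hS
  exact {
    convex := h.convex
    compact := hB
    measurable := hmeas
    continuousOn := hcont.congr fun y hy => chartPatch_of_mem hy
    continuousOn_inv := by
      rw [← hS]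
      exact φ.continuousOn.mono hSsub
    left_inv := fun y hy => by rw [chartPatch_of_mem hy, φ.right_inv (h.subset_target hy)]
    action_le := fun L => ⟨_, fun c hc hL =>
      h.pathAction_le (chart_mem_atlas _ x) (by rwa [image_chartPatch] at hc) hL⟩
    le_vol := by
      refine ⟨C ^ d, Measure.le_iff.2 fun A hA => ?_⟩
      rw [Measure.smul_apply, withDensity_apply', Measure.restrict_restrict hA, ENNReal.smul_def,
        smul_eq_mul, Measure.restrict_apply hA, ← setLIntegral_const]
      refine setLIntegral_mono' (hA.inter hBm) fun y hy => ?_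
      rw [← ENNReal.ofReal_coe_nnreal]
      exact ENNReal.ofReal_le_ofReal (by exact_mod_cast h.volumeDensity_le hy.2)
    map_eq := by rw [hmap, hS]
    map_vol_le := ⟨_, hvol⟩
    measure_ne_zero := by
      intro h0
      have := Measure.le_iff'.1 hvol S
      rw [Measure.map_apply hmeas hSm, Measure.smul_apply, hS, h0, smul_zero, nonpos_iff_eq_zero,
        Measure.restrict_apply' hBm] at this
      refine hB0 (measure_mono_null ?_ this)
      exact fun y hy => ⟨mem_image_of_mem _ hy, hy⟩ }

end ChartVolume

end GeneralizedFlow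

end

noncomputable section

namespace GeneralizedFlow

/-! ### Flexibility of a compact Riemannian manifold -/

section RiemannianFlexible

variable {d : ℕ} {M : Type*} [MetricSpace M]
  [ChartedSpace (EuclideanSpace ℝ (Fin d)) M]
  [RiemannianBundle (fun x : M => TangentSpace (𝓡 d) x)]

-- Distances in a metric space are finite, and here they are infima of lengths of `C¹` curves, so
-- any two points are joined by a curve.
variable (d M) in
theorem preconnectedSpace_of_isRiemannianManifold [IsRiemannianManifold (𝓡 d) M] :
    PreconnectedSpace M := by
  refine ⟨isPreconnected_of_forall_pair fun x _ y _ => ?_⟩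
  have h : Manifold.riemannianEDist (𝓡 d) x y < ⊤ := by
    rw [← IsRiemannianManifold.out (I := 𝓡 d) x y]
    exact edist_lt_top x y
  obtain ⟨γ, h0, h1, hγ, -⟩ := Manifold.exists_lt_of_riemannianEDist_lt h
  exact ⟨γ '' Icc 0 1, subset_univ _, ⟨0, by simp, h0⟩, ⟨1, by simp, h1⟩,
    isPreconnected_Icc.image γ hγ.continuousOn⟩

variable [MeasurableSpace M] [BorelSpace M] [IsManifold (𝓡 d) 1 M] [IsRiemannianManifold (𝓡 d) M]
  [IsContinuousRiemannianBundle (EuclideanSpace ℝ (Fin d)) (fun x : M => TangentSpace (𝓡 d) x)]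

theorem riemannianVolume_ne_zero_of_mem_nhds {x : M} {U : Set M} (hU : U ∈ 𝓝 x) :
    riemannianVolume d M U ≠ 0 := by
  obtain ⟨C, r, r0, h⟩ := exists_isComparable (d := d) x
  set φ := chartAt (EuclideanSpace ℝ (Fin d)) x
  have hB : Metric.closedBall (φ x) r ∈ 𝓝 (φ x) := Metric.closedBall_mem_nhds _ r0
  have hp := isPatch_chartPatch (x := x) (isCompact_closedBall (φ x) r)
    (Metric.measure_closedBall_pos volume _ r0).ne' h
  obtain ⟨C', hC'⟩ := hp.map_vol_le
  intro h0
  have hle := (Measure.le_map_apply hp.measurable.aemeasurable U).trans (Measure.le_iff'.1 hC' U)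
  rw [Measure.smul_apply, h0, smul_zero, nonpos_iff_eq_zero,
    Measure.restrict_apply' Metric.isClosed_closedBall.measurableSet] at hle
  refine (Measure.measure_pos_of_mem_nhds volume (Filter.inter_mem ?_ hB)).ne' hle
  have hx : φ x ∈ φ.target := mem_chart_target _ x
  have hc : φ.symm ⁻¹' U ∈ 𝓝 (φ x) := by
    refine (φ.continuousAt_symm hx).preimage_mem_nhds ?_
    rwa [φ.left_inv (mem_chart_source _ x)]
  filter_upwards [hc, hB] with y hy hy'
  rwa [mem_preimage, chartPatch_of_mem hy']

variable [CompactSpace M] [IsProbabilityMeasure (riemannianVolume d M)]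

variable (d) in
theorem exists_isFlexible_mem_nhds (x : M) : ∃ S ∈ 𝓝 x, MeasurableSet S ∧
    IsFlexible (riemannianVolume d M) (pathAction d) S := by
  obtain ⟨C, r, r0, h⟩ := exists_isComparable (d := d) x
  set φ := chartAt (EuclideanSpace ℝ (Fin d)) x
  have hp := isPatch_chartPatch (x := x) (isCompact_closedBall (φ x) r)
    (Metric.measure_closedBall_pos volume _ r0).ne' h
  refine ⟨_, ?_, (hp.compact.image_of_continuousOn hp.continuousOn).isClosed.measurableSet,
    hp.isFlexible (isPathAction_pathAction d)⟩
  rw [image_chartPatch]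
  have hc : φ ⁻¹' Metric.closedBall (φ x) r ∈ 𝓝 x :=
    (φ.continuousAt (mem_chart_source _ x)).preimage_mem_nhds (Metric.closedBall_mem_nhds _ r0)
  filter_upwards [hc, φ.open_source.mem_nhds (mem_chart_source _ x)] with y hy hy'
  exact ⟨φ y, hy, φ.left_inv hy'⟩

variable (d M) in
theorem isFlexible_univ_riemannianVolume :
    IsFlexible (riemannianVolume d M) (pathAction d) (univ : Set M) := by
  classical
  have := preconnectedSpace_of_isRiemannianManifold d M
  obtain ⟨x₀⟩ : Nonempty M := nonempty_of_isProbabilityMeasure (riemannianVolume d M)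
  choose S hS hSm hSf using exists_isFlexible_mem_nhds (M := M) d
  have hxS : ∀ x, x ∈ interior (S x) := fun x => mem_interior_iff_mem_nhds.2 (hS x)
  obtain ⟨t, ht⟩ := isCompact_univ.elim_finite_subcover (fun x => interior (S x))
    (fun _ => isOpen_interior) fun x _ => mem_iUnion.2 ⟨x, hxS x⟩
  have hcov : ∀ z, ∃ i ∈ t, z ∈ interior (S i) := fun z => by simpa using ht (mem_univ z)
  -- A maximal subfamily of the finite cover with flexible union. If it omitted a set, connectedness
  -- would make its open union meet that of the omitted sets; the overlap is a neighbourhood of some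
  -- point and has positive volume, so the family could be enlarged.
  set F := t.powerset.filter fun J => J.Nonempty ∧
    IsFlexible (riemannianVolume d M) (pathAction d) (⋃ j ∈ J, S j)
  have hF : F.Nonempty := by
    obtain ⟨i, hi, -⟩ := hcov x₀
    refine ⟨{i}, Finset.mem_filter.2 ⟨by simpa using hi, by simp, ?_⟩⟩
    simpa using hSf i
  obtain ⟨J, hJ, hmax⟩ := F.exists_max_image Finset.card hF
  obtain ⟨hJt, ⟨j₀, hj₀⟩, hJf⟩ := Finset.mem_filter.1 hJ
  rw [Finset.mem_powerset] at hJt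
  have hsub : ∀ i ∈ t, i ∈ J := by
    by_contra! hcon
    obtain ⟨i₀, hi₀, hi₀J⟩ := hcon
    obtain ⟨z, -, hzU, hzV⟩ := (isPreconnected_univ (α := M)) (⋃ j ∈ J, interior (S j))
      (⋃ i ∈ t \ J, interior (S i)) (isOpen_biUnion fun _ _ => isOpen_interior)
      (isOpen_biUnion fun _ _ => isOpen_interior)
      (fun z _ => by
        obtain ⟨i, hi, hz⟩ := hcov z
        by_cases hiJ : i ∈ J
        · exact .inl (mem_biUnion hiJ hz)
        · exact .inr (mem_biUnion (Finset.mem_sdiff.2 ⟨hi, hiJ⟩) hz))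
      ⟨j₀, mem_univ _, mem_biUnion hj₀ (hxS j₀)⟩
      ⟨i₀, mem_univ _, mem_biUnion (Finset.mem_sdiff.2 ⟨hi₀, hi₀J⟩) (hxS i₀)⟩
    obtain ⟨j, hj, hzj⟩ := mem_iUnion₂.1 hzU
    obtain ⟨i, hi, hzi⟩ := mem_iUnion₂.1 hzV
    rw [Finset.mem_sdiff] at hi
    have hne : riemannianVolume d M ((⋃ j ∈ J, S j) ∩ S i) ≠ 0 :=
      riemannianVolume_ne_zero_of_mem_nhds (x := z) (Filter.inter_mem
        (Filter.mem_of_superset (mem_interior_iff_mem_nhds.1 hzj) (subset_biUnion_of_mem hj))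
        (mem_interior_iff_mem_nhds.1 hzi))
    have hun := hJf.union (Finset.measurableSet_biUnion J fun j _ => hSm j) (hSm i) hne (hSf i)
    have := hmax (insert i J) (Finset.mem_filter.2 ⟨Finset.mem_powerset.2
      (Finset.insert_subset hi.1 hJt), Finset.insert_nonempty _ _, by
        rw [Finset.set_biUnion_insert, union_comm]; exact hun⟩)
    rw [Finset.card_insert_of_notMem hi.2] at this
    omega
  convert hJf
  refine (eq_univ_of_forall fun z => ?_).symm
  obtain ⟨i, hi, hz⟩ := hcov z
  exact mem_biUnion (hsub i hi) (interior_subset hz)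

end RiemannianFlexible

/-! ### The pressure on a Riemannian manifold -/

section RiemannianPressure

variable {d : ℕ} {M : Type*} [MetricSpace M] [ChartedSpace (EuclideanSpace ℝ (Fin d)) M]

theorem measurable_c1 [MeasurableSpace M] [BorelSpace M] (f : C1 d M) (t : unitInterval) :
    Measurable fun x => f (t, x) := by
  have h : Continuous f := f.contMDiff.continuous
  exact (h.comp (Continuous.prodMk_right t)).measurable

variable [RiemannianBundle (fun x : M => TangentSpace (𝓡 d) x)]

/-- The mean value inequality in time; the space derivative plays no role. -/
theorem timeNorm_le_c1Norm (f : C1 d M) : timeNorm f ≤ c1Norm f := by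
  have hle := fun z => le_iSup (fun z : unitInterval × M =>
    max ‖f z‖ₑ (max ‖timeDeriv f z‖ₑ ‖spaceDeriv f z‖ₑ)) z
  refine timeNorm_le_iff.2 ⟨fun z => (le_max_left _ _).trans (hle z), fun x s t => ?_⟩
  have h := enorm_sub_le_of_enorm_derivWithin_le
    (g := fun s => f (projIcc 0 1 zero_le_one s, x)) (K := c1Norm f) ?_ ?_ s.2 t.2
  · simp only [projIcc_val] at h
    exact h
  · have h1 : ContMDiffOn 𝓘(ℝ, ℝ) ((𝓡∂ 1).prod (𝓡 d)) 1
        (fun s : ℝ => (projIcc (0 : ℝ) 1 zero_le_one s, x)) (Icc 0 1) :=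
      contMDiffOn_projIcc.prodMk contMDiffOn_const
    exact mdifferentiableOn_iff_differentiableOn.1
      ((f.contMDiff.comp_contMDiffOn h1).mdifferentiableOn one_ne_zero)
  · intro t ht
    have := ((le_max_left _ _).trans (le_max_right _ _)).trans (hle (⟨t, ht⟩, x))
    exact this

theorem exists_pressure_riemannian [CompactSpace M] [MeasurableSpace M] [BorelSpace M]
    [IsManifold (𝓡 d) 1 M] [IsRiemannianManifold (𝓡 d) M]
    [IsContinuousRiemannianBundle (EuclideanSpace ℝ (Fin d)) (fun x : M => TangentSpace (𝓡 d) x)]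
    [IsProbabilityMeasure (riemannianVolume d M)] {η γ : Measure (M × M)}
    (hη : IsPlan (riemannianVolume d M) η) (hγ : IsPlan (riemannianVolume d M) γ) :
    ∃ p : C1 d M →ₗ[ℝ] ℝ, (∃ K : ℝ≥0, ∀ f : C1 d M, ‖p f‖ₑ ≤ K * c1Norm f) ∧
      ∀ (ν : Measure (C(unitInterval, M) × M)) (ρ : C1 d M), IsProbabilityMeasure ν →
        HasDensity (riemannianVolume d M) ν ρ → c1Norm (ρ - 1) ≤ 2⁻¹ → Connects ν η γ →
        ((p (ρ - 1) : ℝ) : EReal) +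
            (relaxedDistSq (riemannianVolume d M) (pathAction d) η γ : EReal) ≤
          (flowAction (pathAction d) ν : EReal) := by
  obtain ⟨p, ⟨K, hK⟩, hp⟩ := exists_pressure (isPathAction_pathAction d)
    (isFlexible_univ_riemannianVolume d M) hη hγ
  let ι : C1 d M →ₗ[ℝ] (unitInterval × M → ℝ) :=
    { toFun := fun f => f
      map_add' := fun _ _ => rfl
      map_smul' := fun _ _ => rfl }
  refine ⟨p ∘ₗ ι, ⟨K, fun f => ?_⟩, fun ν ρ hν hρ hn hc => ?_⟩
  · refine (hK f).trans ?_
    gcongr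
    exact timeNorm_le_c1Norm f
  · have e : ⇑(ρ - 1) = ⇑ρ - 1 := rfl
    have hle := (timeNorm_le_c1Norm (ρ - 1)).trans hn
    have hι : (p ∘ₗ ι) (ρ - 1) = p (⇑ρ - 1) := congrArg p e
    rw [e] at hle
    rw [hι]
    exact hp ν ρ hν hρ (measurable_c1 ρ) hle hc

end RiemannianPressure

end GeneralizedFlow

end

open GeneralizedFlow in
theorem theorem6p2 (d : ℕ) :
    -- compact Riemannian manifolds without boundary
    (∀ (M : Type*) [MetricSpace M] [CompactSpace M] [MeasurableSpace M] [BorelSpace M]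
      [ChartedSpace (EuclideanSpace ℝ (Fin d)) M] [IsManifold (𝓡 d) ∞ M]
      [RiemannianBundle (fun x : M => TangentSpace (𝓡 d) x)]
      [IsContMDiffRiemannianBundle (𝓡 d) ∞ (EuclideanSpace ℝ (Fin d))
        (fun x : M => TangentSpace (𝓡 d) x)]
      [IsRiemannianManifold (𝓡 d) M]
      [IsProbabilityMeasure (riemannianVolume d M)]
      (η γ : Measure (M × M)),
      IsPlan (riemannianVolume d M) η → IsPlan (riemannianVolume d M) γ →
      ∃ p : C1 d M →ₗ[ℝ] ℝ, (∃ K : ℝ≥0, ∀ f : C1 d M, ‖p f‖ₑ ≤ K * c1Norm f) ∧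
        ∀ (ν : Measure (C(unitInterval, M) × M)) (ρ : C1 d M), IsProbabilityMeasure ν →
          HasDensity (riemannianVolume d M) ν ρ → c1Norm (ρ - 1) ≤ 2⁻¹ → Connects ν η γ →
          ((p (ρ - 1) : ℝ) : EReal) +
              (relaxedDistSq (riemannianVolume d M) (pathAction d) η γ : EReal) ≤
            (flowAction (pathAction d) ν : EReal)) ∧
    -- the cube `[0,1]^d`
    (∀ η γ : Measure (unitCube d × unitCube d),
      IsPlan (cubeVolume d) η → IsPlan (cubeVolume d) γ →
      ∃ p : cubeC1 d →ₗ[ℝ] ℝ, (∃ K : ℝ≥0, ∀ f : cubeC1 d, ‖p f‖ₑ ≤ K * cubeC1Norm f) ∧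
        ∀ (ν : Measure (C(unitInterval, unitCube d) × unitCube d)) (ρ : cubeC1 d),
          IsProbabilityMeasure ν →
          HasDensity (cubeVolume d) ν ρ.1 → cubeC1Norm (ρ - 1) ≤ 2⁻¹ → Connects ν η γ →
          ((p (ρ - 1) : ℝ) : EReal) +
              (relaxedDistSq (cubeVolume d) cubePathAction η γ : EReal) ≤
            (flowAction cubePathAction ν : EReal)) := by
  refine ⟨?_, fun η γ hη hγ => exists_pressure_cube hη hγ⟩
  intro M _ _ _ _ _ _ _ _ _ _ η γ hη hγ
  -- Of the smoothness of the metric only its continuity is used, to compare it with the Euclidean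
  -- one in charts.
  have := isContinuousRiemannianBundle d M (n := ∞)
  exact exists_pressure_riemannian hη hγ
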